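/- **Conventions.** All vector spaces are complex. A *convex bornology* on a vector space $V$ is a family of subsets, called *bounded*, that contains the singletons and is closed under subsets, finite unions, sums $S+T$ and absolutely convex (disked) hulls. $V$ is *complete* if every bounded set is contained in a bounded absolutely convex set $T$ whose gauge is a complete norm on the linear span of $T$. A *complete bornological algebra* is a complete bornological vector space with an associative (not necessarily unital) bilinear multiplication for which $S\cdot T$ is bounded whenever $S$ and $T$ are. A map is *bounded* if it maps bounded sets to bounded sets. For a subset $S$ of an algebra let $S^\infty=\bigcup_{n\ge 1}S^n$. The algebra $N$ is *analytically nilpotent* if $S^\infty$ is bounded for every bounded $S\subseteq N$. An *analytically nilpotent extension* $N\overset{i}\rightarrowtail E\overset{p}\twoheadrightarrow A$ consists of complete bornological algebras $N,E,A$ and bounded homomorphisms $i,p$ such that $i$ is a bornological isomorphism onto $\ker p$ with the subspace bornology, $p$ induces a bornological isomorphism from $E/i(N)$ with the quotient bornology onto $A$, there is a bounded linear map $s\colon A\to E$ with $p\circ s=\mathrm{id}_A$, and $N$ is analytically nilpotent. A *lanilcur* is a bounded linear map $l\colon A\to B$ between complete bornological algebras whose curvature $\omega_l(a,b)=l(ab)-l(a)l(b)$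 is analytically nilpotent, that is, $\omega_l(S,S)^\infty$ is bounded for every bounded $S\subseteq A$. Let $C^\infty([0,1];B)=C^\infty([0,1])\mathbin{\hat\otimes}B$ (completed bornological tensor product; $C^\infty([0,1])$ carries the bounded bornology of the usual Fréchet topology), with the evaluation maps $\mathrm{ev}_t=\mathrm{ev}_t\mathbin{\hat\otimes}\mathrm{id}_B$. In the *homomorphism category* (respectively the *lanilcur category*) the morphisms are the bounded homomorphisms (respectively the lanilcurs), and a *smooth homotopy* between morphisms $\varphi_0,\varphi_1\colon A\to B$ is a morphism $H\colon A\to C^\infty([0,1];B)$ with $\mathrm{ev}_t\circ H=\varphi_t$ for $t=0,1$. In either category, $A$ is *smoothly contractible* if $\mathrm{id}_A$ is smoothly homotopic to $0$; a morphism $p\colon E\to A$ exhibits $A$ as a *smooth deformation retract* of $E$ if there are a morphism $s\colon A\to E$ with $p\circ s=\mathrm{id}_A$ and a smooth homotopy $H$ between $\mathrm{id}_E$ and $s\circ p$ with $\mathrm{ev}_t\circ H\circ s=s$ for all $t\in[0,1]$; and $f\colon A\to B$ is a *smooth homotopy equivalence* if there is a morphism $g\colon B\to A$ such that $g\circ f$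 and $f\circ g$ are smoothly homotopic to the identity maps. For a complete bornological algebra $A$ with unitization $A^+=\mathbb C\oplus A$, let $\Omega^0A=A$ and $\Omega^nA=A^+\otimes A^{\otimes n}\ni a_0\,da_1\cdots da_n$ for $n\ge1$ (noncommutative differential forms; $d1=0$). The *analytic tensor algebra* $\mathcal TA$ is the completion of the algebra $\bigoplus_n\Omega^{2n}A$ of even forms with the Fedosov product $x\odot y=xy-(-1)^{\deg x}dx\,dy$, with respect to the convex bornology that is generated by the sets $$\{a_0\,da_1\cdots da_{2n}: n\ge0,\ a_0,\dots,a_{2n}\in S\}\cup\{da_1\cdots da_{2n}: n\ge1,\ a_1,\dots,a_{2n}\in S\}$$ for bounded $S\subseteq A$. A bounded homomorphism $f\colon A\to B$ induces a bounded homomorphism $\mathcal Tf\colon\mathcal TA\to\mathcal TB$, $a_0\,da_1\cdots da_{2n}\mapsto f(a_0)\,df(a_1)\cdots df(a_{2n})$. **Theorem (Goodwillie-type theorem).** Let $N\overset{i}\rightarrowtail E\overset{p}\twoheadrightarrow A$ be an analytically nilpotent extension. Then 1. $N$ is smoothly contractible in the lanilcur category; 2. $p$ exhibits $A$ as a smooth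 deformation retract of $E$ in the lanilcur category; 3. $\mathcal TN$ is smoothly contractible in the homomorphism category; 4. $\mathcal Tp\colon\mathcal TE\to\mathcal TA$ exhibits $\mathcal TA$ as a smooth deformation retract of $\mathcal TE$ in the homomorphism category; 5. in particular, $\mathcal Tp$ is a smooth homotopy equivalence in the homomorphism category. -/

import Mathlib

open scoped TensorProduct ContDiff Pointwise Topology
open Bornology Filter

namespace BornAlg

section ConvexBornologies

variable {V W X : Type*} [AddCommGroup V] [Module ℂ V] [AddCommGroup W] [Module ℂ W]
  [AddCommGroup X] [Module ℂ X]

/-- A disk is a circled convex set; equivalently, an absolutely convex set. -/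
def IsDisk (S : Set V) : Prop :=
  ∀ x ∈ S, ∀ y ∈ S, ∀ a b : ℂ, ‖a‖ + ‖b‖ ≤ 1 → a • x + b • y ∈ S

/-- The disked hull: the smallest disk containing `S`. -/
def diskHull (S : Set V) : Set V := ⋂₀ {D | IsDisk D ∧ S ⊆ D}

/-- The sequence `x` is Cauchy for the gauge of the disk `S`. -/
def CauchyIn (S : Set V) (x : ℕ → V) : Prop :=
  ∀ ε : ℝ, 0 < ε → ∃ N, ∀ m ≥ N, ∀ n ≥ N, x m - x n ∈ (ε : ℂ) • S

/-- The sequence `x` converges to `y` for the gauge of the disk `S`. -/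
def LimIn (S : Set V) (x : ℕ → V) (y : V) : Prop :=
  ∀ ε : ℝ, 0 < ε → ∃ N, ∀ n ≥ N, x n - y ∈ (ε : ℂ) • S

/-- A completant disk: the gauge of `S` is a complete norm on the linear span of `S`. -/
structure IsCompletant (S : Set V) : Prop where
  disk : IsDisk S
  norming : ∀ x : V, (∀ ε : ℝ, 0 < ε → x ∈ (ε : ℂ) • S) → x = 0
  complete : ∀ x : ℕ → V, CauchyIn S x → ∃ y, LimIn S x y

theorem subset_diskHull (S : Set V) : S ⊆ diskHull S :=
  Set.subset_sInter fun _ hD => hD.2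

theorem diskHull_min {S D : Set V} (hD : IsDisk D) (h : S ⊆ D) : diskHull S ⊆ D :=
  Set.sInter_subset_of_mem ⟨hD, h⟩

theorem isDisk_diskHull (S : Set V) : IsDisk (diskHull S) :=
  fun x hx y hy a b hab D hD => hD.1 x (hx D hD) y (hy D hD) a b hab

theorem diskHull_mono {S T : Set V} (h : S ⊆ T) : diskHull S ⊆ diskHull T :=
  diskHull_min (isDisk_diskHull T) (h.trans (subset_diskHull T))

theorem IsDisk.smul_mem {S : Set V} (hS : IsDisk S) {x : V} (hx : x ∈ S) {a : ℂ}
    (ha : ‖a‖ ≤ 1) : a • x ∈ S := by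
  simpa using hS x hx x hx a 0 (by simpa using ha)

theorem IsDisk.neg_mem {S : Set V} (hS : IsDisk S) {x : V} (hx : x ∈ S) : -x ∈ S := by
  simpa using hS.smul_mem hx (a := -1) (by simp)

theorem IsDisk.zero_mem {S : Set V} (hS : IsDisk S) {x : V} (hx : x ∈ S) : (0 : V) ∈ S := by
  simpa using hS.smul_mem hx (a := 0) (by simp)

theorem IsDisk.preimage {D : Set W} (hD : IsDisk D) (f : V →ₗ[ℂ] W) : IsDisk (f ⁻¹' D) := by
  intro x hx y hy a b hab
  simpa using hD _ hx _ hy a b hab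

theorem IsDisk.image {D : Set V} (hD : IsDisk D) (f : V →ₗ[ℂ] W) : IsDisk (f '' D) := by
  rintro _ ⟨x, hx, rfl⟩ _ ⟨y, hy, rfl⟩ a b hab
  exact ⟨_, hD x hx y hy a b hab, by simp⟩

theorem map_diskHull_subset (f : V →ₗ[ℂ] W) (S : Set V) :
    f '' diskHull S ⊆ diskHull (f '' S) := by
  rw [Set.image_subset_iff]
  exact diskHull_min ((isDisk_diskHull _).preimage f)
    (Set.image_subset_iff.1 (subset_diskHull _))

theorem bilin_diskHull (B : V →ₗ[ℂ] W →ₗ[ℂ] X) {S : Set V} {T : Set W} {x : V} {y : W}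
    (hx : x ∈ diskHull S) (hy : y ∈ diskHull T) :
    B x y ∈ diskHull (Set.image2 (fun v w => B v w) S T) := by
  set D := diskHull (Set.image2 (fun v w => B v w) S T)
  have h1 : ∀ v ∈ S, ∀ w ∈ diskHull T, B v w ∈ D := by
    intro v hv
    have : diskHull T ⊆ (B v) ⁻¹' D := diskHull_min ((isDisk_diskHull _).preimage _)
      fun w hw => subset_diskHull _ ⟨v, hv, w, hw, rfl⟩
    exact fun w hw => this hw
  have h2 : diskHull S ⊆ (B.flip y) ⁻¹' D := diskHull_min ((isDisk_diskHull _).preimage _)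
    fun v hv => h1 v hv y hy
  exact h2 hx

theorem IsDisk.add_smul_mem {S : Set V} (hS : IsDisk S) {x y : V} {a b : ℝ} (ha : 0 ≤ a)
    (hb : 0 ≤ b) (hx : x ∈ (a : ℂ) • S) (hy : y ∈ (b : ℂ) • S) :
    x + y ∈ ((a + b : ℝ) : ℂ) • S := by
  obtain ⟨s, hs, rfl⟩ := hx
  obtain ⟨t, ht, rfl⟩ := hy
  by_cases h0 : a + b = 0
  · have ha' : a = 0 := by linarith
    have hb' : b = 0 := by linarith
    subst ha' hb'
    exact ⟨s, hs, by simp⟩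
  · have hp : 0 < a + b := lt_of_le_of_ne (by linarith) (Ne.symm h0)
    refine ⟨((a / (a + b) : ℝ) : ℂ) • s + ((b / (a + b) : ℝ) : ℂ) • t,
      hS s hs t ht _ _ ?_, ?_⟩
    · rw [Complex.norm_real, Complex.norm_real, Real.norm_of_nonneg (by positivity),
        Real.norm_of_nonneg (by positivity), ← add_div, div_self h0]
    · simp only [smul_add, smul_smul, ← Complex.ofReal_mul]
      rw [mul_div_cancel₀ _ h0, mul_div_cancel₀ _ h0]

theorem IsDisk.smul_subset {S : Set V} (hS : IsDisk S) {a : ℂ} {b : ℝ} (h : ‖a‖ ≤ b) :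
    a • S ⊆ (b : ℂ) • S := by
  rintro _ ⟨s, hs, rfl⟩
  by_cases hb : b = 0
  · have : a = 0 := by simpa [hb] using h
    exact ⟨s, hs, by simp [hb, this]⟩
  · have hb0 : 0 < b := lt_of_le_of_ne ((norm_nonneg a).trans h) (Ne.symm hb)
    refine ⟨(a / b) • s, hS.smul_mem hs ?_, ?_⟩
    · rw [norm_div, Complex.norm_real, Real.norm_of_nonneg hb0.le]
      exact (div_le_one hb0).2 h
    · have : (b : ℂ) ≠ 0 := by exact_mod_cast hb
      simp only [smul_smul]
      rw [mul_div_cancel₀ _ this]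

theorem CauchyIn.mono {S T : Set V} (h : S ⊆ T) {x : ℕ → V} (hx : CauchyIn S x) :
    CauchyIn T x := fun ε hε => by
  obtain ⟨N, hN⟩ := hx ε hε
  exact ⟨N, fun m hm n hn => Set.smul_set_mono h (hN m hm n hn)⟩

theorem LimIn.mono {S T : Set V} (h : S ⊆ T) {x : ℕ → V} {y : V} (hx : LimIn S x y) :
    LimIn T x y := fun ε hε => by
  obtain ⟨N, hN⟩ := hx ε hε
  exact ⟨N, fun n hn => Set.smul_set_mono h (hN n hn)⟩

theorem CauchyIn.map (f : V →ₗ[ℂ] W) {S : Set V} {x : ℕ → V} (hx : CauchyIn S x) :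
    CauchyIn (f '' S) (fun n => f (x n)) := fun ε hε => by
  obtain ⟨N, hN⟩ := hx ε hε
  refine ⟨N, fun m hm n hn => ?_⟩
  obtain ⟨s, hs, h⟩ := hN m hm n hn
  exact ⟨f s, ⟨s, hs, rfl⟩, by simp only at h ⊢; rw [← map_sub, ← h, map_smul]⟩

theorem LimIn.map (f : V →ₗ[ℂ] W) {S : Set V} {x : ℕ → V} {y : V} (hx : LimIn S x y) :
    LimIn (f '' S) (fun n => f (x n)) (f y) := fun ε hε => by
  obtain ⟨N, hN⟩ := hx ε hε
  refine ⟨N, fun n hn => ?_⟩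
  obtain ⟨s, hs, h⟩ := hN n hn
  exact ⟨f s, ⟨s, hs, rfl⟩, by simp only at h ⊢; rw [← map_sub, ← h, map_smul]⟩

theorem CauchyIn.add {S T : Set V} {x y : ℕ → V} (hx : CauchyIn S x) (hy : CauchyIn T y) :
    CauchyIn (S + T) (x + y) := fun ε hε => by
  obtain ⟨N, hN⟩ := hx ε hε
  obtain ⟨M, hM⟩ := hy ε hε
  refine ⟨max N M, fun m hm n hn => ?_⟩
  rw [smul_add]
  exact ⟨_, hN m (le_of_max_le_left hm) n (le_of_max_le_left hn), _,
    hM m (le_of_max_le_right hm) n (le_of_max_le_right hn), by simp only [Pi.add_apply]; abel⟩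

theorem LimIn.add {S T : Set V} {x y : ℕ → V} {u v : V} (hx : LimIn S x u) (hy : LimIn T y v) :
    LimIn (S + T) (x + y) (u + v) := fun ε hε => by
  obtain ⟨N, hN⟩ := hx ε hε
  obtain ⟨M, hM⟩ := hy ε hε
  refine ⟨max N M, fun n hn => ?_⟩
  rw [smul_add]
  exact ⟨_, hN n (le_of_max_le_left hn), _, hM n (le_of_max_le_right hn),
    by simp only [Pi.add_apply]; abel⟩

theorem CauchyIn.smul {S : Set V} {x : ℕ → V} (c : ℂ) (hx : CauchyIn S x) :
    CauchyIn (c • S) (c • x) := by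
  exact hx.map (LinearMap.lsmul ℂ V c)

theorem LimIn.smul {S : Set V} {x : ℕ → V} {y : V} (c : ℂ) (hx : LimIn S x y) :
    LimIn (c • S) (c • x) (c • y) := by
  exact hx.map (LinearMap.lsmul ℂ V c)

theorem CauchyIn.add_disk {S : Set V} (hS : IsDisk S) {x y : ℕ → V} (hx : CauchyIn S x)
    (hy : CauchyIn S y) : CauchyIn S (x + y) := fun ε hε => by
  obtain ⟨N, hN⟩ := hx (ε / 2) (by positivity)
  obtain ⟨M, hM⟩ := hy (ε / 2) (by positivity)
  refine ⟨max N M, fun m hm n hn => ?_⟩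
  have := hS.add_smul_mem (by positivity) (by positivity)
    (hN m (le_of_max_le_left hm) n (le_of_max_le_left hn))
    (hM m (le_of_max_le_right hm) n (le_of_max_le_right hn))
  rw [add_halves] at this
  convert this using 1
  simp only [Pi.add_apply]; abel

theorem CauchyIn.smul_disk {S : Set V} (hS : IsDisk S) {x : ℕ → V} (hx : CauchyIn S x) (c : ℂ) :
    CauchyIn S (c • x) := fun ε hε => by
  obtain ⟨N, hN⟩ := hx (ε / (‖c‖ + 1)) (by positivity)
  refine ⟨N, fun m hm n hn => ?_⟩
  obtain ⟨s, hs, h⟩ := hN m hm n hn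
  have h1 : ‖c * ((ε / (‖c‖ + 1) : ℝ) : ℂ)‖ ≤ ε := by
    rw [norm_mul, Complex.norm_real, Real.norm_of_nonneg (by positivity), ← mul_div_assoc,
      div_le_iff₀ (by positivity)]
    nlinarith
  refine hS.smul_subset h1 ⟨s, hs, ?_⟩
  simp only [Pi.smul_apply] at h ⊢
  rw [mul_smul, h, smul_sub]

theorem geom_sum_mem {S : Set V} (hS : IsDisk S) (h0 : (0 : V) ∈ S) (v : ℕ → V)
    (hv : ∀ j, v j ∈ S) (J m : ℕ) (hJ : J ≤ m) :
    ∑ j ∈ Finset.Ico J m, (((1 / 2 : ℝ) ^ (j + 1) : ℝ) : ℂ) • v j ∈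
      (((1 / 2 : ℝ) ^ J - (1 / 2 : ℝ) ^ m : ℝ) : ℂ) • S := by
  induction m, hJ using Nat.le_induction with
  | base => exact ⟨0, h0, by simp⟩
  | succ m hm ih =>
    rw [Finset.sum_Ico_succ_top hm]
    have h1 : (1 / 2 : ℝ) ^ m ≤ (1 / 2 : ℝ) ^ J :=
      pow_le_pow_of_le_one (by norm_num) (by norm_num) hm
    have := hS.add_smul_mem (sub_nonneg.2 h1) (by positivity) ih
      (⟨v m, hv m, rfl⟩ : (((1 / 2 : ℝ) ^ (m + 1) : ℝ) : ℂ) • v m ∈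
        (((1 / 2 : ℝ) ^ (m + 1) : ℝ) : ℂ) • S)
    convert this using 3
    ring

variable (V) in
/-- A convex (vector) bornology: a bornology that is stable under sums and disked hulls. -/
class ConvexBornology [Bornology V] : Prop where
  isBounded_add : ∀ S T : Set V, IsBounded S → IsBounded T → IsBounded (S + T)
  isBounded_diskHull : ∀ S : Set V, IsBounded S → IsBounded (diskHull S)

variable (V) in
/-- A complete bornological vector space: every bounded set is contained in a bounded
completant disk. -/
class CompleteBornology [Bornology V] : Prop extends ConvexBornology V where
  exists_completant : ∀ S : Set V, IsBounded S → ∃ T : Set V, IsBounded T ∧ IsCompletant T ∧ S ⊆ T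

/-- Boundedness of a map between bornological spaces: bounded sets go to bounded sets. -/
def BoundedMap {V W : Type*} [Bornology V] [Bornology W] (f : V → W) : Prop :=
  ∀ S : Set V, IsBounded S → IsBounded (f '' S)

theorem BoundedMap.comp {V W X : Type*} [Bornology V] [Bornology W] [Bornology X] {g : W → X}
    {f : V → W} (hg : BoundedMap g) (hf : BoundedMap f) : BoundedMap (g ∘ f) := fun S hS => by
  rw [Set.image_comp]
  exact hg _ (hf _ hS)

/-- Bornological convergence of a sequence. -/
def BornTendsto [Bornology V] (x : ℕ → V) (y : V) : Prop :=
  ∃ ε : ℕ → ℂ, Tendsto ε atTop (𝓝 0) ∧ ∃ S : Set V, IsBounded S ∧ ∀ n, x n - y ∈ ε n • S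

/-- Bornologically closed sets. -/
def IsBornClosed [Bornology V] (K : Set V) : Prop :=
  ∀ (x : ℕ → V) (y : V), (∀ n, x n ∈ K) → BornTendsto x y → y ∈ K

variable (V) in
/-- The smallest bornologically closed linear subspace, that is, the closure of `{0}`. -/
def sepKernel [Bornology V] : Submodule ℂ V :=
  sInf {K : Submodule ℂ V | IsBornClosed (K : Set V)}

theorem sepKernel_le [Bornology V] {K : Submodule ℂ V} (hK : IsBornClosed (K : Set V)) :
    sepKernel V ≤ K := sInf_le hK

theorem isBornClosed_sepKernel [Bornology V] : IsBornClosed (sepKernel V : Set V) := by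
  intro x y hx hxy
  simp only [sepKernel, SetLike.mem_coe, Submodule.mem_sInf, Set.mem_ofPred_eq] at hx ⊢
  exact fun K hK => hK x y (fun n => hx n K hK) hxy

theorem BornTendsto.map [Bornology V] [Bornology W] {f : V →ₗ[ℂ] W} (hf : BoundedMap f)
    {x : ℕ → V} {y : V} (h : BornTendsto x y) : BornTendsto (fun n => f (x n)) (f y) := by
  obtain ⟨ε, hε, S, hS, h⟩ := h
  refine ⟨ε, hε, f '' S, hf S hS, fun n => ?_⟩
  obtain ⟨s, hs, h⟩ := h n
  exact ⟨f s, ⟨s, hs, rfl⟩, by simp only at h ⊢; rw [← map_sub, ← h, map_smul]⟩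

theorem IsBornClosed.comap [Bornology V] [Bornology W] {f : V →ₗ[ℂ] W} (hf : BoundedMap f)
    {K : Submodule ℂ W} (hK : IsBornClosed (K : Set W)) :
    IsBornClosed (K.comap f : Set V) := fun _ _ hx hxy => hK _ _ hx (hxy.map hf)

theorem sepKernel_map [Bornology V] [Bornology W] {f : V →ₗ[ℂ] W} (hf : BoundedMap f) :
    sepKernel V ≤ (sepKernel W).comap f :=
  sepKernel_le (isBornClosed_sepKernel.comap hf)

section Convex

variable [Bornology V] [ConvexBornology V]

theorem isBounded_smul {S : Set V} (hS : IsBounded S) (c : ℂ) : IsBounded (c • S) := by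
  have key : ∀ n : ℕ, IsBounded ((n : ℂ) • diskHull S) := by
    intro n
    induction n with
    | zero =>
      refine isBounded_singleton (x := (0 : V)) |>.subset ?_
      rintro _ ⟨s, -, rfl⟩
      simp
    | succ n ih =>
      refine (ConvexBornology.isBounded_add _ _ ih
        (ConvexBornology.isBounded_diskHull S hS)).subset ?_
      rintro _ ⟨s, hs, rfl⟩
      exact ⟨_, ⟨s, hs, rfl⟩, s, hs, by simp [add_smul]⟩
  obtain ⟨n, hn⟩ := exists_nat_ge ‖c‖
  refine (key n).subset ((Set.smul_set_mono (subset_diskHull S)).trans ?_)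
  simpa using (isDisk_diskHull S).smul_subset hn

theorem CauchyIn.exists_tail {S : Set V} (hS : IsBounded S) {x : ℕ → V} (hx : CauchyIn S x) :
    ∃ T : Set V, IsBounded T ∧ ∀ᶠ n in atTop, x n ∈ T := by
  obtain ⟨N, hN⟩ := hx 1 one_pos
  refine ⟨{x N} + S, ConvexBornology.isBounded_add _ _ isBounded_singleton hS, ?_⟩
  filter_upwards [eventually_ge_atTop N] with n hn
  refine ⟨x N, rfl, x n - x N, ?_, by simp⟩
  simpa using hN n hn N le_rfl

end Convex

theorem LimIn.unique [Bornology V] [CompleteBornology V] {S T : Set V} (hS : IsBounded S)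
    (hT : IsBounded T) {x : ℕ → V} {y z : V} (hy : LimIn S x y) (hz : LimIn T x z) : y = z := by
  obtain ⟨U, -, hUc, hU⟩ := CompleteBornology.exists_completant (S ∪ T) (hS.union hT)
  have hy := hy.mono (Set.subset_union_left.trans hU)
  have hz := hz.mono (Set.subset_union_right.trans hU)
  refine sub_eq_zero.1 (hUc.norming _ fun ε hε => ?_)
  obtain ⟨N, hN⟩ := hy (ε / 2) (by positivity)
  obtain ⟨M, hM⟩ := hz (ε / 2) (by positivity)
  have h1 := hN (max N M) (le_max_left _ _)
  have h2 := hM (max N M) (le_max_right _ _)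
  obtain ⟨s, hs, h1⟩ := h1
  have h1' : y - x (max N M) ∈ ((ε / 2 : ℝ) : ℂ) • U :=
    ⟨-s, hUc.disk.neg_mem hs, by simp only at h1 ⊢; rw [smul_neg, h1]; abel⟩
  have := hUc.disk.add_smul_mem (by positivity) (by positivity) h1' h2
  simpa using this

theorem isBornClosed_bot [Bornology V] [CompleteBornology V] :
    IsBornClosed ((⊥ : Submodule ℂ V) : Set V) := by
  rintro x y hx ⟨ε, hε, S, hS, h⟩
  obtain ⟨U, -, hUc, hU⟩ := CompleteBornology.exists_completant S hS
  refine hUc.norming y fun δ hδ => ?_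
  obtain ⟨n, hn⟩ := (hε.norm.eventually (ge_mem_nhds (by simpa using hδ))).exists
  obtain ⟨s, hs, h⟩ := h n
  have hx0 : x n = 0 := by simpa using hx n
  have : -y ∈ (δ : ℂ) • U :=
    hUc.disk.smul_subset hn ⟨s, hU hs, by simpa [hx0] using h⟩
  obtain ⟨u, hu, h⟩ := this
  exact ⟨-u, hUc.disk.neg_mem hu, by simp only at h ⊢; rw [smul_neg, h, neg_neg]⟩

/-- The family of all subsets of the disked hulls of the members of a suitable family `E` of
sets, as a bornology. It is the convex bornology generated by the sets `E i`. -/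
@[reducible] def bornologyOfHulls {ι : Type*} (E : ι → Set V) (hne : ∃ i, (E i).Nonempty)
    (hadd : ∀ i j, ∃ k, ∀ x ∈ E i ∪ E j, (2 : ℂ) • x ∈ diskHull (E k))
    (hspan : ⊤ ≤ Submodule.span ℂ (⋃ i, E i)) : Bornology V :=
  Bornology.ofBounded {T | ∃ i, T ⊆ diskHull (E i)}
    (hne.imp fun _ _ => Set.empty_subset _)
    (fun _ ⟨i, hi⟩ _ h => ⟨i, h.trans hi⟩)
    (by
      rintro s ⟨i, hi⟩ t ⟨j, hj⟩
      obtain ⟨k, hk⟩ := hadd i j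
      have hk' : ∀ x ∈ E i ∪ E j, x ∈ diskHull (E k) := fun x hx => by
        have := (isDisk_diskHull (E k)).smul_mem (hk x hx) (a := 1 / 2) (by norm_num)
        simpa [smul_smul] using this
      exact ⟨k, Set.union_subset
        (hi.trans (diskHull_min (isDisk_diskHull _) fun x hx => hk' x (Or.inl hx)))
        (hj.trans (diskHull_min (isDisk_diskHull _) fun x hx => hk' x (Or.inr hx)))⟩)
    (by
      have hdbl : ∀ i, ∃ k, ∀ x ∈ diskHull (E i), (2 : ℂ) • x ∈ diskHull (E k) := fun i => by
        obtain ⟨k, hk⟩ := hadd i i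
        refine ⟨k, fun x hx => ?_⟩
        have : diskHull (E i) ⊆ (LinearMap.lsmul ℂ V 2) ⁻¹' diskHull (E k) :=
          diskHull_min ((isDisk_diskHull _).preimage _) fun x hx => hk x (Or.inl hx)
        exact this hx
      have hpow : ∀ (n : ℕ) i, ∃ k, ∀ x ∈ diskHull (E i), (2 ^ n : ℂ) • x ∈ diskHull (E k) := by
        intro n
        induction n with
        | zero => exact fun i => ⟨i, fun x hx => by simpa using hx⟩
        | succ n ih =>
          intro i
          obtain ⟨k, hk⟩ := ih i
          obtain ⟨l, hl⟩ := hdbl k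
          exact ⟨l, fun x hx => by
            have := hl _ (hk x hx)
            rwa [smul_smul, ← pow_succ'] at this⟩
      let M : Submodule ℂ V :=
        { carrier := {x | ∃ i, x ∈ diskHull (E i)}
          zero_mem' := by
            obtain ⟨i, x, hx⟩ := hne
            exact ⟨i, (isDisk_diskHull _).zero_mem (subset_diskHull _ hx)⟩
          add_mem' := by
            rintro x y ⟨i, hi⟩ ⟨j, hj⟩
            obtain ⟨k, hk⟩ := hadd i j
            have hx : (2 : ℂ) • x ∈ diskHull (E k) := by
              have : diskHull (E i) ⊆ (LinearMap.lsmul ℂ V 2) ⁻¹' diskHull (E k) :=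
                diskHull_min ((isDisk_diskHull _).preimage _) fun x hx => hk x (Or.inl hx)
              exact this hi
            have hy : (2 : ℂ) • y ∈ diskHull (E k) := by
              have : diskHull (E j) ⊆ (LinearMap.lsmul ℂ V 2) ⁻¹' diskHull (E k) :=
                diskHull_min ((isDisk_diskHull _).preimage _) fun x hx => hk x (Or.inr hx)
              exact this hj
            have := isDisk_diskHull (E k) _ hx _ hy (1 / 2) (1 / 2) (by norm_num)
            exact ⟨k, by simpa [smul_smul] using this⟩
          smul_mem' := by
            rintro c x ⟨i, hi⟩
            obtain ⟨n, hn⟩ := pow_unbounded_of_one_lt ‖c‖ (one_lt_two (α := ℝ))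
            obtain ⟨k, hk⟩ := hpow n i
            have := (isDisk_diskHull (E k)).smul_mem (hk x hi) (a := c / 2 ^ n) (by
              rw [norm_div, norm_pow, Complex.norm_ofNat]
              exact (div_le_one (by positivity)).2 hn.le)
            refine ⟨k, ?_⟩
            rwa [smul_smul, div_mul_cancel₀ _ (pow_ne_zero n two_ne_zero)] at this }
      intro x
      have hM : (⊤ : Submodule ℂ V) ≤ M := hspan.trans (Submodule.span_le.2 (by
        intro y hy
        obtain ⟨i, hi⟩ := Set.mem_iUnion.1 hy
        exact ⟨i, subset_diskHull _ hi⟩))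
      obtain ⟨i, hi⟩ := hM (Submodule.mem_top (x := x))
      exact ⟨i, Set.singleton_subset_iff.2 hi⟩)

theorem isBounded_bornologyOfHulls {ι : Type*} {E : ι → Set V} (hne : ∃ i, (E i).Nonempty)
    (hadd : ∀ i j, ∃ k, ∀ x ∈ E i ∪ E j, (2 : ℂ) • x ∈ diskHull (E k))
    (hspan : ⊤ ≤ Submodule.span ℂ (⋃ i, E i)) {T : Set V} :
    @IsBounded V (bornologyOfHulls E hne hadd hspan) T ↔ ∃ i, T ⊆ diskHull (E i) :=
  Bornology.isBounded_ofBounded_iff _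

theorem convexBornology_of_hulls [Bornology V] {ι : Type*} (E : ι → Set V)
    (hadd : ∀ i j, ∃ k, ∀ x ∈ E i ∪ E j, (2 : ℂ) • x ∈ diskHull (E k))
    (hb : ∀ T : Set V, IsBounded T ↔ ∃ i, T ⊆ diskHull (E i)) : ConvexBornology V where
  isBounded_add S T hS hT := by
    obtain ⟨i, hi⟩ := (hb S).1 hS
    obtain ⟨j, hj⟩ := (hb T).1 hT
    obtain ⟨k, hk⟩ := hadd i j
    refine (hb _).2 ⟨k, ?_⟩
    rintro _ ⟨x, hx, y, hy, rfl⟩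
    have h1 : diskHull (E i) ⊆ (LinearMap.lsmul ℂ V 2) ⁻¹' diskHull (E k) :=
      diskHull_min ((isDisk_diskHull _).preimage _) fun x hx => hk x (Or.inl hx)
    have h2 : diskHull (E j) ⊆ (LinearMap.lsmul ℂ V 2) ⁻¹' diskHull (E k) :=
      diskHull_min ((isDisk_diskHull _).preimage _) fun x hx => hk x (Or.inr hx)
    have := isDisk_diskHull (E k) _ (h1 (hi hx)) _ (h2 (hj hy)) (1 / 2) (1 / 2) (by norm_num)
    simpa [smul_smul] using this
  isBounded_diskHull S hS := by
    obtain ⟨i, hi⟩ := (hb S).1 hS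
    exact (hb _).2 ⟨i, diskHull_min (isDisk_diskHull _) hi⟩

end ConvexBornologies

section Algebras

/-- A (convex) bornological algebra over the complex numbers, not necessarily unital: a convex
bornological vector space with a bounded associative bilinear multiplication. -/
class BornologicalAlgebra (A : Type*) [NonUnitalRing A] [Module ℂ A] [Bornology A] : Prop extends
    ConvexBornology A, IsScalarTower ℂ A A, SMulCommClass ℂ A A where
  isBounded_mul : ∀ S T : Set A, IsBounded S → IsBounded T → IsBounded (S * T)

/-- A complete bornological algebra. -/
class CompleteBornologicalAlgebra (A : Type*) [NonUnitalRing A] [Module ℂ A] [Bornology A] :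
    Prop extends BornologicalAlgebra A, CompleteBornology A

variable {A B : Type*} [NonUnitalRing A] [Module ℂ A] [Bornology A]
  [NonUnitalRing B] [Module ℂ B] [Bornology B]

/-- Analytic nilpotence: `S^∞ = ⋃_{n ≥ 1} S^n` is bounded for every bounded `S`. The set `S^∞`
is the multiplicative subsemigroup generated by `S`. -/
def IsANilpotent (A : Type*) [NonUnitalRing A] [Bornology A] : Prop :=
  ∀ S : Set A, IsBounded S → IsBounded (Subsemigroup.closure S : Set A)

/-- The curvature of a linear map between algebras. -/
def curvature (l : A →ₗ[ℂ] B) (a b : A) : B := l (a * b) - l a * l b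

/-- A lanilcur: a bounded linear map with analytically nilpotent curvature. -/
structure IsLanilcur (l : A →ₗ[ℂ] B) : Prop where
  bounded : BoundedMap l
  curvature_bounded : ∀ S : Set A, IsBounded S →
    IsBounded (Subsemigroup.closure (Set.image2 (curvature l) S S) : Set B)

end Algebras

section Completion

variable {V W : Type*} [AddCommGroup V] [Module ℂ V] [Bornology V] [ConvexBornology V]
  [AddCommGroup W] [Module ℂ W] [Bornology W] [ConvexBornology W]

variable (V) in
/-- The space of bornological Cauchy sequences. -/
def cauchySubmodule : Submodule ℂ (ℕ → V) where
  carrier := {x | ∃ S : Set V, IsBounded S ∧ CauchyIn S x}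
  zero_mem' := ⟨{0}, isBounded_singleton, fun ε _ => ⟨0, fun m _ n _ => by simp⟩⟩
  add_mem' := by
    rintro x y ⟨S, hS, hx⟩ ⟨T, hT, hy⟩
    exact ⟨S + T, ConvexBornology.isBounded_add S T hS hT, hx.add hy⟩
  smul_mem' := by
    rintro c x ⟨S, hS, hx⟩
    exact ⟨c • S, isBounded_smul hS c, hx.smul c⟩

variable (V) in
/-- The space of bornological Cauchy sequences, as a type of its own. -/
def CauchySeqs : Type _ := cauchySubmodule V

instance CauchySeqs.instAddCommGroup : AddCommGroup (CauchySeqs V) := inferInstanceAs (AddCommGroup (cauchySubmodule V))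
instance CauchySeqs.instModule : Module ℂ (CauchySeqs V) := inferInstanceAs (Module ℂ (cauchySubmodule V))

/-- The underlying sequence. -/
def CauchySeqs.val : CauchySeqs V →ₗ[ℂ] (ℕ → V) := (cauchySubmodule V).subtype

theorem CauchySeqs.ext {x y : CauchySeqs V} (h : x.val = y.val) : x = y := Subtype.ext h

theorem CauchySeqs.cauchy (x : CauchySeqs V) : ∃ S : Set V, IsBounded S ∧ CauchyIn S x.val :=
  x.2

/-- The Cauchy sequences with respect to `S` that eventually lie in `S`. If `S` is a disk, this is
the set of the Cauchy sequences that represent the elements of (an open or closed) unit ball of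
the Hausdorff completion of the linear span of `S`, normed by the gauge of `S`. -/
def CauchySeqs.ball (S : Set V) : Set (CauchySeqs V) :=
  {x | (∀ᶠ n in atTop, x.val n ∈ S) ∧ CauchyIn S x.val}

theorem CauchySeqs.ball_mono {S T : Set V} (h : S ⊆ T) :
    CauchySeqs.ball S ⊆ CauchySeqs.ball T :=
  fun _ hx => ⟨hx.1.mono fun _ hn => h hn, hx.2.mono h⟩

theorem CauchySeqs.mem_ball (x : CauchySeqs V) : ∃ S : Set V, IsBounded S ∧ x ∈ ball S := by
  obtain ⟨S, hS, hx⟩ := x.cauchy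
  obtain ⟨T, hT, h⟩ := hx.exists_tail hS
  exact ⟨S ∪ T, hS.union hT, h.mono fun n hn => Or.inr hn, hx.mono Set.subset_union_left⟩

theorem CauchySeqs.isDisk_ball {S : Set V} (hS : IsDisk S) : IsDisk (ball S) := by
  rintro x ⟨hx, hx'⟩ y ⟨hy, hy'⟩ a b hab
  refine ⟨?_, fun ε hε => ?_⟩
  · filter_upwards [hx, hy] with n h1 h2
    simpa using hS _ h1 _ h2 a b hab
  · obtain ⟨N, hN⟩ := hx' ε hε
    obtain ⟨M, hM⟩ := hy' ε hε
    refine ⟨max N M, fun m hm n hn => ?_⟩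
    obtain ⟨s, hs, h1⟩ := hN m (le_of_max_le_left hm) n (le_of_max_le_left hn)
    obtain ⟨t, ht, h2⟩ := hM m (le_of_max_le_right hm) n (le_of_max_le_right hn)
    refine ⟨a • s + b • t, hS s hs t ht a b hab, ?_⟩
    simp only [map_add, map_smul, Pi.add_apply, Pi.smul_apply] at h1 h2 ⊢
    rw [smul_add, smul_comm _ a, smul_comm _ b, h1, h2, smul_sub, smul_sub]
    abel

/-- The bornology on the space of Cauchy sequences whose quotient is the inductive limit of the
Hausdorff completions of the seminormed spaces spanned by the bounded disks. -/
instance CauchySeqs.instBornology : Bornology (CauchySeqs V) :=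
  Bornology.ofBounded {X | ∃ S : Set V, IsBounded S ∧ X ⊆ CauchySeqs.ball S}
    ⟨∅, isBounded_empty, Set.empty_subset _⟩
    (fun _ ⟨S, hS, h⟩ _ h' => ⟨S, hS, h'.trans h⟩)
    (fun _ ⟨S, hS, h⟩ _ ⟨T, hT, h'⟩ => ⟨S ∪ T, hS.union hT, Set.union_subset
      (h.trans (CauchySeqs.ball_mono Set.subset_union_left))
      (h'.trans (CauchySeqs.ball_mono Set.subset_union_right))⟩)
    (fun x => by
      obtain ⟨S, hS, h⟩ := x.mem_ball
      exact ⟨S, hS, Set.singleton_subset_iff.2 h⟩)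

theorem CauchySeqs.isBounded_iff {X : Set (CauchySeqs V)} :
    IsBounded X ↔ ∃ S : Set V, IsBounded S ∧ X ⊆ CauchySeqs.ball S :=
  Bornology.isBounded_ofBounded_iff _

theorem CauchySeqs.isBounded_iff_disk {X : Set (CauchySeqs V)} :
    IsBounded X ↔ ∃ S : Set V, IsBounded S ∧ IsDisk S ∧ X ⊆ CauchySeqs.ball S :=
  CauchySeqs.isBounded_iff.trans ⟨fun ⟨S, hS, h⟩ => ⟨diskHull S,
    ConvexBornology.isBounded_diskHull S hS, isDisk_diskHull S,
    h.trans (ball_mono (subset_diskHull S))⟩, fun ⟨S, hS, _, h⟩ => ⟨S, hS, h⟩⟩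

instance CauchySeqs.instConvexBornology : ConvexBornology (CauchySeqs V) where
  isBounded_add X Y hX hY := by
    obtain ⟨S, hS, hX⟩ := CauchySeqs.isBounded_iff.1 hX
    obtain ⟨T, hT, hY⟩ := CauchySeqs.isBounded_iff.1 hY
    refine CauchySeqs.isBounded_iff.2 ⟨S + T, ConvexBornology.isBounded_add S T hS hT, ?_⟩
    rintro _ ⟨x, hx, y, hy, rfl⟩
    refine ⟨?_, (hX hx).2.add (hY hy).2⟩
    filter_upwards [(hX hx).1, (hY hy).1] with n h1 h2
    exact ⟨_, h1, _, h2, rfl⟩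
  isBounded_diskHull X hX := by
    obtain ⟨S, hS, hd, hX⟩ := CauchySeqs.isBounded_iff_disk.1 hX
    exact CauchySeqs.isBounded_iff.2 ⟨S, hS, diskHull_min (CauchySeqs.isDisk_ball hd) hX⟩

/-- Applying a bounded linear map to a Cauchy sequence termwise. -/
def CauchySeqs.map (f : V →ₗ[ℂ] W) (hf : BoundedMap f) : CauchySeqs V →ₗ[ℂ] CauchySeqs W where
  toFun x := ⟨fun n => f (x.val n), by
    obtain ⟨S, hS, hx⟩ := x.cauchy
    exact ⟨_, hf S hS, hx.map f⟩⟩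
  map_add' x y := CauchySeqs.ext (funext fun n => f.map_add _ _)
  map_smul' c x := CauchySeqs.ext (funext fun n => f.map_smul _ _)

theorem CauchySeqs.map_mem_ball (f : V →ₗ[ℂ] W) (hf : BoundedMap f) {S : Set V}
    {x : CauchySeqs V} (hx : x ∈ ball S) : CauchySeqs.map f hf x ∈ ball (f '' S) :=
  ⟨hx.1.mono fun _ hn => ⟨_, hn, rfl⟩, hx.2.map f⟩

theorem CauchySeqs.boundedMap_map (f : V →ₗ[ℂ] W) (hf : BoundedMap f) :
    BoundedMap (CauchySeqs.map f hf) := fun X hX => by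
  obtain ⟨S, hS, hX⟩ := CauchySeqs.isBounded_iff.1 hX
  refine CauchySeqs.isBounded_iff.2 ⟨f '' S, hf S hS, ?_⟩
  rintro _ ⟨x, hx, rfl⟩
  exact CauchySeqs.map_mem_ball f hf (hX hx)

variable (V) in
/-- The completion of a convex bornological vector space: the separated inductive limit of the
Hausdorff completions of the seminormed spaces spanned by the bounded disks, realized as the space
of bornological Cauchy sequences modulo the bornological closure of `{0}`. -/
def Completion : Type _ := CauchySeqs V ⧸ sepKernel (CauchySeqs V)

instance Completion.instAddCommGroup : AddCommGroup (Completion V) :=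
  inferInstanceAs (AddCommGroup (CauchySeqs V ⧸ sepKernel (CauchySeqs V)))
instance Completion.instModule : Module ℂ (Completion V) :=
  inferInstanceAs (Module ℂ (CauchySeqs V ⧸ sepKernel (CauchySeqs V)))

/-- The class of a Cauchy sequence in the completion. -/
def Completion.mk : CauchySeqs V →ₗ[ℂ] Completion V := (sepKernel (CauchySeqs V)).mkQ

theorem Completion.mk_surjective : Function.Surjective (Completion.mk : CauchySeqs V → _) :=
  (sepKernel (CauchySeqs V)).mkQ_surjective

theorem Completion.mk_eq_zero {x : CauchySeqs V} :
    Completion.mk x = 0 ↔ x ∈ sepKernel (CauchySeqs V) :=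
  Submodule.Quotient.mk_eq_zero _

/-- The quotient bornology on the completion. -/
instance Completion.instBornology : Bornology (Completion V) :=
  Bornology.ofBounded {X | ∃ Y : Set (CauchySeqs V), IsBounded Y ∧ X ⊆ Completion.mk '' Y}
    ⟨∅, isBounded_empty, Set.empty_subset _⟩
    (fun _ ⟨S, hS, h⟩ _ h' => ⟨S, hS, h'.trans h⟩)
    (fun _ ⟨S, hS, h⟩ _ ⟨T, hT, h'⟩ => ⟨S ∪ T, hS.union hT, by
      rw [Set.image_union]; exact Set.union_subset_union h h'⟩)
    (fun x => by
      obtain ⟨y, rfl⟩ := Completion.mk_surjective x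
      exact ⟨{y}, isBounded_singleton, by simp⟩)

theorem Completion.isBounded_iff' {X : Set (Completion V)} :
    IsBounded X ↔ ∃ Y : Set (CauchySeqs V), IsBounded Y ∧ X ⊆ Completion.mk '' Y :=
  Bornology.isBounded_ofBounded_iff _

theorem Completion.isBounded_iff {X : Set (Completion V)} :
    IsBounded X ↔ ∃ S : Set V, IsBounded S ∧ IsDisk S ∧
      X ⊆ Completion.mk '' CauchySeqs.ball S := by
  rw [Completion.isBounded_iff']
  constructor
  · rintro ⟨Y, hY, h⟩
    obtain ⟨S, hS, hd, hY⟩ := CauchySeqs.isBounded_iff_disk.1 hY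
    exact ⟨S, hS, hd, h.trans (Set.image_mono hY)⟩
  · rintro ⟨S, hS, hd, h⟩
    exact ⟨_, CauchySeqs.isBounded_iff.2 ⟨S, hS, subset_rfl⟩, h⟩

theorem Completion.boundedMap_mk : BoundedMap (Completion.mk : CauchySeqs V → Completion V) :=
  fun X hX => Completion.isBounded_iff'.2 ⟨X, hX, subset_rfl⟩

instance Completion.instConvexBornology : ConvexBornology (Completion V) where
  isBounded_add X Y hX hY := by
    obtain ⟨X', hX', hX⟩ := Completion.isBounded_iff'.1 hX
    obtain ⟨Y', hY', hY⟩ := Completion.isBounded_iff'.1 hY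
    refine Completion.isBounded_iff'.2 ⟨X' + Y', ConvexBornology.isBounded_add _ _ hX' hY', ?_⟩
    rintro _ ⟨x, hx, y, hy, rfl⟩
    obtain ⟨x, hx', rfl⟩ := hX hx
    obtain ⟨y, hy', rfl⟩ := hY hy
    exact ⟨x + y, ⟨x, hx', y, hy', rfl⟩, map_add _ _ _⟩
  isBounded_diskHull X hX := by
    obtain ⟨S, hS, hd, hX⟩ := Completion.isBounded_iff.1 hX
    exact Completion.isBounded_iff.2 ⟨S, hS, hd,
      diskHull_min ((CauchySeqs.isDisk_ball hd).image _) hX⟩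

theorem Completion.norming {S : Set V} (hS : IsBounded S) (x : Completion V)
    (hx : ∀ ε : ℝ, 0 < ε → x ∈ (ε : ℂ) • (Completion.mk '' CauchySeqs.ball S)) : x = 0 := by
  obtain ⟨x, rfl⟩ := Completion.mk_surjective x
  have h : ∀ n : ℕ, ∃ y ∈ CauchySeqs.ball S,
      x - ((1 / ((n : ℝ) + 1) : ℝ) : ℂ) • y ∈ sepKernel (CauchySeqs V) := fun n => by
    obtain ⟨_, ⟨y, hy, rfl⟩, h⟩ := hx (1 / ((n : ℝ) + 1)) (by positivity)
    refine ⟨y, hy, Completion.mk_eq_zero.1 ?_⟩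
    simp only at h
    rw [map_sub, map_smul, h, sub_self]
  choose y hy hxy using h
  refine Completion.mk_eq_zero.2 (isBornClosed_sepKernel _ _ hxy
    ⟨fun n => ((-(1 / ((n : ℝ) + 1)) : ℝ) : ℂ), ?_, CauchySeqs.ball S,
      CauchySeqs.isBounded_iff.2 ⟨S, hS, subset_rfl⟩, fun n => ⟨y n, hy n, ?_⟩⟩)
  · have := (tendsto_one_div_add_atTop_nhds_zero_nat (𝕜 := ℝ)).neg
    rw [neg_zero] at this
    exact_mod_cast (Complex.continuous_ofReal.tendsto 0).comp this
  · simp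

theorem Completion.isCompletant {S : Set V} (hS : IsBounded S) (hd : IsDisk S) :
    IsCompletant (Completion.mk '' CauchySeqs.ball S : Set (Completion V)) := by
  have hD : IsDisk (Completion.mk '' CauchySeqs.ball S : Set (Completion V)) :=
    (CauchySeqs.isDisk_ball hd).image _
  refine ⟨hD, Completion.norming hS, fun x hx => ?_⟩
  choose N hN using fun k : ℕ => hx ((1 / 2 : ℝ) ^ (k + 1)) (by positivity)
  set φ : ℕ → ℕ := fun k => ∑ i ∈ Finset.range (k + 1), N i with hφ
  have hφN : ∀ k, N k ≤ φ k := fun k =>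
    Finset.single_le_sum (f := N) (fun _ _ => Nat.zero_le _) (Finset.self_mem_range_succ k)
  have hφs : ∀ k, φ k ≤ φ (k + 1) := fun k => by
    simp only [hφ]; rw [Finset.sum_range_succ N (k + 1)]; omega
  have hstep : ∀ k, ∃ z ∈ CauchySeqs.ball S,
      (((1 / 2 : ℝ) ^ (k + 1) : ℝ) : ℂ) • Completion.mk z = x (φ (k + 1)) - x (φ k) := fun k => by
    obtain ⟨_, ⟨z, hz, rfl⟩, h⟩ := hN k (φ (k + 1)) ((hφN k).trans (hφs k)) (φ k) (hφN k)
    exact ⟨z, hz, h⟩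
  choose z hz hzx using hstep
  choose n hn using fun k => eventually_atTop.1 (hz k).1
  have h0 : (0 : V) ∈ S := hd.zero_mem (hn 0 _ le_rfl)
  classical
  set u : ℕ → ℕ → V := fun j m => if n j ≤ m then (z j).val m else 0 with hu
  have huS : ∀ j m, u j m ∈ S := fun j m => by
    simp only [hu]; split_ifs with h
    · exact hn j m h
    · exact h0
  set w : ℕ → V := fun m =>
    ∑ j ∈ Finset.range m, (((1 / 2 : ℝ) ^ (j + 1) : ℝ) : ℂ) • u j m with hw
  set Z : ℕ → CauchySeqs V := fun J =>
    ∑ j ∈ Finset.range J, (((1 / 2 : ℝ) ^ (j + 1) : ℝ) : ℂ) • z j with hZ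
  have hZc : ∀ J, CauchyIn S (Z J).val := by
    intro J
    induction J with
    | zero => exact fun ε _ => ⟨0, fun m _ n _ => ⟨0, h0, by simp [hZ]⟩⟩
    | succ J ih =>
      have : Z (J + 1) = Z J + (((1 / 2 : ℝ) ^ (J + 1) : ℝ) : ℂ) • z J := by
        simp only [hZ]; rw [Finset.sum_range_succ]
      rw [this, map_add, map_smul]
      exact ih.add_disk hd ((hz J).2.smul_disk hd _)
  have hZmk : ∀ J, Completion.mk (Z J) = x (φ J) - x (φ 0) := by
    intro J
    simp only [hZ, map_sum, map_smul, hzx]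
    exact Finset.sum_range_sub (fun j => x (φ j)) J
  have htail : ∀ J, ∃ M, ∀ m ≥ M, w m - (Z J).val m ∈ (((1 / 2 : ℝ) ^ J : ℝ) : ℂ) • S := by
    intro J
    refine ⟨J + ∑ j ∈ Finset.range J, n j, fun m hm => ?_⟩
    have hJm : J ≤ m := le_trans (Nat.le_add_right _ _) hm
    have hval : (Z J).val m =
        ∑ j ∈ Finset.range J, (((1 / 2 : ℝ) ^ (j + 1) : ℝ) : ℂ) • u j m := by
      simp only [hZ, map_sum, map_smul, Finset.sum_apply, Pi.smul_apply]
      refine Finset.sum_congr rfl fun j hj => ?_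
      have : n j ≤ m := (Finset.single_le_sum (f := n) (fun _ _ => Nat.zero_le _) hj).trans
        ((Nat.le_add_left _ _).trans hm)
      simp [hu, this]
    have hsum : w m - (Z J).val m =
        ∑ j ∈ Finset.Ico J m, (((1 / 2 : ℝ) ^ (j + 1) : ℝ) : ℂ) • u j m := by
      rw [hval, Finset.sum_Ico_eq_sub _ hJm]
    rw [hsum]
    refine (hd.smul_subset ?_) (geom_sum_mem hd h0 (fun j => u j m) (fun j => huS j m) J m hJm)
    rw [Complex.norm_real, Real.norm_of_nonneg]
    · have : (0 : ℝ) ≤ (1 / 2) ^ m := by positivity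
      linarith
    · exact sub_nonneg.2 (pow_le_pow_of_le_one (by norm_num) (by norm_num) hJm)
  have hsmall : ∀ ε : ℝ, 0 < ε → ∃ J : ℕ, (1 / 2 : ℝ) ^ J < ε := fun ε hε =>
    exists_pow_lt_of_lt_one hε (by norm_num)
  have hwc : CauchyIn S w := fun ε hε => by
    obtain ⟨J, hJ⟩ := hsmall (ε / 4) (by positivity)
    obtain ⟨M, hM⟩ := htail J
    obtain ⟨K, hK⟩ := hZc J (ε / 2) (by positivity)
    refine ⟨max M K, fun a ha b hb => ?_⟩
    have hle : ‖(((1 / 2 : ℝ) ^ J : ℝ) : ℂ)‖ ≤ ε / 4 := by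
      rw [Complex.norm_real, Real.norm_of_nonneg (by positivity)]; exact hJ.le
    have h1 := hd.smul_subset hle (hM a (le_of_max_le_left ha))
    have h2 := hd.smul_subset hle (hM b (le_of_max_le_left hb))
    have h2' : (Z J).val b - w b ∈ ((ε / 4 : ℝ) : ℂ) • S := by
      obtain ⟨s, hs, h⟩ := h2
      exact ⟨-s, hd.neg_mem hs, by simp only at h ⊢; rw [smul_neg, h, neg_sub]⟩
    have h3 := hK a (le_of_max_le_right ha) b (le_of_max_le_right hb)
    have h4 := hd.add_smul_mem (by positivity) (by positivity) h1 h2'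
    have h5 := hd.add_smul_mem (by positivity) (by positivity) h3 h4
    rw [show ε / 2 + (ε / 4 + ε / 4) = ε by ring] at h5
    convert h5 using 1
    abel
  set w' : CauchySeqs V := ⟨w, S, hS, hwc⟩ with hw'
  have hw'v : w'.val = w := rfl
  refine ⟨x (φ 0) + Completion.mk w', fun ε hε => ?_⟩
  obtain ⟨J, hJ⟩ := hsmall (ε / 2) (by positivity)
  refine ⟨φ J, fun m hm => ?_⟩
  have hle1 : ‖(((1 / 2 : ℝ) ^ (J + 1) : ℝ) : ℂ)‖ ≤ ε / 2 := by
    rw [Complex.norm_real, Real.norm_of_nonneg (by positivity), pow_succ]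
    have : (0 : ℝ) < (1 / 2) ^ J := by positivity
    linarith
  have hle2 : ‖(((1 / 2 : ℝ) ^ J : ℝ) : ℂ)‖ ≤ ε / 2 := by
    rw [Complex.norm_real, Real.norm_of_nonneg (by positivity)]; exact hJ.le
  have h1 := hD.smul_subset hle1 (hN J m ((hφN J).trans hm) (φ J) (hφN J))
  have h2 : x (φ J) - (x (φ 0) + Completion.mk w') ∈
      (((1 / 2 : ℝ) ^ J : ℝ) : ℂ) • (Completion.mk '' CauchySeqs.ball S : Set (Completion V)) := by
    have hne : (((1 / 2 : ℝ) ^ J : ℝ) : ℂ) ≠ 0 := by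
      exact_mod_cast (by positivity : (0 : ℝ) < (1 / 2) ^ J).ne'
    refine ⟨_, ⟨((((1 / 2 : ℝ) ^ J : ℝ) : ℂ)⁻¹) • (Z J - w'), ⟨?_, ?_⟩, rfl⟩, ?_⟩
    · obtain ⟨M, hM⟩ := htail J
      filter_upwards [eventually_ge_atTop M] with m hm
      obtain ⟨s, hs, h⟩ := hM m hm
      have : ((((1 / 2 : ℝ) ^ J : ℝ) : ℂ)⁻¹ • (Z J - w')).val m = -s := by
        simp only [map_smul, map_sub, Pi.smul_apply, Pi.sub_apply, hw'v] at h ⊢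
        rw [← neg_sub, ← h, smul_neg, smul_smul, inv_mul_cancel₀ hne, one_smul]
      rw [this]
      exact hd.neg_mem hs
    · rw [map_smul, sub_eq_add_neg, ← neg_one_smul ℂ w', map_add, map_smul]
      exact ((hZc J).add_disk hd (hwc.smul_disk hd _)).smul_disk hd _
    · simp only [map_smul, map_sub, hZmk]
      rw [smul_smul, mul_inv_cancel₀ hne, one_smul]
      abel
  have h3 := hD.add_smul_mem (by positivity) (by positivity) h1 (hD.smul_subset hle2 h2)
  rw [add_halves] at h3
  convert h3 using 1
  abel

instance Completion.instCompleteBornology : CompleteBornology (Completion V) where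
  exists_completant X hX := by
    obtain ⟨S, hS, hd, hX⟩ := Completion.isBounded_iff.1 hX
    exact ⟨_, Completion.isBounded_iff.2 ⟨S, hS, hd, subset_rfl⟩,
      Completion.isCompletant hS hd, hX⟩

/-- The map of completions induced by a bounded linear map. -/
def Completion.map (f : V →ₗ[ℂ] W) (hf : BoundedMap f) : Completion V →ₗ[ℂ] Completion W :=
  Submodule.mapQ _ _ (CauchySeqs.map f hf) (sepKernel_map (CauchySeqs.boundedMap_map f hf))

theorem Completion.map_mk (f : V →ₗ[ℂ] W) (hf : BoundedMap f) (x : CauchySeqs V) :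
    Completion.map f hf (Completion.mk x) = Completion.mk (CauchySeqs.map f hf x) := rfl

theorem Completion.boundedMap_map (f : V →ₗ[ℂ] W) (hf : BoundedMap f) :
    BoundedMap (Completion.map f hf) := fun X hX => by
  obtain ⟨Y, hY, hX⟩ := Completion.isBounded_iff'.1 hX
  refine Completion.isBounded_iff'.2 ⟨_, CauchySeqs.boundedMap_map f hf Y hY, ?_⟩
  rintro _ ⟨x, hx, rfl⟩
  obtain ⟨y, hy, rfl⟩ := hX hx
  exact ⟨_, ⟨y, hy, rfl⟩, rfl⟩

section Lift

variable {Y : Type*} [AddCommGroup Y] [Module ℂ Y] [Bornology Y] [CompleteBornology Y]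

theorem CauchySeqs.exists_lim (x : CauchySeqs Y) :
    ∃ y : Y, ∃ S : Set Y, IsBounded S ∧ LimIn S x.val y := by
  obtain ⟨S, hS, hx⟩ := x.cauchy
  obtain ⟨T, hT, hTc, hST⟩ := CompleteBornology.exists_completant S hS
  obtain ⟨y, hy⟩ := hTc.complete _ (hx.mono hST)
  exact ⟨y, T, hT, hy⟩

/-- The limit of a Cauchy sequence in a complete bornological vector space. -/
noncomputable def CauchySeqs.lim : CauchySeqs Y →ₗ[ℂ] Y where
  toFun x := x.exists_lim.choose
  map_add' x y := by
    obtain ⟨S, hS, hx⟩ := x.exists_lim.choose_spec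
    obtain ⟨T, hT, hy⟩ := y.exists_lim.choose_spec
    obtain ⟨U, hU, hxy⟩ := (x + y).exists_lim.choose_spec
    exact hxy.unique hU (ConvexBornology.isBounded_add S T hS hT) (hx.add hy)
  map_smul' c x := by
    obtain ⟨S, hS, hx⟩ := x.exists_lim.choose_spec
    obtain ⟨U, hU, hxy⟩ := (c • x).exists_lim.choose_spec
    exact hxy.unique hU (isBounded_smul hS c) (hx.smul c)

theorem CauchySeqs.lim_eq {x : CauchySeqs Y} {y : Y} {S : Set Y} (hS : IsBounded S)
    (h : LimIn S x.val y) : CauchySeqs.lim x = y := by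
  obtain ⟨T, hT, hx⟩ := x.exists_lim.choose_spec
  exact hx.unique hT hS h

theorem CauchySeqs.boundedMap_lim : BoundedMap (CauchySeqs.lim : CauchySeqs Y → Y) := fun X hX => by
  obtain ⟨S, hS, hX⟩ := CauchySeqs.isBounded_iff.1 hX
  obtain ⟨T, hT, hTc, hST⟩ := CompleteBornology.exists_completant S hS
  refine (isBounded_smul hT ((2 : ℝ) : ℂ)).subset ?_
  rintro _ ⟨x, hx, rfl⟩
  obtain ⟨y, hy⟩ := hTc.complete _ ((hX hx).2.mono hST)
  rw [CauchySeqs.lim_eq hT hy]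
  obtain ⟨N, hN⟩ := hy 1 one_pos
  obtain ⟨n, hn, hnN⟩ := ((hX hx).1.and (eventually_ge_atTop N)).exists
  obtain ⟨s, hs, h⟩ := hN n hnN
  have := hTc.disk.add_smul_mem zero_le_one zero_le_one
    (⟨x.val n, hST hn, by simp⟩ : x.val n ∈ ((1 : ℝ) : ℂ) • T)
    (⟨-s, hTc.disk.neg_mem hs, rfl⟩ : ((1 : ℝ) : ℂ) • (-s) ∈ ((1 : ℝ) : ℂ) • T)
  simp only at h
  rw [smul_neg, h] at this
  norm_num at this ⊢
  exact this

/-- The extension to the completion of a bounded linear map with values in a complete bornological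
vector space. -/
noncomputable def Completion.lift (f : V →ₗ[ℂ] Y) (hf : BoundedMap f) : Completion V →ₗ[ℂ] Y :=
  (sepKernel (CauchySeqs V)).liftQ (CauchySeqs.lim ∘ₗ CauchySeqs.map f hf)
    (sepKernel_le (IsBornClosed.comap (f := CauchySeqs.lim ∘ₗ CauchySeqs.map f hf)
      (BoundedMap.comp (g := (CauchySeqs.lim : CauchySeqs Y → Y))
        (f := (CauchySeqs.map f hf : CauchySeqs V → CauchySeqs Y))
        CauchySeqs.boundedMap_lim (CauchySeqs.boundedMap_map f hf)) isBornClosed_bot))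

theorem Completion.lift_mk (f : V →ₗ[ℂ] Y) (hf : BoundedMap f) (x : CauchySeqs V) :
    Completion.lift f hf (Completion.mk x) = CauchySeqs.lim (CauchySeqs.map f hf x) := rfl

theorem Completion.boundedMap_lift (f : V →ₗ[ℂ] Y) (hf : BoundedMap f) :
    BoundedMap (Completion.lift f hf) := fun X hX => by
  obtain ⟨Z, hZ, hX⟩ := Completion.isBounded_iff'.1 hX
  refine (CauchySeqs.boundedMap_lim _ (CauchySeqs.boundedMap_map f hf Z hZ)).subset ?_
  rintro _ ⟨x, hx, rfl⟩
  obtain ⟨y, hy, rfl⟩ := hX hx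
  exact ⟨_, ⟨y, hy, rfl⟩, (Completion.lift_mk f hf y).symm⟩

end Lift

variable (V) in
/-- Constant sequences. -/
def CauchySeqs.const : V →ₗ[ℂ] CauchySeqs V where
  toFun v := ⟨fun _ => v, {0}, isBounded_singleton, fun ε _ => ⟨0, fun _ _ _ _ => by simp⟩⟩
  map_add' _ _ := rfl
  map_smul' _ _ := rfl

theorem CauchySeqs.val_const (v : V) (n : ℕ) : (CauchySeqs.const V v).val n = v := rfl

variable (V) in
/-- The canonical map into the completion, given by constant sequences. -/
def Completion.natural : V →ₗ[ℂ] Completion V := Completion.mk ∘ₗ CauchySeqs.const V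

theorem Completion.boundedMap_natural : BoundedMap (Completion.natural V) := fun S hS => by
  refine Completion.isBounded_iff'.2 ⟨_, CauchySeqs.isBounded_iff.2
    ⟨S ∪ {0}, hS.union isBounded_singleton, subset_rfl⟩, ?_⟩
  rintro _ ⟨v, hv, rfl⟩
  exact ⟨CauchySeqs.const V v, ⟨Eventually.of_forall fun _ => Or.inl hv, fun ε _ =>
    ⟨0, fun _ _ _ _ => ⟨0, Or.inr rfl, by simp [CauchySeqs.val_const]⟩⟩⟩, rfl⟩

theorem Completion.lift_natural {Y : Type*} [AddCommGroup Y] [Module ℂ Y] [Bornology Y]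
    [CompleteBornology Y] (f : V →ₗ[ℂ] Y) (hf : BoundedMap f) (v : V) :
    Completion.lift f hf (Completion.natural V v) = f v := by
  refine CauchySeqs.lim_eq (x := CauchySeqs.map f hf (CauchySeqs.const V v)) (S := {0})
    isBounded_singleton fun ε _ => ⟨0, fun _ _ => ⟨0, rfl, ?_⟩⟩
  change (ε : ℂ) • (0 : Y) = f v - f v
  simp

theorem Completion.lift_unique {Y : Type*} [AddCommGroup Y] [Module ℂ Y] [Bornology Y]
    [CompleteBornology Y] (f : V →ₗ[ℂ] Y) (hf : BoundedMap f) (g : Completion V →ₗ[ℂ] Y)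
    (hg : BoundedMap g) (h : ∀ v, g (Completion.natural V v) = f v) :
    g = Completion.lift f hf := by
  ext x
  obtain ⟨x, rfl⟩ := Completion.mk_surjective x
  obtain ⟨S, hS, hx⟩ := x.cauchy
  have hD : IsBounded (Completion.mk '' CauchySeqs.ball (diskHull S)) :=
    Completion.boundedMap_mk _ (CauchySeqs.isBounded_iff.2
      ⟨_, ConvexBornology.isBounded_diskHull S hS, subset_rfl⟩)
  have hx := hx.mono (subset_diskHull S)
  have hlim : LimIn (Completion.mk '' CauchySeqs.ball (diskHull S))
      (fun n => Completion.natural V (x.val n)) (Completion.mk x) := fun ε hε => by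
    obtain ⟨N, hN⟩ := hx ε hε
    refine ⟨N, fun n hn => ?_⟩
    have hne : (ε : ℂ) ≠ 0 := by exact_mod_cast hε.ne'
    refine ⟨_, ⟨(ε : ℂ)⁻¹ • (CauchySeqs.const V (x.val n) - x), ⟨?_, ?_⟩, rfl⟩, ?_⟩
    · filter_upwards [eventually_ge_atTop N] with m hm
      obtain ⟨s, hs, h⟩ := hN n hn m hm
      have : ((ε : ℂ)⁻¹ • (CauchySeqs.const V (x.val n) - x)).val m = s := by
        simp only [map_smul, map_sub, Pi.smul_apply, Pi.sub_apply, CauchySeqs.val_const] at h ⊢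
        rw [← h, smul_smul, inv_mul_cancel₀ hne, one_smul]
      rwa [this]
    · have hc : CauchyIn (diskHull S) ((-1 : ℂ) • x.val) := hx.smul_disk (isDisk_diskHull S) _
      rw [map_smul]
      refine CauchyIn.smul_disk (isDisk_diskHull S) (fun δ hδ => ?_) _
      obtain ⟨M, hM⟩ := hc δ hδ
      refine ⟨M, fun m hm k hk => ?_⟩
      have := hM m hm k hk
      simp only [map_sub, Pi.sub_apply, CauchySeqs.val_const, Pi.smul_apply, neg_smul,
        one_smul] at this ⊢
      convert this using 1
      abel
    · simp only [map_smul]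
      rw [smul_smul, mul_inv_cancel₀ hne, one_smul, map_sub]
      rfl
  have h1 := hlim.map g
  have h2 := hlim.map (Completion.lift f hf)
  simp only [h, Completion.lift_natural] at h1 h2
  exact h1.unique (hg _ hD) (Completion.boundedMap_lift f hf _ hD) h2

end Completion

section CompletionAlgebra

variable {A B : Type*} [NonUnitalRing A] [Module ℂ A] [Bornology A] [BornologicalAlgebra A]
  [NonUnitalRing B] [Module ℂ B] [Bornology B] [BornologicalAlgebra B]

theorem CauchyIn.mul {S T : Set A} {x y : ℕ → A}
    (hx : CauchyIn S x) (hy : CauchyIn T y) {P Q : Set A} (hP : ∀ᶠ n in atTop, x n ∈ P)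
    (hQ : ∀ᶠ n in atTop, y n ∈ Q) : CauchyIn (S * Q + P * T) (x * y) := fun ε hε => by
  obtain ⟨N, hN⟩ := hx ε hε
  obtain ⟨M, hM⟩ := hy ε hε
  obtain ⟨K, hK⟩ := eventually_atTop.1 (hP.and hQ)
  refine ⟨N + M + K, fun m hm n hn => ?_⟩
  obtain ⟨s, hs, h1⟩ := hN m (by omega) n (by omega)
  obtain ⟨t, ht, h2⟩ := hM m (by omega) n (by omega)
  refine ⟨s * y m + x n * t, ⟨_, ⟨s, hs, y m, (hK m (by omega)).2, rfl⟩, _,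
    ⟨x n, (hK n (by omega)).1, t, ht, rfl⟩, rfl⟩, ?_⟩
  simp only at h1 h2
  simp only [smul_add, Pi.mul_apply]
  rw [← smul_mul_assoc, ← mul_smul_comm, h1, h2, sub_mul, mul_sub]
  abel

/-- Termwise multiplication of Cauchy sequences. -/
instance CauchySeqs.instMul : Mul (CauchySeqs A) where
  mul x y := ⟨x.val * y.val, by
    obtain ⟨S, hS, hx⟩ := x.mem_ball
    obtain ⟨T, hT, hy⟩ := y.mem_ball
    exact ⟨_, ConvexBornology.isBounded_add _ _ (BornologicalAlgebra.isBounded_mul _ _ hS hT)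
      (BornologicalAlgebra.isBounded_mul _ _ hS hT), hx.2.mul hy.2 hx.1 hy.1⟩⟩

theorem CauchySeqs.val_mul (x y : CauchySeqs A) : (x * y).val = x.val * y.val := rfl

instance CauchySeqs.instNonUnitalRing : NonUnitalRing (CauchySeqs A) :=
  { (inferInstance : AddCommGroup (CauchySeqs A)) with
    mul := (· * ·)
    left_distrib := fun x y z => CauchySeqs.ext (by
      simp only [CauchySeqs.val_mul, map_add, mul_add])
    right_distrib := fun x y z => CauchySeqs.ext (by
      simp only [CauchySeqs.val_mul, map_add, add_mul])
    zero_mul := fun x => CauchySeqs.ext (by simp only [CauchySeqs.val_mul, map_zero, zero_mul])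
    mul_zero := fun x => CauchySeqs.ext (by simp only [CauchySeqs.val_mul, map_zero, mul_zero])
    mul_assoc := fun x y z => CauchySeqs.ext (by simp only [CauchySeqs.val_mul, mul_assoc]) }

instance CauchySeqs.instBornologicalAlgebra : BornologicalAlgebra (CauchySeqs A) where
  smul_assoc c x y := CauchySeqs.ext (by
    simp only [smul_eq_mul, CauchySeqs.val_mul, map_smul, smul_mul_assoc])
  smul_comm c x y := CauchySeqs.ext (by
    simp only [smul_eq_mul, CauchySeqs.val_mul, map_smul, mul_smul_comm])
  isBounded_mul X Y hX hY := by
    obtain ⟨S, hS, hX⟩ := CauchySeqs.isBounded_iff.1 hX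
    obtain ⟨T, hT, hY⟩ := CauchySeqs.isBounded_iff.1 hY
    have hST := BornologicalAlgebra.isBounded_mul S T hS hT
    refine CauchySeqs.isBounded_iff.2 ⟨S * T ∪ (S * T + S * T),
      hST.union (ConvexBornology.isBounded_add _ _ hST hST), ?_⟩
    rintro _ ⟨x, hx, y, hy, rfl⟩
    refine ⟨?_, ((hX hx).2.mul (hY hy).2 (hX hx).1 (hY hy).1).mono
      Set.subset_union_right⟩
    filter_upwards [(hX hx).1, (hY hy).1] with n h1 h2
    exact Or.inl ⟨_, h1, _, h2, rfl⟩

theorem sepKernel_mul_left (x : A) {y : A} (hy : y ∈ sepKernel A) : x * y ∈ sepKernel A :=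
  sepKernel_map (f := LinearMap.mulLeft ℂ x) (fun S hS =>
    (BornologicalAlgebra.isBounded_mul {x} S isBounded_singleton hS).subset (by
      rintro _ ⟨s, hs, rfl⟩
      exact ⟨x, rfl, s, hs, rfl⟩)) hy

theorem sepKernel_mul_right {x : A} (y : A) (hx : x ∈ sepKernel A) : x * y ∈ sepKernel A :=
  sepKernel_map (f := LinearMap.mulRight ℂ y) (fun S hS =>
    (BornologicalAlgebra.isBounded_mul S {y} hS isBounded_singleton).subset (by
      rintro _ ⟨s, hs, rfl⟩
      exact ⟨s, hs, y, rfl, rfl⟩)) hx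

/-- The multiplication on the completion induced by that of Cauchy sequences. -/
instance Completion.instMul : Mul (Completion A) where
  mul := Quotient.map₂ (· * ·) (by
    intro x x' hx y y' hy
    have hx := (Submodule.quotientRel_def _).1 hx
    have hy := (Submodule.quotientRel_def _).1 hy
    refine (Submodule.quotientRel_def _).2 ?_
    have : x * y - x' * y' = (x - x') * y + x' * (y - y') := by
      rw [sub_mul, mul_sub]; abel
    rw [this]
    exact add_mem (sepKernel_mul_right y hx) (sepKernel_mul_left x' hy))

theorem Completion.mk_mul (x y : CauchySeqs A) :
    Completion.mk (x * y) = Completion.mk x * Completion.mk y := rfl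

instance Completion.instNonUnitalRing : NonUnitalRing (Completion A) :=
  { (inferInstance : AddCommGroup (Completion A)) with
    mul := (· * ·)
    left_distrib := fun x y z => by
      obtain ⟨x, rfl⟩ := Completion.mk_surjective x
      obtain ⟨y, rfl⟩ := Completion.mk_surjective y
      obtain ⟨z, rfl⟩ := Completion.mk_surjective z
      simp only [← Completion.mk_mul, ← map_add, mul_add]
    right_distrib := fun x y z => by
      obtain ⟨x, rfl⟩ := Completion.mk_surjective x
      obtain ⟨y, rfl⟩ := Completion.mk_surjective y
      obtain ⟨z, rfl⟩ := Completion.mk_surjective z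
      simp only [← Completion.mk_mul, ← map_add, add_mul]
    zero_mul := fun x => by
      obtain ⟨x, rfl⟩ := Completion.mk_surjective x
      rw [← map_zero Completion.mk, ← Completion.mk_mul, zero_mul]
    mul_zero := fun x => by
      obtain ⟨x, rfl⟩ := Completion.mk_surjective x
      rw [← map_zero Completion.mk, ← Completion.mk_mul, mul_zero]
    mul_assoc := fun x y z => by
      obtain ⟨x, rfl⟩ := Completion.mk_surjective x
      obtain ⟨y, rfl⟩ := Completion.mk_surjective y
      obtain ⟨z, rfl⟩ := Completion.mk_surjective z
      simp only [← Completion.mk_mul, mul_assoc] }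

instance Completion.instCompleteBornologicalAlgebra :
    CompleteBornologicalAlgebra (Completion A) where
  smul_assoc c x y := by
    obtain ⟨x, rfl⟩ := Completion.mk_surjective x
    obtain ⟨y, rfl⟩ := Completion.mk_surjective y
    simp only [smul_eq_mul, ← Completion.mk_mul, ← map_smul, smul_mul_assoc]
  smul_comm c x y := by
    obtain ⟨x, rfl⟩ := Completion.mk_surjective x
    obtain ⟨y, rfl⟩ := Completion.mk_surjective y
    simp only [smul_eq_mul, ← Completion.mk_mul, ← map_smul, mul_smul_comm]
  isBounded_mul X Y hX hY := by
    obtain ⟨X', hX', hX⟩ := Completion.isBounded_iff'.1 hX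
    obtain ⟨Y', hY', hY⟩ := Completion.isBounded_iff'.1 hY
    refine Completion.isBounded_iff'.2 ⟨X' * Y', BornologicalAlgebra.isBounded_mul _ _ hX' hY', ?_⟩
    rintro _ ⟨x, hx, y, hy, rfl⟩
    obtain ⟨x, hx', rfl⟩ := hX hx
    obtain ⟨y, hy', rfl⟩ := hY hy
    exact ⟨x * y, ⟨x, hx', y, hy', rfl⟩, rfl⟩
  exists_completant := CompleteBornology.exists_completant

/-- The homomorphism of completions induced by a bounded homomorphism. -/
def Completion.mapHom (f : A →ₙₐ[ℂ] B) (hf : BoundedMap f) : Completion A →ₙₐ[ℂ] Completion B :=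
  { Completion.map (f : A →ₗ[ℂ] B) hf with
    map_zero' := map_zero (Completion.map (f : A →ₗ[ℂ] B) hf)
    map_mul' := fun x y => by
      obtain ⟨x, rfl⟩ := Completion.mk_surjective x
      obtain ⟨y, rfl⟩ := Completion.mk_surjective y
      refine congrArg Completion.mk (CauchySeqs.ext (funext fun n => ?_))
      exact map_mul f _ _ }

end CompletionAlgebra

section Tensor

variable {V W : Type*} [AddCommGroup V] [Module ℂ V] [Bornology V]
  [AddCommGroup W] [Module ℂ W] [Bornology W]

/-- The bismall sets `S ⊗ T = {v ⊗ w | v ∈ S, w ∈ T}` with bounded `S` and `T`. -/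
def bismall (p : {S : Set V // IsBounded S} × {T : Set W // IsBounded T}) : Set (V ⊗[ℂ] W) :=
  Set.image2 (fun v w => v ⊗ₜ[ℂ] w) p.1.1 p.2.1

theorem bismall_nonempty :
    ∃ p : {S : Set V // IsBounded S} × {T : Set W // IsBounded T}, (bismall p).Nonempty :=
  ⟨⟨⟨{0}, isBounded_singleton⟩, ⟨{0}, isBounded_singleton⟩⟩, _, 0, rfl, 0, rfl, rfl⟩

theorem bismall_span : ⊤ ≤ Submodule.span ℂ
    (⋃ p : {S : Set V // IsBounded S} × {T : Set W // IsBounded T}, bismall p) := by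
  rw [← TensorProduct.span_tmul_eq_top]
  refine Submodule.span_mono ?_
  rintro _ ⟨v, w, rfl⟩
  exact Set.mem_iUnion.2 ⟨⟨⟨{v}, isBounded_singleton⟩, ⟨{w}, isBounded_singleton⟩⟩,
    v, rfl, w, rfl, rfl⟩

variable [ConvexBornology V]

theorem bismall_add (p q : {S : Set V // IsBounded S} × {T : Set W // IsBounded T}) :
    ∃ r, ∀ x ∈ bismall p ∪ bismall q, (2 : ℂ) • x ∈ diskHull (bismall r) := by
  refine ⟨⟨⟨_, isBounded_smul (p.1.2.union q.1.2) 2⟩, ⟨_, p.2.2.union q.2.2⟩⟩, ?_⟩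
  rintro _ (⟨v, hv, w, hw, rfl⟩ | ⟨v, hv, w, hw, rfl⟩)
  · exact subset_diskHull _ ⟨_, ⟨v, Or.inl hv, rfl⟩, w, Or.inl hw, rfl⟩
  · exact subset_diskHull _ ⟨_, ⟨v, Or.inr hv, rfl⟩, w, Or.inr hw, rfl⟩

/-- The bornology of the algebraic tensor product: the convex bornology generated by the bismall
sets. -/
instance instBornologyTensor : Bornology (V ⊗[ℂ] W) :=
  bornologyOfHulls bismall bismall_nonempty bismall_add bismall_span

theorem isBounded_tensor_iff {X : Set (V ⊗[ℂ] W)} : IsBounded X ↔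
    ∃ p : {S : Set V // IsBounded S} × {T : Set W // IsBounded T}, X ⊆ diskHull (bismall p) :=
  isBounded_bornologyOfHulls bismall_nonempty bismall_add bismall_span

instance instConvexBornologyTensor : ConvexBornology (V ⊗[ℂ] W) :=
  convexBornology_of_hulls bismall bismall_add fun _ => isBounded_tensor_iff

theorem boundedMap_tensor_lift {X : Type*} [AddCommGroup X] [Module ℂ X] [Bornology X]
    [ConvexBornology X] (b : V →ₗ[ℂ] W →ₗ[ℂ] X)
    (hb : ∀ S T, IsBounded S → IsBounded T → IsBounded (Set.image2 (fun v w => b v w) S T)) :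
    BoundedMap (TensorProduct.lift b) := fun Y hY => by
  obtain ⟨⟨⟨S, hS⟩, ⟨T, hT⟩⟩, hY⟩ := isBounded_tensor_iff.1 hY
  refine (ConvexBornology.isBounded_diskHull _ (hb S T hS hT)).subset ?_
  refine (Set.image_mono hY).trans ((map_diskHull_subset _ _).trans (diskHull_mono ?_))
  rintro _ ⟨_, ⟨v, hv, w, hw, rfl⟩, rfl⟩
  exact ⟨v, hv, w, hw, by simp⟩

variable (V W) in
/-- The completed bornological tensor product. -/
abbrev CompletedTensor : Type _ := Completion (V ⊗[ℂ] W)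

variable {A B : Type*} [NonUnitalRing A] [Module ℂ A] [Bornology A] [BornologicalAlgebra A]
  [NonUnitalRing B] [Module ℂ B] [Bornology B] [BornologicalAlgebra B]

instance instBornologicalAlgebraTensor : BornologicalAlgebra (A ⊗[ℂ] B) where
  smul_assoc := smul_assoc
  smul_comm := smul_comm
  isBounded_mul X Y hX hY := by
    obtain ⟨⟨⟨S, hS⟩, ⟨T, hT⟩⟩, hX⟩ := isBounded_tensor_iff.1 hX
    obtain ⟨⟨⟨S', hS'⟩, ⟨T', hT'⟩⟩, hY⟩ := isBounded_tensor_iff.1 hY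
    refine isBounded_tensor_iff.2 ⟨⟨⟨_, BornologicalAlgebra.isBounded_mul _ _ hS hS'⟩,
      ⟨_, BornologicalAlgebra.isBounded_mul _ _ hT hT'⟩⟩, ?_⟩
    rintro _ ⟨x, hx, y, hy, rfl⟩
    refine diskHull_mono ?_ (bilin_diskHull (LinearMap.mul ℂ (A ⊗[ℂ] B)) (hX hx) (hY hy))
    rintro _ ⟨_, ⟨a, ha, b, hb, rfl⟩, _, ⟨a', ha', b', hb', rfl⟩, rfl⟩
    exact ⟨a * a', ⟨a, ha, a', ha', rfl⟩, b * b', ⟨b, hb, b', hb', rfl⟩, by simp⟩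

end Tensor

section Smooth

/-- The algebra of smooth functions on `[0,1]`: those functions that are infinitely often
differentiable on `[0,1]`, with one-sided derivatives at the end points. -/
def smoothSubalgebra : Subalgebra ℂ (Set.Icc (0 : ℝ) 1 → ℂ) where
  carrier := {f | ContDiffOn ℝ ∞ (Set.IccExtend zero_le_one f) (Set.Icc 0 1)}
  mul_mem' hf hg := ContDiffOn.mul hf hg
  add_mem' hf hg := ContDiffOn.add hf hg
  algebraMap_mem' c := contDiffOn_const (c := c)

/-- The algebra `C^∞([0,1])`. -/
def SmoothFn : Type := smoothSubalgebra

noncomputable instance SmoothFn.instCommRing : CommRing SmoothFn :=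
  inferInstanceAs (CommRing smoothSubalgebra)
noncomputable instance SmoothFn.instAlgebra : Algebra ℂ SmoothFn :=
  inferInstanceAs (Algebra ℂ smoothSubalgebra)

/-- The extension of a smooth function on `[0,1]` to the real line that is constant outside
`[0,1]`; only its restriction to `[0,1]` matters. -/
noncomputable def SmoothFn.toFun (f : SmoothFn) : ℝ → ℂ := Set.IccExtend zero_le_one f.1

theorem SmoothFn.contDiffOn (f : SmoothFn) : ContDiffOn ℝ ∞ f.toFun (Set.Icc 0 1) := f.2

/-- Evaluation at a point of `[0,1]`. -/
noncomputable def SmoothFn.eval (t : Set.Icc (0 : ℝ) 1) : SmoothFn →ₐ[ℂ] ℂ :=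
  (Pi.evalAlgHom ℂ (fun _ : Set.Icc (0 : ℝ) 1 => ℂ) t).comp smoothSubalgebra.val

/-- Bounded sets of smooth functions: all derivatives are uniformly bounded on `[0,1]`. -/
def SmoothFn.IsBdd (S : Set SmoothFn) : Prop :=
  ∀ k : ℕ, ∃ C : ℝ, ∀ f ∈ S, ∀ t ∈ Set.Icc (0 : ℝ) 1,
    ‖iteratedDerivWithin k f.toFun (Set.Icc 0 1) t‖ ≤ C

/-- The bounded bornology of the Fréchet space `C^∞([0,1])`. -/
instance SmoothFn.instBornology : Bornology SmoothFn :=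
  Bornology.ofBounded {S | SmoothFn.IsBdd S}
    (fun _ => ⟨0, by simp⟩)
    (fun _ hS _ hT k => (hS k).imp fun _ hC f hf => hC f (hT hf))
    (fun _ hS _ hT k => by
      obtain ⟨C, hC⟩ := hS k
      obtain ⟨D, hD⟩ := hT k
      refine ⟨max C D, ?_⟩
      rintro f (hf | hf) t ht
      · exact (hC f hf t ht).trans (le_max_left _ _)
      · exact (hD f hf t ht).trans (le_max_right _ _))
    (fun f k => by
      have hc := (f.contDiffOn.continuousOn_iteratedDerivWithin (m := k)
        (by exact_mod_cast le_top) (uniqueDiffOn_Icc zero_lt_one))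
      obtain ⟨C, hC⟩ := isCompact_Icc.exists_bound_of_continuousOn hc
      refine ⟨C, ?_⟩
      rintro g rfl t ht
      exact hC t ht)

theorem SmoothFn.isBounded_iff {S : Set SmoothFn} : IsBounded S ↔ SmoothFn.IsBdd S :=
  Bornology.isBounded_ofBounded_iff _

theorem SmoothFn.iteratedDerivWithin_combo (f g : SmoothFn) (a b : ℂ) (k : ℕ) {t : ℝ}
    (ht : t ∈ Set.Icc (0 : ℝ) 1) :
    iteratedDerivWithin k (a • f + b • g).toFun (Set.Icc 0 1) t =
      a • iteratedDerivWithin k f.toFun (Set.Icc 0 1) t +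
        b • iteratedDerivWithin k g.toFun (Set.Icc 0 1) t := by
  have hu := uniqueDiffOn_Icc (zero_lt_one (α := ℝ))
  have hf : ContDiffWithinAt ℝ k f.toFun (Set.Icc 0 1) t :=
    (f.contDiffOn t ht).of_le (by exact_mod_cast le_top)
  have hg : ContDiffWithinAt ℝ k g.toFun (Set.Icc 0 1) t :=
    (g.contDiffOn t ht).of_le (by exact_mod_cast le_top)
  have h1 := iteratedDerivWithin_add ht hu (hf.const_smul a) (hg.const_smul b)
  have h2 := iteratedDerivWithin_const_smul ht hu a hf
  have h3 := iteratedDerivWithin_const_smul ht hu b hg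
  rw [← h2, ← h3]
  exact h1

instance SmoothFn.instBornologicalAlgebra : BornologicalAlgebra SmoothFn where
  smul_assoc := smul_assoc
  smul_comm := smul_comm
  isBounded_add S T hS hT := SmoothFn.isBounded_iff.2 fun k => by
    obtain ⟨C, hC⟩ := SmoothFn.isBounded_iff.1 hS k
    obtain ⟨D, hD⟩ := SmoothFn.isBounded_iff.1 hT k
    refine ⟨C + D, ?_⟩
    rintro _ ⟨f, hf, g, hg, rfl⟩ t ht
    have := SmoothFn.iteratedDerivWithin_combo f g 1 1 k ht
    simp only [one_smul] at this
    simp only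
    rw [this]
    exact (norm_add_le _ _).trans (add_le_add (hC f hf t ht) (hD g hg t ht))
  isBounded_diskHull S hS := SmoothFn.isBounded_iff.2 fun k => by
    obtain ⟨C, hC⟩ := SmoothFn.isBounded_iff.1 hS k
    refine ⟨max C 0, fun f hf => ?_⟩
    have hd : IsDisk {f : SmoothFn | ∀ t ∈ Set.Icc (0 : ℝ) 1,
        ‖iteratedDerivWithin k f.toFun (Set.Icc 0 1) t‖ ≤ max C 0} := by
      intro f hf g hg a b hab t ht
      rw [SmoothFn.iteratedDerivWithin_combo f g a b k ht]
      refine (norm_add_le _ _).trans ?_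
      rw [norm_smul, norm_smul]
      have h0 : 0 ≤ max C 0 := le_max_right _ _
      calc _ ≤ ‖a‖ * max C 0 + ‖b‖ * max C 0 :=
            add_le_add (mul_le_mul_of_nonneg_left (hf t ht) (norm_nonneg _))
              (mul_le_mul_of_nonneg_left (hg t ht) (norm_nonneg _))
        _ = (‖a‖ + ‖b‖) * max C 0 := by ring
        _ ≤ 1 * max C 0 := mul_le_mul_of_nonneg_right hab h0
        _ = _ := one_mul _
    exact diskHull_min hd (fun g hg t ht => (hC g hg t ht).trans (le_max_left _ _)) hf
  isBounded_mul S T hS hT := SmoothFn.isBounded_iff.2 fun k => by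
    choose C hC using SmoothFn.isBounded_iff.1 hS
    choose D hD using SmoothFn.isBounded_iff.1 hT
    refine ⟨∑ i ∈ Finset.range (k + 1), (k.choose i : ℝ) * C i * D (k - i), ?_⟩
    rintro _ ⟨f, hf, g, hg, rfl⟩ t ht
    have hu := uniqueDiffOn_Icc (zero_lt_one (α := ℝ))
    have h : (f * g).toFun = fun x => f.toFun x * g.toFun x := rfl
    simp only [h]
    rw [← norm_iteratedFDerivWithin_eq_norm_iteratedDerivWithin]
    refine (norm_iteratedFDerivWithin_mul_le f.contDiffOn g.contDiffOn hu ht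
      (n := k) (by exact_mod_cast le_top)).trans (Finset.sum_le_sum fun i _ => ?_)
    rw [norm_iteratedFDerivWithin_eq_norm_iteratedDerivWithin,
      norm_iteratedFDerivWithin_eq_norm_iteratedDerivWithin]
    have h1 := hC i f hf t ht
    have h2 := hD (k - i) g hg t ht
    have h3 : 0 ≤ C i := (norm_nonneg _).trans h1
    gcongr

variable {A B : Type*} [NonUnitalRing A] [Module ℂ A] [Bornology A] [CompleteBornologicalAlgebra A]
  [NonUnitalRing B] [Module ℂ B] [Bornology B] [CompleteBornologicalAlgebra B]

variable (B) in
/-- The complete bornological algebra `C^∞([0,1]; B) := C^∞([0,1]) ⊗̂ B`. -/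
abbrev SmoothPaths : Type _ := CompletedTensor SmoothFn B

variable (B) in
/-- The bilinear map `(f, b) ↦ f(t) b`. -/
noncomputable def evalBilin (t : Set.Icc (0 : ℝ) 1) : SmoothFn →ₗ[ℂ] B →ₗ[ℂ] B :=
  (LinearMap.lsmul ℂ B).comp (SmoothFn.eval t).toLinearMap

theorem boundedMap_evalBilin (t : Set.Icc (0 : ℝ) 1) :
    BoundedMap (TensorProduct.lift (evalBilin B t)) :=
  boundedMap_tensor_lift _ fun S T hS hT => by
    obtain ⟨C, hC⟩ := SmoothFn.isBounded_iff.1 hS 0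
    have hd := isDisk_diskHull T
    refine (isBounded_smul (ConvexBornology.isBounded_diskHull T hT) ((max C 0 : ℝ) : ℂ)).subset ?_
    rintro _ ⟨f, hf, b, hb, rfl⟩
    have h1 := hC f hf t t.2
    rw [iteratedDerivWithin_zero] at h1
    have h2 : f.toFun t = SmoothFn.eval t f := Set.IccExtend_val _ _ t
    rw [h2] at h1
    exact hd.smul_subset (h1.trans (le_max_left _ _)) ⟨b, subset_diskHull T hb, rfl⟩

variable (B) in
/-- The evaluation map `ev_t : C^∞([0,1]; B) → B`, determined by `ev_t (f ⊗ b) = f(t) b`. -/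
noncomputable def evalAt (t : Set.Icc (0 : ℝ) 1) : SmoothPaths B →ₗ[ℂ] B :=
  Completion.lift (TensorProduct.lift (evalBilin B t)) (boundedMap_evalBilin t)

/-- A smooth homotopy between `φ₀` and `φ₁` in the lanilcur category. -/
structure IsLanilcurHomotopy (H : A →ₗ[ℂ] SmoothPaths B) (φ₀ φ₁ : A →ₗ[ℂ] B) : Prop where
  isLanilcur : IsLanilcur (B := SmoothPaths B) H
  eval_zero : ∀ a, evalAt B 0 (H a) = φ₀ a
  eval_one : ∀ a, evalAt B 1 (H a) = φ₁ a

/-- A smooth homotopy between `φ₀` and `φ₁` in the homomorphism category. -/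
structure IsSmoothHomotopy (H : A →ₙₐ[ℂ] SmoothPaths B) (φ₀ φ₁ : A →ₙₐ[ℂ] B) : Prop where
  bounded : BoundedMap H
  eval_zero : ∀ a, evalAt B 0 (H a) = φ₀ a
  eval_one : ∀ a, evalAt B 1 (H a) = φ₁ a

variable (A) in
/-- `A` is smoothly contractible in the lanilcur category: there is a smooth homotopy of lanilcurs
between the identity map and the zero map. -/
def LanilcurContractible : Prop :=
  ∃ H : A →ₗ[ℂ] SmoothPaths A, IsLanilcurHomotopy H LinearMap.id 0

variable (A) in
/-- `A` is smoothly contractible in the homomorphism category. -/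
def SmoothlyContractible : Prop :=
  ∃ H : A →ₙₐ[ℂ] SmoothPaths A, IsSmoothHomotopy H (NonUnitalAlgHom.id ℂ A) 0

/-- `A` is a smooth deformation retract of `B` in the lanilcur category, with retraction `p`:
`p` is a lanilcur and has a right inverse lanilcur `s`, and there is a smooth homotopy of lanilcurs
between the identity map of `B` and `s ∘ p` that is constant on (the image under `s` of) `A`. -/
def IsLanilcurDeformationRetraction (p : B →ₗ[ℂ] A) : Prop :=
  IsLanilcur p ∧ ∃ s : A →ₗ[ℂ] B, IsLanilcur s ∧ (∀ a, p (s a) = a) ∧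
    ∃ H : B →ₗ[ℂ] SmoothPaths B, IsLanilcurHomotopy H LinearMap.id (s ∘ₗ p) ∧
      ∀ (t : Set.Icc (0 : ℝ) 1) (a : A), evalAt B t (H (s a)) = s a

/-- `A` is a smooth deformation retract of `B` in the homomorphism category, with retraction
`p`. -/
def IsSmoothDeformationRetraction (p : B →ₙₐ[ℂ] A) : Prop :=
  BoundedMap p ∧ ∃ s : A →ₙₐ[ℂ] B, BoundedMap s ∧ (∀ a, p (s a) = a) ∧
    ∃ H : B →ₙₐ[ℂ] SmoothPaths B, IsSmoothHomotopy H (NonUnitalAlgHom.id ℂ B) (s.comp p) ∧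
      ∀ (t : Set.Icc (0 : ℝ) 1) (a : A), evalAt B t (H (s a)) = s a

/-- Smooth homotopy of bounded homomorphisms. -/
def SmoothlyHomotopic (φ₀ φ₁ : A →ₙₐ[ℂ] B) : Prop :=
  ∃ H : A →ₙₐ[ℂ] SmoothPaths B, IsSmoothHomotopy H φ₀ φ₁

/-- Smooth homotopy equivalences in the homomorphism category. -/
def IsSmoothHomotopyEquiv (f : A →ₙₐ[ℂ] B) : Prop :=
  BoundedMap f ∧ ∃ g : B →ₙₐ[ℂ] A, BoundedMap g ∧
    SmoothlyHomotopic (g.comp f) (NonUnitalAlgHom.id ℂ A) ∧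
    SmoothlyHomotopic (f.comp g) (NonUnitalAlgHom.id ℂ B)

end Smooth

section Forms

set_option linter.unusedSectionVars false

variable {A B : Type*} [NonUnitalRing A] [Module ℂ A] [IsScalarTower ℂ A A] [SMulCommClass ℂ A A]
  [NonUnitalRing B] [Module ℂ B] [IsScalarTower ℂ B B] [SMulCommClass ℂ B B]

variable (A) in
/-- The space of noncommutative differential forms over the unitization `A⁺` with
`d 1 = 0`: the direct sum of `A⁺ ⊗ A^{⊗ n}` over `n ≥ 0`, where
`c ⊗ (a₁ ⊗ ⋯ ⊗ aₙ)` stands for the form `c da₁ ⋯ daₙ`. The differential forms over `A` itself are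
those whose degree zero part lies in `A ⊆ A⁺`. -/
def Omega : Type _ := Unitization ℂ A ⊗[ℂ] TensorAlgebra ℂ A

noncomputable instance Omega.instAddCommGroup : AddCommGroup (Omega A) :=
  inferInstanceAs (AddCommGroup (Unitization ℂ A ⊗[ℂ] TensorAlgebra ℂ A))
noncomputable instance Omega.instModule : Module ℂ (Omega A) :=
  inferInstanceAs (Module ℂ (Unitization ℂ A ⊗[ℂ] TensorAlgebra ℂ A))

namespace Omega

variable (A) in
/-- The bilinear map `(c, w) ↦ c ⊗ w`. -/
noncomputable def mk : Unitization ℂ A →ₗ[ℂ] TensorAlgebra ℂ A →ₗ[ℂ] Omega A :=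
  TensorProduct.mk ℂ (Unitization ℂ A) (TensorAlgebra ℂ A)

/-- The universal property of the tensor product. -/
noncomputable def lift {X : Type*} [AddCommGroup X] [Module ℂ X]
    (b : Unitization ℂ A →ₗ[ℂ] TensorAlgebra ℂ A →ₗ[ℂ] X) : Omega A →ₗ[ℂ] X :=
  TensorProduct.lift b

@[simp] theorem lift_mk {X : Type*} [AddCommGroup X] [Module ℂ X]
    (b : Unitization ℂ A →ₗ[ℂ] TensorAlgebra ℂ A →ₗ[ℂ] X) (c : Unitization ℂ A)
    (w : TensorAlgebra ℂ A) : lift b (mk A c w) = b c w := TensorProduct.lift.tmul _ _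

theorem hom_ext {X : Type*} [AddCommGroup X] [Module ℂ X] {f g : Omega A →ₗ[ℂ] X}
    (h : ∀ c w, f (mk A c w) = g (mk A c w)) : f = g := TensorProduct.ext' h

/-- The form `c da₁ ⋯ daₙ`. -/
noncomputable def form (c : Unitization ℂ A) (l : List A) : Omega A :=
  mk A c (l.map (TensorAlgebra.ι ℂ)).prod

variable (A) in
/-- The exterior differential `d (c da₁ ⋯ daₙ) = dc da₁ ⋯ daₙ` with `d 1 = 0`. -/
noncomputable def d : Module.End ℂ (Omega A) :=
  lift (((LinearMap.mul ℂ (TensorAlgebra ℂ A)).compr₂ (mk A 1)) ∘ₗ TensorAlgebra.ι ℂ ∘ₗ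
    Unitization.sndHom ℂ ℂ A)

theorem d_mk (c : Unitization ℂ A) (w : TensorAlgebra ℂ A) :
    d A (mk A c w) = mk A 1 (TensorAlgebra.ι ℂ c.snd * w) := by
  simp [d]

theorem d_d (x : Omega A) : d A (d A x) = 0 := by
  have : (d A) ∘ₗ (d A) = 0 := hom_ext fun c w => by simp [d_mk]
  exact LinearMap.congr_fun this x

variable (A) in
/-- Left multiplication of forms by elements of `A⁺`. -/
noncomputable def L : Unitization ℂ A →ₗ[ℂ] Module.End ℂ (Omega A) where
  toFun c := lift (mk A ∘ₗ LinearMap.mulLeft ℂ c)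
  map_add' c c' := hom_ext fun c w => by simp [add_mul]
  map_smul' c c' := hom_ext fun c w => by simp

@[simp] theorem L_mk (c c' : Unitization ℂ A) (w : TensorAlgebra ℂ A) :
    L A c (mk A c' w) = mk A (c * c') w := by
  simp [L]

theorem L_mul (c c' : Unitization ℂ A) : L A (c * c') = L A c * L A c' :=
  hom_ext fun e w => by simp [mul_assoc]

theorem L_one : L A 1 = 1 := hom_ext fun e w => by simp

variable (A) in
/-- Left multiplication by the one-form `dc`, determined by the Leibniz rule
`dc · x = d (c x) - c dx`. -/
noncomputable def D : Unitization ℂ A →ₗ[ℂ] Module.End ℂ (Omega A) :=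
  (LinearMap.mulLeft ℂ (d A) - LinearMap.mulRight ℂ (d A)) ∘ₗ L A

theorem D_apply (c : Unitization ℂ A) : D A c = d A * L A c - L A c * d A := rfl

theorem D_mk (c₀ c : Unitization ℂ A) (w : TensorAlgebra ℂ A) :
    D A c₀ (mk A c w) = mk A 1 (TensorAlgebra.ι ℂ (c₀ * c).snd * w) -
      mk A c₀ (TensorAlgebra.ι ℂ c.snd * w) := by
  simp [D_apply, d_mk]

theorem D_inr_snd (c : Unitization ℂ A) : D A (Unitization.inr c.snd) = D A c := by
  have h : D A 1 = 0 := by simp [D_apply, L_one]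
  conv_rhs => rw [← Unitization.inl_fst_add_inr_snd_eq c]
  have : (Unitization.inl c.fst : Unitization ℂ A) = c.fst • 1 := by
    rw [← Unitization.algebraMap_eq_inl, Algebra.algebraMap_eq_smul_one]
  rw [this, map_add, map_smul, h, smul_zero, zero_add]

theorem D_mul (c c' : Unitization ℂ A) : D A (c * c') = D A c * L A c' + L A c * D A c' := by
  simp only [D_apply, L_mul]
  noncomm_ring

variable (A) in
/-- Left multiplication by the forms `da₁ ⋯ daₙ`. -/
noncomputable def leftMulD : TensorAlgebra ℂ A →ₐ[ℂ] Module.End ℂ (Omega A) :=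
  TensorAlgebra.lift ℂ (D A ∘ₗ Unitization.inrHom ℂ ℂ A)

@[simp] theorem leftMulD_ι (a : A) :
    leftMulD A (TensorAlgebra.ι ℂ a) = D A (Unitization.inr a) := by
  simp [leftMulD]

variable (A) in
/-- Left multiplication in the algebra of differential forms: `mulForms A x y` is the ordinary
product of the forms `x` and `y`, so that
`(c da₁ ⋯ daₙ) · y = c · (da₁ · (⋯ (daₙ · y)))`. -/
noncomputable def mulForms : Omega A →ₗ[ℂ] Module.End ℂ (Omega A) :=
  lift ((LinearMap.mul ℂ (Module.End ℂ (Omega A))).compl₁₂ (L A) (leftMulD A).toLinearMap)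

theorem mulForms_mk (c : Unitization ℂ A) (w : TensorAlgebra ℂ A) :
    mulForms A (mk A c w) = L A c * leftMulD A w := by
  simp [mulForms]

theorem mulForms_L (c : Unitization ℂ A) (x : Omega A) :
    mulForms A (L A c x) = L A c * mulForms A x := by
  have : mulForms A ∘ₗ L A c = LinearMap.mulLeft ℂ (L A c) ∘ₗ mulForms A :=
    hom_ext fun e w => by simp [mulForms_mk, L_mul, mul_assoc]
  exact LinearMap.congr_fun this x

theorem mulForms_D (c : Unitization ℂ A) (x : Omega A) :
    mulForms A (D A c x) = D A c * mulForms A x := by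
  have : mulForms A ∘ₗ D A c = LinearMap.mulLeft ℂ (D A c) ∘ₗ mulForms A :=
    hom_ext fun e w => by
      simp only [LinearMap.comp_apply, D_mk, map_sub, mulForms_mk, map_mul, leftMulD_ι, D_inr_snd,
        L_one, one_mul, LinearMap.mulLeft_apply, D_mul]
      noncomm_ring
  exact LinearMap.congr_fun this x

theorem mulForms_leftMulD (w : TensorAlgebra ℂ A) (x : Omega A) :
    mulForms A (leftMulD A w x) = leftMulD A w * mulForms A x := by
  induction w using TensorAlgebra.induction generalizing x with
  | algebraMap r => simp [Algebra.algebraMap_eq_smul_one]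
  | ι a => rw [leftMulD_ι, mulForms_D]
  | mul a b ha hb => rw [map_mul, Module.End.mul_apply, ha, hb, mul_assoc]
  | add a b ha hb => rw [map_add, LinearMap.add_apply, map_add, ha, hb, add_mul]

/-- Associativity of the product of forms. -/
theorem mulForms_mulForms (x y : Omega A) :
    mulForms A (mulForms A x y) = mulForms A x * mulForms A y := by
  have : mulForms A ∘ₗ (mulForms A).flip y = LinearMap.mulRight ℂ (mulForms A y) ∘ₗ mulForms A :=
    hom_ext fun c w => by
      simp [mulForms_mk, mulForms_L, mulForms_leftMulD, mul_assoc]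
  exact LinearMap.congr_fun this x

variable (A) in
/-- The algebra endomorphism of the tensor algebra that is `(-1)ⁿ` on `A^{⊗ n}`. -/
noncomputable def gradT : TensorAlgebra ℂ A →ₐ[ℂ] TensorAlgebra ℂ A :=
  TensorAlgebra.lift ℂ (-TensorAlgebra.ι ℂ)

@[simp] theorem gradT_ι (a : A) : gradT A (TensorAlgebra.ι ℂ a) = -TensorAlgebra.ι ℂ a := by
  simp [gradT]

theorem gradT_gradT (w : TensorAlgebra ℂ A) : gradT A (gradT A w) = w := by
  have : (gradT A).comp (gradT A) = AlgHom.id ℂ _ := TensorAlgebra.hom_ext (by ext; simp)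
  exact DFunLike.congr_fun this w

variable (A) in
/-- The grading operator `x ↦ (-1)^{deg x} x`. -/
noncomputable def grad : Module.End ℂ (Omega A) :=
  lift ((mk A).compl₂ (gradT A).toLinearMap)

@[simp] theorem grad_mk (c : Unitization ℂ A) (w : TensorAlgebra ℂ A) :
    grad A (mk A c w) = mk A c (gradT A w) := by
  simp [grad]

@[simp] theorem grad_grad (x : Omega A) : grad A (grad A x) = x := by
  have : (grad A) ∘ₗ (grad A) = LinearMap.id := hom_ext fun c w => by simp [gradT_gradT]
  exact LinearMap.congr_fun this x

theorem grad_mul_d : grad A * d A = -(d A * grad A) := hom_ext fun c w => by simp [d_mk]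

theorem grad_d (x : Omega A) : grad A (d A x) = -d A (grad A x) :=
  LinearMap.congr_fun grad_mul_d x

theorem grad_mul_L (c : Unitization ℂ A) : grad A * L A c = L A c * grad A :=
  hom_ext fun e w => by simp

theorem grad_mul_D (c : Unitization ℂ A) : grad A * D A c = -(D A c * grad A) := by
  rw [D_apply, mul_sub, sub_mul, ← mul_assoc, ← mul_assoc, grad_mul_d, grad_mul_L, neg_mul,
    mul_assoc, grad_mul_L, mul_assoc, grad_mul_d]
  noncomm_ring

theorem grad_mul_leftMulD (w : TensorAlgebra ℂ A) :
    grad A * leftMulD A w = leftMulD A (gradT A w) * grad A := by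
  induction w using TensorAlgebra.induction with
  | algebraMap r => simp only [AlgHom.commutes, Algebra.commutes]
  | ι a => rw [leftMulD_ι, gradT_ι, map_neg, leftMulD_ι, grad_mul_D, neg_mul]
  | mul a b ha hb => rw [map_mul, map_mul, map_mul, ← mul_assoc, ha, mul_assoc, hb, mul_assoc]
  | add a b ha hb => rw [map_add, map_add, map_add, mul_add, ha, hb, add_mul]

theorem grad_mulForms (x y : Omega A) :
    grad A (mulForms A x y) = mulForms A (grad A x) (grad A y) := by
  have : LinearMap.mulLeft ℂ (grad A) ∘ₗ mulForms A =
      LinearMap.mulRight ℂ (grad A) ∘ₗ mulForms A ∘ₗ grad A := hom_ext fun c w => by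
    simp only [LinearMap.comp_apply, LinearMap.mulLeft_apply, LinearMap.mulRight_apply, grad_mk,
      mulForms_mk]
    rw [← mul_assoc, grad_mul_L, mul_assoc, grad_mul_leftMulD, mul_assoc]
  exact LinearMap.congr_fun (LinearMap.congr_fun this x) y

theorem d_mul_d : d A * d A = 0 := LinearMap.ext d_d

theorem d_mul_D (c : Unitization ℂ A) : d A * D A c = -(D A c * d A) := by
  rw [D_apply, mul_sub, sub_mul, ← mul_assoc, d_mul_d, mul_assoc (L A c), d_mul_d]
  noncomm_ring

theorem d_mul_leftMulD (w : TensorAlgebra ℂ A) :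
    d A * leftMulD A w = leftMulD A (gradT A w) * d A := by
  induction w using TensorAlgebra.induction with
  | algebraMap r => simp only [AlgHom.commutes, Algebra.commutes]
  | ι a => rw [leftMulD_ι, gradT_ι, map_neg, leftMulD_ι, d_mul_D, neg_mul]
  | mul a b ha hb => rw [map_mul, map_mul, map_mul, ← mul_assoc, ha, mul_assoc, hb, mul_assoc]
  | add a b ha hb => rw [map_add, map_add, map_add, mul_add, ha, hb, add_mul]

/-- The graded Leibniz rule. -/
theorem d_mulForms (x y : Omega A) : d A (mulForms A x y) =
    mulForms A (d A x) y + mulForms A (grad A x) (d A y) := by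
  have : LinearMap.mulLeft ℂ (d A) ∘ₗ mulForms A = mulForms A ∘ₗ d A +
      LinearMap.mulRight ℂ (d A) ∘ₗ mulForms A ∘ₗ grad A := hom_ext fun c w => by
    simp only [LinearMap.add_apply, LinearMap.comp_apply, LinearMap.mulLeft_apply,
      LinearMap.mulRight_apply, grad_mk, mulForms_mk, d_mk, L_one, one_mul, map_mul, leftMulD_ι,
      D_inr_snd]
    rw [mul_assoc, ← d_mul_leftMulD, D_apply]
    noncomm_ring
  exact LinearMap.congr_fun (LinearMap.congr_fun this x) y

variable (A) in
/-- The Fedosov product `x ⊙ y = x y - (-1)^{deg x} dx dy`. -/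
noncomputable def fedosov : Omega A →ₗ[ℂ] Module.End ℂ (Omega A) :=
  mulForms A - LinearMap.mulRight ℂ (d A) ∘ₗ mulForms A ∘ₗ d A ∘ₗ grad A

theorem fedosov_apply (x y : Omega A) :
    fedosov A x y = mulForms A x y - mulForms A (d A (grad A x)) (d A y) := rfl

theorem fedosov_assoc (x y z : Omega A) :
    fedosov A (fedosov A x y) z = fedosov A x (fedosov A y z) := by
  have h1 : ∀ x y : Omega A, ∀ z, mulForms A (mulForms A x y) z =
      mulForms A x (mulForms A y z) := fun x y z => by
    rw [mulForms_mulForms, Module.End.mul_apply]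
  simp only [fedosov_apply, map_sub, LinearMap.sub_apply, grad_mulForms, d_mulForms, grad_d,
    grad_grad, d_d, map_neg, LinearMap.neg_apply, map_zero, LinearMap.zero_apply, h1, map_add,
    LinearMap.add_apply]
  abel

theorem grad_fedosov (x y : Omega A) :
    grad A (fedosov A x y) = fedosov A (grad A x) (grad A y) := by
  simp only [fedosov_apply, map_sub, grad_mulForms, grad_d, grad_grad, map_neg,
    LinearMap.neg_apply, neg_neg]

variable (A) in
/-- The component in `ℂ` with respect to the decomposition `A⁺ = ℂ ⊕ A` in degree `0`. The kernel
of this map is the space of differential forms over `A`. -/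
noncomputable def aug : Omega A →ₗ[ℂ] ℂ :=
  lift ((LinearMap.mul ℂ ℂ).compl₁₂ (Unitization.fstHom ℂ A).toLinearMap
    TensorAlgebra.algebraMapInv.toLinearMap)

theorem aug_mk (c : Unitization ℂ A) (w : TensorAlgebra ℂ A) :
    aug A (mk A c w) = c.fst * TensorAlgebra.algebraMapInv w := by
  simp [aug]

theorem algebraMapInv_ι (a : A) :
    TensorAlgebra.algebraMapInv (R := ℂ) (TensorAlgebra.ι ℂ a) = 0 := by
  simp [TensorAlgebra.algebraMapInv]

theorem aug_d (x : Omega A) : aug A (d A x) = 0 := by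
  have : (aug A) ∘ₗ (d A) = 0 := hom_ext fun c w => by
    simp [d_mk, aug_mk, algebraMapInv_ι]
  exact LinearMap.congr_fun this x

theorem aug_L (c : Unitization ℂ A) (x : Omega A) : aug A (L A c x) = c.fst * aug A x := by
  have : (aug A) ∘ₗ (L A c) = c.fst • aug A := hom_ext fun c w => by
    simp [aug_mk, mul_assoc]
  exact LinearMap.congr_fun this x

theorem aug_D (c : Unitization ℂ A) (x : Omega A) : aug A (D A c x) = 0 := by
  rw [D_apply, LinearMap.sub_apply, map_sub, Module.End.mul_apply, Module.End.mul_apply, aug_d,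
    aug_L, aug_d, mul_zero, sub_zero]

theorem aug_leftMulD (w : TensorAlgebra ℂ A) (x : Omega A) :
    aug A (leftMulD A w x) = TensorAlgebra.algebraMapInv w * aug A x := by
  induction w using TensorAlgebra.induction generalizing x with
  | algebraMap r => simp [Module.algebraMap_end_apply]
  | ι a => rw [leftMulD_ι, aug_D, algebraMapInv_ι, zero_mul]
  | mul a b ha hb => rw [map_mul, Module.End.mul_apply, ha, hb, map_mul, mul_assoc]
  | add a b ha hb => rw [map_add, LinearMap.add_apply, map_add, ha, hb, map_add, add_mul]

theorem aug_mulForms (x y : Omega A) : aug A (mulForms A x y) = aug A x * aug A y := by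
  have : aug A ∘ₗ (mulForms A).flip y = aug A y • aug A := hom_ext fun c w => by
    simp [mulForms_mk, aug_L, aug_leftMulD, aug_mk]
    ring
  have h := LinearMap.congr_fun this x
  simp only [LinearMap.comp_apply, LinearMap.flip_apply, LinearMap.smul_apply, smul_eq_mul] at h
  rw [h, mul_comm]

theorem aug_fedosov (x y : Omega A) : aug A (fedosov A x y) = aug A x * aug A y := by
  rw [fedosov_apply, map_sub, aug_mulForms, aug_mulForms, aug_d, zero_mul, sub_zero]

theorem aug_grad (x : Omega A) : aug A (grad A x) = aug A x := by
  have h : (TensorAlgebra.algebraMapInv (R := ℂ) (M := A)).comp (gradT A) =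
      TensorAlgebra.algebraMapInv := TensorAlgebra.hom_ext (by ext; simp [algebraMapInv_ι])
  have : (aug A) ∘ₗ (grad A) = aug A := hom_ext fun c w => by
    have := DFunLike.congr_fun h w
    simp only [AlgHom.comp_apply] at this
    simp [aug_mk, this]
  exact LinearMap.congr_fun this x

end Omega

variable (A) in
/-- The space of even differential forms over `A`: the direct sum of `A` and of
`A⁺ ⊗ A^{⊗ 2n}` over `n ≥ 1`. -/
noncomputable def evenForms : Submodule ℂ (Omega A) where
  carrier := {x | Omega.grad A x = x ∧ Omega.aug A x = 0}
  zero_mem' := ⟨map_zero _, map_zero _⟩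
  add_mem' hx hy := ⟨by rw [map_add, hx.1, hy.1], by rw [map_add, hx.2, hy.2, add_zero]⟩
  smul_mem' c x hx := ⟨by rw [map_smul, hx.1], by rw [map_smul, hx.2, smul_zero]⟩

variable (A) in
/-- The algebra of even differential forms over `A` with the Fedosov product. -/
def EvenForms : Type _ := evenForms A

noncomputable instance EvenForms.instAddCommGroup : AddCommGroup (EvenForms A) :=
  inferInstanceAs (AddCommGroup (evenForms A))
noncomputable instance EvenForms.instModule : Module ℂ (EvenForms A) :=
  inferInstanceAs (Module ℂ (evenForms A))

namespace EvenForms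

/-- The underlying differential form. -/
noncomputable def val : EvenForms A →ₗ[ℂ] Omega A := (evenForms A).subtype

theorem ext {x y : EvenForms A} (h : x.val = y.val) : x = y := Subtype.ext h

theorem grad_val (x : EvenForms A) : Omega.grad A x.val = x.val := x.2.1

theorem aug_val (x : EvenForms A) : Omega.aug A x.val = 0 := x.2.2

noncomputable instance instMul : Mul (EvenForms A) where
  mul x y := ⟨Omega.fedosov A x.val y.val,
    by rw [Omega.grad_fedosov, x.grad_val, y.grad_val],
    by rw [Omega.aug_fedosov, x.aug_val, zero_mul]⟩

theorem val_mul (x y : EvenForms A) : (x * y).val = Omega.fedosov A x.val y.val := rfl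

noncomputable instance instNonUnitalRing : NonUnitalRing (EvenForms A) :=
  { (inferInstance : AddCommGroup (EvenForms A)) with
    mul := (· * ·)
    left_distrib := fun x y z => ext (by simp only [val_mul, map_add])
    right_distrib := fun x y z => ext (by simp only [val_mul, map_add, LinearMap.add_apply])
    zero_mul := fun x => ext (by simp only [val_mul, map_zero, LinearMap.zero_apply])
    mul_zero := fun x => ext (by simp only [val_mul, map_zero])
    mul_assoc := fun x y z => ext (by simp only [val_mul, Omega.fedosov_assoc]) }

instance instIsScalarTower : IsScalarTower ℂ (EvenForms A) (EvenForms A) where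
  smul_assoc c x y := ext (by
    simp only [smul_eq_mul, val_mul, map_smul, LinearMap.smul_apply])

instance instSMulCommClass : SMulCommClass ℂ (EvenForms A) (EvenForms A) where
  smul_comm c x y := ext (by simp only [smul_eq_mul, val_mul, map_smul])

end EvenForms

end Forms

section FormsFunctoriality

set_option linter.unusedSectionVars false

variable {A B : Type*} [NonUnitalRing A] [Module ℂ A] [IsScalarTower ℂ A A] [SMulCommClass ℂ A A]
  [NonUnitalRing B] [Module ℂ B] [IsScalarTower ℂ B B] [SMulCommClass ℂ B B]

/-- The homomorphism of unitizations `A⁺ → B⁺` induced by a homomorphism `A → B`. -/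
noncomputable def unitMap (f : A →ₙₐ[ℂ] B) : Unitization ℂ A →ₐ[ℂ] Unitization ℂ B :=
  Unitization.lift ((Unitization.inrNonUnitalAlgHom ℂ B).comp f)

theorem unitMap_inr (f : A →ₙₐ[ℂ] B) (a : A) :
    unitMap f (Unitization.inr a) = Unitization.inr (f a) := by
  simp [unitMap]

theorem unitMap_snd (f : A →ₙₐ[ℂ] B) (c : Unitization ℂ A) :
    (unitMap f c).snd = f c.snd := by
  simp [unitMap, Unitization.algebraMap_eq_inl]

theorem unitMap_fst (f : A →ₙₐ[ℂ] B) (c : Unitization ℂ A) :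
    (unitMap f c).fst = c.fst := by
  simp [unitMap, Unitization.algebraMap_eq_inl]

/-- The homomorphism of tensor algebras induced by a homomorphism `A → B`. -/
noncomputable def tensMap (f : A →ₙₐ[ℂ] B) : TensorAlgebra ℂ A →ₐ[ℂ] TensorAlgebra ℂ B :=
  TensorAlgebra.lift ℂ (TensorAlgebra.ι ℂ ∘ₗ (f : A →ₗ[ℂ] B))

@[simp] theorem tensMap_ι (f : A →ₙₐ[ℂ] B) (a : A) :
    tensMap f (TensorAlgebra.ι ℂ a) = TensorAlgebra.ι ℂ (f a) := by
  simp [tensMap]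

/-- The map `c da₁ ⋯ daₙ ↦ f(c) df(a₁) ⋯ df(aₙ)`. -/
noncomputable def Omega.map (f : A →ₙₐ[ℂ] B) : Omega A →ₗ[ℂ] Omega B :=
  Omega.lift ((Omega.mk B).compl₁₂ (unitMap f).toLinearMap (tensMap f).toLinearMap)

@[simp] theorem Omega.map_mk (f : A →ₙₐ[ℂ] B) (c : Unitization ℂ A) (w : TensorAlgebra ℂ A) :
    Omega.map f (Omega.mk A c w) = Omega.mk B (unitMap f c) (tensMap f w) := by
  simp [Omega.map]

theorem Omega.map_form (f : A →ₙₐ[ℂ] B) (c : Unitization ℂ A) (l : List A) :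
    Omega.map f (Omega.form c l) = Omega.form (unitMap f c) (l.map f) := by
  simp only [Omega.form, Omega.map_mk, map_list_prod, List.map_map]
  congr 3
  funext a
  simp

theorem Omega.map_d (f : A →ₙₐ[ℂ] B) (x : Omega A) :
    Omega.map f (Omega.d A x) = Omega.d B (Omega.map f x) := by
  have : Omega.map f ∘ₗ Omega.d A = Omega.d B ∘ₗ Omega.map f := Omega.hom_ext fun c w => by
    simp [Omega.d_mk, unitMap_snd]
  exact LinearMap.congr_fun this x

theorem Omega.map_L (f : A →ₙₐ[ℂ] B) (c : Unitization ℂ A) (x : Omega A) :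
    Omega.map f (Omega.L A c x) = Omega.L B (unitMap f c) (Omega.map f x) := by
  have : Omega.map f ∘ₗ Omega.L A c = Omega.L B (unitMap f c) ∘ₗ Omega.map f :=
    Omega.hom_ext fun c w => by simp
  exact LinearMap.congr_fun this x

theorem Omega.map_leftMulD (f : A →ₙₐ[ℂ] B) (w : TensorAlgebra ℂ A) (x : Omega A) :
    Omega.map f (Omega.leftMulD A w x) = Omega.leftMulD B (tensMap f w) (Omega.map f x) := by
  induction w using TensorAlgebra.induction generalizing x with
  | algebraMap r => simp [Module.algebraMap_end_apply]
  | ι a =>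
    simp only [Omega.leftMulD_ι, tensMap_ι, Omega.D_apply, LinearMap.sub_apply,
      Module.End.mul_apply, map_sub, Omega.map_d, Omega.map_L, unitMap_inr]
  | mul a b ha hb => simp only [map_mul, Module.End.mul_apply, ha, hb]
  | add a b ha hb => simp only [map_add, LinearMap.add_apply, ha, hb]

theorem Omega.map_mulForms (f : A →ₙₐ[ℂ] B) (x y : Omega A) :
    Omega.map f (Omega.mulForms A x y) = Omega.mulForms B (Omega.map f x) (Omega.map f y) := by
  have : Omega.map f ∘ₗ (Omega.mulForms A).flip y =
      (Omega.mulForms B).flip (Omega.map f y) ∘ₗ Omega.map f := Omega.hom_ext fun c w => by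
    simp [Omega.mulForms_mk, Omega.map_L, Omega.map_leftMulD]
  exact LinearMap.congr_fun this x

theorem Omega.map_grad (f : A →ₙₐ[ℂ] B) (x : Omega A) :
    Omega.map f (Omega.grad A x) = Omega.grad B (Omega.map f x) := by
  have h : (tensMap f).comp (Omega.gradT A) = (Omega.gradT B).comp (tensMap f) :=
    TensorAlgebra.hom_ext (by ext; simp)
  have : Omega.map f ∘ₗ Omega.grad A = Omega.grad B ∘ₗ Omega.map f :=
    Omega.hom_ext fun c w => by
      have := DFunLike.congr_fun h w
      simp only [AlgHom.comp_apply] at this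
      simp [this]
  exact LinearMap.congr_fun this x

theorem Omega.map_aug (f : A →ₙₐ[ℂ] B) (x : Omega A) :
    Omega.aug B (Omega.map f x) = Omega.aug A x := by
  have h : (TensorAlgebra.algebraMapInv (R := ℂ) (M := B)).comp (tensMap f) =
      TensorAlgebra.algebraMapInv := TensorAlgebra.hom_ext (by ext; simp [Omega.algebraMapInv_ι])
  have : Omega.aug B ∘ₗ Omega.map f = Omega.aug A :=
    Omega.hom_ext fun c w => by
      have := DFunLike.congr_fun h w
      simp only [AlgHom.comp_apply] at this
      simp [Omega.aug_mk, unitMap_fst, this]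
  exact LinearMap.congr_fun this x

/-- The homomorphism `c da₁ ⋯ da₂ₙ ↦ f(c) df(a₁) ⋯ df(a₂ₙ)` for the Fedosov products. -/
noncomputable def EvenForms.map (f : A →ₙₐ[ℂ] B) : EvenForms A →ₙₐ[ℂ] EvenForms B where
  toFun x := ⟨Omega.map f x.val, by rw [← Omega.map_grad, x.grad_val],
    by rw [Omega.map_aug, x.aug_val]⟩
  map_smul' c x := EvenForms.ext (map_smul (Omega.map f) c x.val)
  map_zero' := EvenForms.ext (map_zero (Omega.map f))
  map_add' x y := EvenForms.ext (map_add (Omega.map f) x.val y.val)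
  map_mul' x y := EvenForms.ext (by
    change Omega.map f (Omega.fedosov A x.val y.val) =
      Omega.fedosov B (Omega.map f x.val) (Omega.map f y.val)
    rw [Omega.fedosov_apply, map_sub, Omega.map_mulForms, Omega.map_mulForms, Omega.map_d,
      Omega.map_d, Omega.map_grad, Omega.fedosov_apply])

theorem EvenForms.val_map (f : A →ₙₐ[ℂ] B) (x : EvenForms A) :
    (EvenForms.map f x).val = Omega.map f x.val := rfl

end FormsFunctoriality

section FormsBornology

set_option linter.unusedSectionVars false

variable {A B : Type*} [NonUnitalRing A] [Module ℂ A] [Bornology A] [BornologicalAlgebra A]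
  [NonUnitalRing B] [Module ℂ B] [Bornology B] [BornologicalAlgebra B]

namespace Omega

/-- The set of the forms `c da₁ ⋯ daₙ` with `c ∈ S ∪ {1}` and `aⱼ ∈ T`. -/
def forms (S T : Set A) : Set (Omega A) :=
  {x | ∃ (c : Unitization ℂ A) (l : List A), (c = 1 ∨ ∃ a ∈ S, c = Unitization.inr a) ∧
    (∀ a ∈ l, a ∈ T) ∧ x = form c l}

theorem forms_mono {S S' T T' : Set A} (hS : S ⊆ S') (hT : T ⊆ T') :
    forms S T ⊆ forms S' T' := by
  rintro _ ⟨c, l, hc, hl, rfl⟩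
  exact ⟨c, l, hc.imp_right fun ⟨a, ha, h⟩ => ⟨a, hS ha, h⟩, fun a ha => hT (hl a ha), rfl⟩

theorem gradT_list (l : List A) : gradT A (l.map (TensorAlgebra.ι ℂ)).prod =
    (-1 : ℂ) ^ l.length • (l.map (TensorAlgebra.ι ℂ)).prod := by
  induction l with
  | nil => simp
  | cons a l ih => simp [ih, pow_succ]

theorem grad_form (c : Unitization ℂ A) (l : List A) :
    grad A (form c l) = (-1 : ℂ) ^ l.length • form c l := by
  rw [form, grad_mk, gradT_list, map_smul]

theorem aug_form (c : Unitization ℂ A) (l : List A) :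
    aug A (form c l) = if l = [] then c.fst else 0 := by
  cases l <;> simp [form, aug_mk, algebraMapInv_ι]

theorem d_form (c : Unitization ℂ A) (l : List A) : d A (form c l) = form 1 (c.snd :: l) := by
  simp [form, d_mk]

theorem mulForms_form (c : Unitization ℂ A) (l : List A) (x : Omega A) :
    mulForms A (form c l) x = L A c (leftMulD A (l.map (TensorAlgebra.ι ℂ)).prod x) := by
  rw [form, mulForms_mk, Module.End.mul_apply]

/-- The bounded set of tails that occur in products. -/
def tails (S : Set A) : Set A :=
  (S ∪ S * S ∪ {0}) ∪ (2 : ℂ) • (S ∪ S * S ∪ {0})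

theorem isBounded_tails {S : Set A} (hS : IsBounded S) : IsBounded (tails S) := by
  have : IsBounded (S ∪ S * S ∪ {0}) :=
    (hS.union (BornologicalAlgebra.isBounded_mul S S hS hS)).union isBounded_singleton
  exact this.union (isBounded_smul this 2)

theorem D_forms {S : Set A} {a : A} (ha : a ∈ S) {x : Omega A}
    (hx : x ∈ diskHull (forms S (tails S))) :
    D A (Unitization.inr a) x ∈ diskHull (forms S (tails S)) := by
  have key : diskHull (forms S (tails S)) ⊆
      (D A (Unitization.inr a)) ⁻¹' diskHull (forms S (tails S)) := by
    refine diskHull_min ((isDisk_diskHull _).preimage _) ?_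
    rintro _ ⟨c, l, hc, hl, rfl⟩
    have h1 : (Unitization.inr a * c).snd ∈ S ∪ S * S ∪ {0} := by
      rcases hc with rfl | ⟨b, hb, rfl⟩
      · exact Or.inl (Or.inl (by simpa using ha))
      · exact Or.inl (Or.inr ⟨a, ha, b, hb, by simp⟩)
    have h2 : c.snd ∈ S ∪ S * S ∪ {0} := by
      rcases hc with rfl | ⟨b, hb, rfl⟩
      · exact Or.inr (by simp)
      · exact Or.inl (Or.inl (by simpa using hb))
    have h3 : form 1 ((2 : ℂ) • (Unitization.inr a * c).snd :: l) ∈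
        diskHull (forms S (tails S)) := subset_diskHull _ ⟨_, _, Or.inl rfl, by
      intro b hb
      rcases List.mem_cons.1 hb with rfl | hb
      · exact Or.inr ⟨_, h1, rfl⟩
      · exact hl b hb, rfl⟩
    have h4 : form (Unitization.inr a) ((2 : ℂ) • c.snd :: l) ∈
        diskHull (forms S (tails S)) := subset_diskHull _ ⟨_, _, Or.inr ⟨a, ha, rfl⟩, by
      intro b hb
      rcases List.mem_cons.1 hb with rfl | hb
      · exact Or.inr ⟨_, h2, rfl⟩
      · exact hl b hb, rfl⟩
    have := isDisk_diskHull _ _ h3 _ h4 (1 / 2) (-(1 / 2)) (by norm_num)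
    rw [Set.mem_preimage]
    convert this using 1
    generalize hu : (Unitization.inr a * c).snd = u
    generalize hv : c.snd = v
    rw [form, D_mk, hu, hv]
    simp [form, smul_smul, sub_eq_add_neg]
  exact key hx

theorem leftMulD_forms {S : Set A} {l : List A} (hl : ∀ a ∈ l, a ∈ S) {x : Omega A}
    (hx : x ∈ diskHull (forms S (tails S))) :
    leftMulD A (l.map (TensorAlgebra.ι ℂ)).prod x ∈ diskHull (forms S (tails S)) := by
  induction l with
  | nil => simpa using hx
  | cons a l ih =>
    simp only [List.map_cons, List.prod_cons, map_mul, Module.End.mul_apply, leftMulD_ι]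
    exact D_forms (hl a (by simp)) (ih fun b hb => hl b (by simp [hb]))

theorem L_forms {S : Set A} {c : Unitization ℂ A} (hc : c = 1 ∨ ∃ a ∈ S, c = Unitization.inr a)
    {x : Omega A} (hx : x ∈ diskHull (forms S (tails S))) :
    L A c x ∈ diskHull (forms (tails S) (tails S)) := by
  have hST : ∀ x ∈ S ∪ S * S, x ∈ tails S := fun x hx => Or.inl (Or.inl hx)
  have key : diskHull (forms S (tails S)) ⊆
      (L A c) ⁻¹' diskHull (forms (tails S) (tails S)) := by
    refine diskHull_min ((isDisk_diskHull _).preimage _) ?_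
    rintro _ ⟨c', l, hc', hl, rfl⟩
    refine subset_diskHull _ ⟨c * c', l, ?_, hl, by simp [form]⟩
    rcases hc with rfl | ⟨a, ha, rfl⟩ <;> rcases hc' with rfl | ⟨b, hb, rfl⟩
    · exact Or.inl (one_mul 1)
    · exact Or.inr ⟨b, hST _ (Or.inl hb), one_mul _⟩
    · exact Or.inr ⟨a, hST _ (Or.inl ha), mul_one _⟩
    · exact Or.inr ⟨a * b, hST _ (Or.inr ⟨a, ha, b, hb, rfl⟩), by simp⟩
  exact key hx

/-- The product of two forms with entries in `S`, up to the disked hull. -/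
theorem mulForms_forms {S : Set A} {x y : Omega A} (hx : x ∈ forms S S) (hy : y ∈ forms S S) :
    mulForms A x y ∈ diskHull (forms (tails S) (tails S)) := by
  obtain ⟨c, l, hc, hl, rfl⟩ := hx
  rw [mulForms_form]
  exact L_forms hc (leftMulD_forms hl (subset_diskHull _
    (forms_mono subset_rfl (fun a ha => Or.inl (Or.inl (Or.inl ha))) hy)))

theorem d_forms {S : Set A} {x : Omega A} (hx : x ∈ forms S S) :
    d A x ∈ forms (S ∪ {0}) (S ∪ {0}) := by
  obtain ⟨c, l, hc, hl, rfl⟩ := hx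
  refine ⟨1, c.snd :: l, Or.inl rfl, fun b hb => ?_, d_form c l⟩
  rcases List.mem_cons.1 hb with rfl | hb
  · rcases hc with rfl | ⟨a, ha, rfl⟩
    · exact Or.inr (by simp)
    · exact Or.inl (by simpa using ha)
  · exact Or.inl (hl b hb)

theorem mem_span_lists (w : TensorAlgebra ℂ A) : w ∈ Submodule.span ℂ
    (Set.range fun l : List A => (l.map (TensorAlgebra.ι ℂ)).prod) := by
  set P := Submodule.span ℂ
    (Set.range fun l : List A => (l.map (TensorAlgebra.ι ℂ)).prod) with hP
  have key : ∀ w v, v ∈ P → w * v ∈ P := by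
    intro w
    induction w using TensorAlgebra.induction with
    | algebraMap r =>
      intro v hv
      rw [← Algebra.smul_def]
      exact P.smul_mem _ hv
    | ι a =>
      intro v hv
      have : P ≤ P.comap (LinearMap.mulLeft ℂ (TensorAlgebra.ι ℂ a)) := by
        refine Submodule.span_le.2 ?_
        rintro _ ⟨l, rfl⟩
        exact Submodule.subset_span ⟨a :: l, by simp⟩
      exact this hv
    | mul a b ha hb =>
      intro v hv
      rw [mul_assoc]
      exact ha _ (hb _ hv)
    | add a b ha hb =>
      intro v hv
      rw [add_mul]
      exact add_mem (ha v hv) (hb v hv)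
  simpa using key w 1 (Submodule.subset_span ⟨[], by simp⟩)

theorem mem_span_forms (x : Omega A) :
    x ∈ Submodule.span ℂ (forms (A := A) Set.univ Set.univ) := by
  set Q := Submodule.span ℂ (forms (A := A) Set.univ Set.univ) with hQ
  have key : ∀ (c : Unitization ℂ A) (w : TensorAlgebra ℂ A), mk A c w ∈ Q := by
    intro c w
    have : Submodule.span ℂ (Set.range fun l : List A => (l.map (TensorAlgebra.ι ℂ)).prod) ≤
        Q.comap (mk A c) := by
      refine Submodule.span_le.2 ?_
      rintro _ ⟨l, rfl⟩
      have hf : ∀ c', (c' = 1 ∨ ∃ a ∈ (Set.univ : Set A), c' = Unitization.inr a) →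
          mk A c' (l.map (TensorAlgebra.ι ℂ)).prod ∈ Q := fun c' hc' =>
        Submodule.subset_span ⟨c', l, hc', fun _ _ => trivial, rfl⟩
      have h : c = c.fst • (1 : Unitization ℂ A) + Unitization.inr c.snd := by
        conv_lhs => rw [← Unitization.inl_fst_add_inr_snd_eq c]
        rw [← Unitization.algebraMap_eq_inl, Algebra.algebraMap_eq_smul_one]
      change mk A c _ ∈ Q
      rw [h, map_add, map_smul, LinearMap.add_apply, LinearMap.smul_apply]
      exact add_mem (Submodule.smul_mem _ _ (hf _ (Or.inl rfl)))
        (hf _ (Or.inr ⟨_, trivial, rfl⟩))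
    exact this (mem_span_lists w)
  have : (Q.mkQ : Omega A →ₗ[ℂ] _) = 0 := hom_ext fun c w => by
    simpa using key c w
  simpa using LinearMap.congr_fun this x

end Omega

namespace EvenForms

/-- The projection of all forms to the even forms over `A`. -/
noncomputable def proj : Omega A →ₗ[ℂ] EvenForms A :=
  LinearMap.codRestrict (evenForms A)
    ((1 / 2 : ℂ) • (LinearMap.id + Omega.grad A) - (Omega.aug A).smulRight (Omega.form 1 []))
    (fun x => by
      constructor
      · simp only [LinearMap.sub_apply, LinearMap.smul_apply, LinearMap.add_apply,
          LinearMap.id_apply, LinearMap.smulRight_apply, map_sub, map_smul, map_add,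
          Omega.grad_grad, Omega.grad_form]
        simp [add_comm]
      · simp only [LinearMap.sub_apply, LinearMap.smul_apply, LinearMap.add_apply,
          LinearMap.id_apply, LinearMap.smulRight_apply, map_sub, map_smul, map_add,
          Omega.aug_grad, Omega.aug_form, smul_eq_mul]
        simp
        ring)

theorem val_proj (x : Omega A) : (proj x).val =
    (1 / 2 : ℂ) • (x + Omega.grad A x) - Omega.aug A x • Omega.form 1 [] := rfl

theorem proj_val (x : EvenForms A) : proj x.val = x := ext (by
  rw [val_proj, x.grad_val, x.aug_val, zero_smul, sub_zero, ← two_smul ℂ, smul_smul]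
  norm_num)

/-- The set `S° (dS)^{ev}`, where `S° = S ∪ {1}`: all the even forms `a₀ da₁ ⋯ da₂ₙ` with `n ≥ 0`
and `da₁ ⋯ da₂ₙ` with `n ≥ 1`, where all `aⱼ` belong to `S`. -/
def generators (S : Set A) : Set (EvenForms A) :=
  {x | ∃ (c : Unitization ℂ A) (l : List A), (c = 1 ∨ ∃ a ∈ S, c = Unitization.inr a) ∧
    (∀ a ∈ l, a ∈ S) ∧ Even l.length ∧ x.val = Omega.form c l}

theorem generators_mono {S T : Set A} (h : S ⊆ T) : generators S ⊆ generators T := by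
  rintro x ⟨c, l, hc, hl, he, hx⟩
  exact ⟨c, l, hc.imp_right fun ⟨a, ha, h'⟩ => ⟨a, h ha, h'⟩, fun a ha => h (hl a ha), he, hx⟩

theorem zero_mem_generators {S : Set A} (h : (0 : A) ∈ S) : 0 ∈ generators S :=
  ⟨Unitization.inr 0, [], Or.inr ⟨0, h, rfl⟩, by simp, by simp, by simp [Omega.form]⟩

theorem proj_form {S : Set A} {x : Omega A} (hx : x ∈ Omega.forms S S) :
    proj x ∈ generators (S ∪ {0}) := by
  obtain ⟨c, l, hc, hl, rfl⟩ := hx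
  have h0 : (0 : EvenForms A) ∈ generators (S ∪ {0}) := zero_mem_generators (Or.inr rfl)
  rcases Nat.even_or_odd l.length with he | ho
  · have h1 : (1 / 2 : ℂ) • (Omega.form c l + Omega.grad A (Omega.form c l)) =
        Omega.form c l := by
      rw [Omega.grad_form, he.neg_one_pow, one_smul, ← two_smul ℂ, smul_smul]
      norm_num
    rcases hc with rfl | ⟨a, ha, rfl⟩
    · rcases eq_or_ne l [] with rfl | hne
      · convert h0
        refine ext ?_
        rw [val_proj, h1, Omega.aug_form]
        simp
      · refine ⟨1, l, Or.inl rfl, fun b hb => Or.inl (hl b hb), he, ?_⟩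
        rw [val_proj, h1, Omega.aug_form]
        simp [hne]
    · refine ⟨_, l, Or.inr ⟨a, Or.inl ha, rfl⟩, fun b hb => Or.inl (hl b hb), he, ?_⟩
      rw [val_proj, h1, Omega.aug_form]
      simp
  · convert h0
    refine ext ?_
    have hne : l ≠ [] := by
      rintro rfl
      simp at ho
    rw [val_proj, Omega.grad_form, Omega.aug_form, ho.neg_one_pow]
    simp [hne]

theorem proj_diskHull {S : Set A} {x : Omega A} (hx : x ∈ diskHull (Omega.forms S S)) :
    proj x ∈ diskHull (generators (S ∪ {0})) := by
  have := map_diskHull_subset (proj (A := A)) _ ⟨x, hx, rfl⟩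
  refine diskHull_mono ?_ this
  rintro _ ⟨y, hy, rfl⟩
  exact proj_form hy

theorem generators_nonempty :
    ∃ S : {S : Set A // IsBounded S}, (generators S.1).Nonempty :=
  ⟨⟨{0}, isBounded_singleton⟩, 0, zero_mem_generators rfl⟩

theorem generators_span :
    ⊤ ≤ Submodule.span ℂ (⋃ S : {S : Set A // IsBounded S}, generators S.1) := by
  intro x _
  have h : Submodule.span ℂ (Omega.forms (A := A) Set.univ Set.univ) ≤
      (Submodule.span ℂ (⋃ S : {S : Set A // IsBounded S}, generators S.1)).comap proj := by
    refine Submodule.span_le.2 ?_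
    rintro _ ⟨c, l, hc, -, rfl⟩
    refine Submodule.subset_span (Set.mem_iUnion.2 ⟨⟨{a | a ∈ l} ∪ {c.snd} ∪ {0}, ?_⟩,
      proj_form ⟨c, l, ?_, fun a ha => Or.inl ha, rfl⟩⟩)
    · exact ((Set.Finite.isBounded (List.finite_toSet l)).union isBounded_singleton).union
        isBounded_singleton
    · rcases hc with rfl | ⟨a, -, rfl⟩
      · exact Or.inl rfl
      · exact Or.inr ⟨a, Or.inr (by simp), rfl⟩
  have := h (Omega.mem_span_forms x.val)
  rwa [Submodule.mem_comap, proj_val] at this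

theorem two_smul_generators (S : Set A) {x : EvenForms A} (hx : x ∈ generators S) :
    (2 : ℂ) • x ∈ generators (S ∪ (2 : ℂ) • S) := by
  obtain ⟨c, l, hc, hl, he, hx⟩ := hx
  rcases hc with rfl | ⟨a, ha, rfl⟩
  · cases l with
    | nil =>
      have := x.aug_val
      rw [hx, Omega.aug_form] at this
      simp at this
    | cons a l =>
      refine ⟨1, (2 : ℂ) • a :: l, Or.inl rfl, ?_, by simpa using he, ?_⟩
      · intro b hb
        rcases List.mem_cons.1 hb with rfl | hb
        · exact Or.inr ⟨a, hl a (by simp), rfl⟩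
        · exact Or.inl (hl b (by simp [hb]))
      · rw [map_smul, hx]
        simp [Omega.form]
  · refine ⟨Unitization.inr ((2 : ℂ) • a), l, Or.inr ⟨_, Or.inr ⟨a, ha, rfl⟩, rfl⟩,
      fun b hb => Or.inl (hl b hb), he, ?_⟩
    rw [map_smul, hx]
    simp [Omega.form]

theorem generators_add (S T : {S : Set A // IsBounded S}) : ∃ U : {S : Set A // IsBounded S},
    ∀ x ∈ generators S.1 ∪ generators T.1, (2 : ℂ) • x ∈ diskHull (generators U.1) := by
  have hST := S.2.union T.2
  refine ⟨⟨_, hST.union (isBounded_smul hST 2)⟩, fun x hx => subset_diskHull _ ?_⟩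
  refine two_smul_generators _ ?_
  rcases hx with hx | hx
  · exact generators_mono Set.subset_union_left hx
  · exact generators_mono Set.subset_union_right hx

/-- The convex bornology on the even forms that is generated by the sets `S° (dS)^{ev}` with
bounded `S ⊆ A`. -/
noncomputable instance instBornology : Bornology (EvenForms A) :=
  bornologyOfHulls (fun S : {S : Set A // IsBounded S} => generators S.1) generators_nonempty
    generators_add generators_span

theorem isBounded_iff {X : Set (EvenForms A)} :
    IsBounded X ↔ ∃ S : {S : Set A // IsBounded S}, X ⊆ diskHull (generators S.1) :=
  isBounded_bornologyOfHulls generators_nonempty generators_add generators_span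

instance instConvexBornology : ConvexBornology (EvenForms A) :=
  convexBornology_of_hulls (fun S : {S : Set A // IsBounded S} => generators S.1) generators_add
    fun _ => isBounded_iff

theorem generators_mul {S : Set A} (hS : IsBounded S) :
    IsBounded (generators S * generators S) := by
  have hS0 : IsBounded (S ∪ {0}) := hS.union isBounded_singleton
  have h1 : IsBounded (diskHull (generators (Omega.tails S ∪ {0}))) :=
    isBounded_iff.2 ⟨⟨_, (Omega.isBounded_tails hS).union isBounded_singleton⟩, subset_rfl⟩
  have h2 : IsBounded (diskHull (generators (Omega.tails (S ∪ {0}) ∪ {0}))) :=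
    isBounded_iff.2 ⟨⟨_, (Omega.isBounded_tails hS0).union isBounded_singleton⟩, subset_rfl⟩
  refine (ConvexBornology.isBounded_add _ _ h1 h2).subset ?_
  rintro _ ⟨x, hx, y, hy, rfl⟩
  have hform : ∀ z ∈ generators S, z.val ∈ Omega.forms S S := by
    rintro z ⟨c, l, hc, hl, -, hz⟩
    exact ⟨c, l, hc, hl, hz⟩
  refine ⟨_, proj_diskHull (Omega.mulForms_forms (hform x hx) (hform y hy)), _,
    (isDisk_diskHull _).neg_mem (proj_diskHull (Omega.mulForms_forms
      (Omega.d_forms (hform x hx)) (Omega.d_forms (hform y hy)))), ?_⟩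
  change _ = x * y
  rw [← proj_val (x * y), val_mul, Omega.fedosov_apply, x.grad_val, map_sub]
  exact (sub_eq_add_neg _ _).symm

instance instBornologicalAlgebra : BornologicalAlgebra (EvenForms A) where
  smul_assoc := smul_assoc
  smul_comm := smul_comm
  isBounded_mul X Y hX hY := by
    obtain ⟨⟨S, hS⟩, hX⟩ := isBounded_iff.1 hX
    obtain ⟨⟨T, hT⟩, hY⟩ := isBounded_iff.1 hY
    refine (ConvexBornology.isBounded_diskHull _ (generators_mul (hS.union hT))).subset ?_
    rintro _ ⟨x, hx, y, hy, rfl⟩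
    have := bilin_diskHull (LinearMap.mul ℂ (EvenForms A))
      (diskHull_mono (generators_mono (Set.subset_union_left (t := T))) (hX hx))
      (diskHull_mono (generators_mono (Set.subset_union_right (s := S))) (hY hy))
    exact this

theorem boundedMap_map (f : A →ₙₐ[ℂ] B) (hf : BoundedMap f) :
    BoundedMap (EvenForms.map f) := fun X hX => by
  obtain ⟨⟨S, hS⟩, hX⟩ := isBounded_iff.1 hX
  refine isBounded_iff.2 ⟨⟨f '' S, hf S hS⟩, ?_⟩
  refine (Set.image_mono hX).trans ((map_diskHull_subset
    (EvenForms.map f : EvenForms A →ₗ[ℂ] EvenForms B) (generators S)).trans (diskHull_mono ?_))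
  rintro _ ⟨x, ⟨c, l, hc, hl, he, hx⟩, rfl⟩
  refine ⟨unitMap f c, l.map f, ?_, ?_, by simpa using he, ?_⟩
  · rcases hc with rfl | ⟨a, ha, rfl⟩
    · exact Or.inl (map_one _)
    · exact Or.inr ⟨f a, ⟨a, ha, rfl⟩, unitMap_inr f a⟩
  · intro b hb
    obtain ⟨a, ha, rfl⟩ := List.mem_map.1 hb
    exact ⟨a, hl a ha, rfl⟩
  · exact (congrArg (Omega.map f) hx).trans (Omega.map_form f c l)

end EvenForms

variable (A) in
/-- The analytic tensor algebra `𝒯 A`: the completion of the algebra of even differential forms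
over `A` with the Fedosov product, with respect to the bornology generated by the sets
`S° (dS)^{ev}`. -/
abbrev AnTensor : Type _ := Completion (EvenForms A)

/-- The bounded homomorphism `𝒯 f : 𝒯 A → 𝒯 B` induced by a bounded homomorphism `f : A → B`,
determined by `a₀ da₁ ⋯ da₂ₙ ↦ f(a₀) df(a₁) ⋯ df(a₂ₙ)`. -/
noncomputable def AnTensor.map (f : A →ₙₐ[ℂ] B) (hf : BoundedMap f) : AnTensor A →ₙₐ[ℂ] AnTensor B :=
  Completion.mapHom (EvenForms.map f) (EvenForms.boundedMap_map f hf)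

end FormsBornology

section Extensions

variable {N E A : Type*} [NonUnitalRing N] [Module ℂ N] [Bornology N]
  [NonUnitalRing E] [Module ℂ E] [Bornology E] [NonUnitalRing A] [Module ℂ A] [Bornology A]

/-- An extension `N ↣ E ↠ A` of bornological algebras: `i` and `p` are bounded homomorphisms, `i`
is a bornological isomorphism onto its range with the subspace bornology, the range of `i` is the
kernel of `p`, and `p` induces a bornological isomorphism from `E / i(N)` with the quotient
bornology onto `A`. -/
structure IsExtension (i : N →ₙₐ[ℂ] E) (p : E →ₙₐ[ℂ] A) : Prop where
  bounded_i : BoundedMap i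
  bounded_p : BoundedMap p
  injective : Function.Injective i
  bounded_of_image : ∀ S : Set N, IsBounded (i '' S) → IsBounded S
  exact : ∀ x : E, p x = 0 ↔ x ∈ Set.range i
  surjective : Function.Surjective p
  exists_bounded_lift : ∀ T : Set A, IsBounded T → ∃ S : Set E, IsBounded S ∧ T ⊆ p '' S

/-- An analytically nilpotent extension: an extension that is allowable, that is, has a bounded
linear section, and whose kernel is analytically nilpotent. -/
structure IsANilpotentExtension (i : N →ₙₐ[ℂ] E) (p : E →ₙₐ[ℂ] A) : Prop extends
    IsExtension i p where
  allowable : ∃ s : A →ₗ[ℂ] E, BoundedMap s ∧ ∀ a, p (s a) = a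
  nilpotent : IsANilpotent N

end Extensions

end BornAlg

/-! Let `s` be a bounded linear section of `p` and put q = s ∘ p. The straight path φ = q + u (id -
q), with u = t or u = 1 - t, joins q and id. In its curvature the mixed terms cancel, and what
remains is (1 - u) ω_q(x, y) + u (1 - u) (x - qx)(y - qy), see `curvature_homotopyMap`. Both
coefficients lie in ker p = i(N), because p ∘ q = p. A product of n such curvatures is therefore a
polynomial in t of degree at most 2n whose coefficients are controlled by the semigroup generated by
a bounded subset of N.

The analytic point is that such products stay bounded in C^∞([0,1]; E). The k-th derivative of tᵃ(1
- t)ᵇ with a + b ≤ 4n is at most (4n)^k, so the factor 4⁻ⁿ makes all these monomials one bounded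
multiplicative semigroup (`SmoothFn.isBounded_scaledMonomials`). The compensating factor cⁿ is
harmless: analytic nilpotence of N applies to c • S as well as to S. Hence φ is a lanilcur
(`isLanilcur_homotopyMap`), which gives the deformation retraction. Taking q = 0 on N gives the
contraction.

For the analytic tensor algebras, the identity da db = ab - a ⊙ b turns the even forms with the
Fedosov product into a tensor algebra. A linear map l with curvature ω extends to the homomorphism
a₀ da₁ ⋯ da₂ₙ ↦ l(a₀) ω(a₁, a₂) ⋯ ω(a₂ₙ₋₁, a₂ₙ), and this extension is bounded if l is a lanilcur
(`EvenForms.boundedMap_lift`). It thus suffices to see that j ∘ φ is a lanilcur, where j : E → 𝒯E is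
the canonical map. Its curvature involves j of the old coefficients together with the curvature of
j, that is, the forms dx dy. The key estimate `EvenForms.nilSet_incl` says that these two kinds of
elements together generate a bounded semigroup. The same estimate makes j ∘ s a lanilcur, whose
extension 𝒯A → 𝒯E is a right inverse of 𝒯p. Since q ∘ s = s, the homotopy is constant on the image
of this section. -/

namespace BornAlg

/-! ### Sets that generate bounded semigroups. -/

section NilSets

set_option linter.unusedSectionVars false

variable {A B : Type*} [NonUnitalRing A] [Module ℂ A] [Bornology A]
  [NonUnitalRing B] [Module ℂ B] [Bornology B]

/-- Sets that generate a bounded multiplicative semigroup. -/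
def NilSet (S : Set A) : Prop := IsBounded (Subsemigroup.closure S : Set A)

theorem NilSet.mono {S T : Set A} (hT : NilSet T) (h : S ⊆ T) : NilSet S :=
  Bornology.IsBounded.subset hT (Subsemigroup.closure_mono h)

/-- The working criterion: an explicit bounded semigroup around the set is usually easier to exhibit
than a description of the generated one. -/
theorem NilSet.of_subsemigroup {S : Set A} (P : Subsemigroup A) (hP : IsBounded (P : Set A))
    (h : S ⊆ P) : NilSet S :=
  hP.subset (Subsemigroup.closure_le.2 h)

theorem nilSet_zero : NilSet ({0} : Set A) :=
  NilSet.of_subsemigroup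
    { carrier := {0}
      mul_mem' := by
        rintro _ _ rfl rfl
        exact mul_zero _ }
    isBounded_singleton subset_rfl

theorem NilSet.image {S : Set A} (hS : NilSet S) (f : A →ₙₐ[ℂ] B) (hf : BoundedMap f) :
    NilSet (f '' S) := by
  refine (hf _ hS).subset ?_
  rw [← MulHom.coe_coe f, ← MulHom.map_mclosure, Subsemigroup.coe_map]

/-- The disked hull of a multiplicative semigroup is closed under multiplication. -/
theorem mul_mem_diskHull [IsScalarTower ℂ A A] [SMulCommClass ℂ A A] (P : Subsemigroup A)
    {x y : A} (hx : x ∈ diskHull (P : Set A)) (hy : y ∈ diskHull (P : Set A)) :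
    x * y ∈ diskHull (P : Set A) := by
  have := bilin_diskHull (LinearMap.mul ℂ A) hx hy
  refine diskHull_mono ?_ this
  rintro _ ⟨a, ha, b, hb, rfl⟩
  exact P.mul_mem ha hb

/-- The disked hull of the generated semigroup is again a bounded semigroup. This is what permits
curvatures to be estimated as sums of several terms, once each term carries a suitable fraction. -/
theorem NilSet.diskHull [BornologicalAlgebra A] {S : Set A} (hS : NilSet S) :
    NilSet (BornAlg.diskHull S) :=
  NilSet.of_subsemigroup
    { carrier := BornAlg.diskHull (Subsemigroup.closure S : Set A)
      mul_mem' := fun hx hy => mul_mem_diskHull _ hx hy }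
    (ConvexBornology.isBounded_diskHull _ hS) (diskHull_mono Subsemigroup.subset_closure)

/-- Products of elementary tensors are taken factorwise, so the growth of the scalar functions and
of the algebra coefficients can be treated separately. -/
theorem NilSet.tmul [BornologicalAlgebra A] [BornologicalAlgebra B] {S : Set A} {T : Set B}
    (hS : NilSet S) (hT : NilSet T) :
    NilSet (Set.image2 (fun a b => a ⊗ₜ[ℂ] b) S T) :=
  NilSet.of_subsemigroup
    { carrier := Set.image2 (fun a b => a ⊗ₜ[ℂ] b) (Subsemigroup.closure S : Set A)
        (Subsemigroup.closure T : Set B)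
      mul_mem' := by
        rintro _ _ ⟨a, ha, b, hb, rfl⟩ ⟨a', ha', b', hb', rfl⟩
        exact ⟨a * a', mul_mem ha ha', b * b', mul_mem hb hb', by simp⟩ }
    (isBounded_tensor_iff.2 ⟨⟨⟨_, hS⟩, ⟨_, hT⟩⟩, subset_diskHull _⟩)
    (Set.image2_subset Subsemigroup.subset_closure Subsemigroup.subset_closure)

end NilSets

/-! ### Growth of the derivatives of tᵃ(1 - t)ᵇ on [0,1]. -/

namespace SmoothFn

open Polynomial

/-- The identity function `t ↦ t`. -/
noncomputable def coord : SmoothFn :=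
  ⟨fun t => ((t : ℝ) : ℂ), by
    have h : ContDiffOn ℝ ∞ (fun t : ℝ => (t : ℂ)) (Set.Icc 0 1) :=
      Complex.ofRealCLM.contDiff.contDiffOn
    exact h.congr fun t ht => Set.IccExtend_of_mem _ _ ht⟩

@[simp] theorem eval_coord (t : Set.Icc (0 : ℝ) 1) : eval t coord = ((t : ℝ) : ℂ) := rfl

theorem toFun_aeval (P : ℂ[X]) {t : ℝ} (ht : t ∈ Set.Icc (0 : ℝ) 1) :
    (aeval coord P).toFun t = P.eval (t : ℂ) := by
  have h : (aeval coord P).toFun t = eval ⟨t, ht⟩ (aeval coord P) :=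
    Set.IccExtend_of_mem _ _ ht
  rw [h, ← aeval_algHom_apply, eval_coord, coe_aeval_eq_eval]

/-- Reduces the one-sided derivatives on [0,1] to formal derivatives, where the product rule is pure
algebra. -/
theorem iteratedDerivWithin_aeval (P : ℂ[X]) (k : ℕ) {t : ℝ} (ht : t ∈ Set.Icc (0 : ℝ) 1) :
    iteratedDerivWithin k (aeval coord P).toFun (Set.Icc 0 1) t =
      (derivative^[k] P).eval (t : ℂ) := by
  induction k generalizing t with
  | zero => simpa using toFun_aeval P ht
  | succ k ih =>
    rw [iteratedDerivWithin_succ, derivWithin_congr (fun x hx => ih hx) (ih ht),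
      Function.iterate_succ_apply']
    exact ((Polynomial.hasDerivAt _ _).comp_ofReal.hasDerivWithinAt).derivWithin
      (uniqueDiffOn_Icc zero_lt_one t ht)

/-- Differentiating once produces two monomials of the same shape, with coefficients of absolute
values a and b and exponent sum no larger than before. Each derivative thus costs at most a factor a
+ b, and the monomials themselves are bounded by 1 on [0,1]. -/
theorem norm_eval_iterate_derivative_le (k a b : ℕ) {t : ℝ} (ht : t ∈ Set.Icc (0 : ℝ) 1) :
    ‖(derivative^[k] (X ^ a * (1 - X) ^ b : ℂ[X])).eval (t : ℂ)‖ ≤ ((a + b : ℕ) : ℝ) ^ k := by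
  induction k generalizing a b with
  | zero =>
    have h1 : ‖(1 : ℂ) - t‖ ≤ 1 := by
      rw [← Complex.ofReal_one, ← Complex.ofReal_sub, Complex.norm_real, Real.norm_eq_abs,
        abs_le]
      constructor <;> linarith [ht.1, ht.2]
    have h2 : ‖(t : ℂ)‖ ≤ 1 := by
      rw [Complex.norm_real, Real.norm_of_nonneg ht.1]
      exact ht.2
    simp only [Function.iterate_zero, id, eval_mul, eval_pow, eval_X, eval_sub, eval_one,
      norm_mul, norm_pow, pow_zero]
    exact mul_le_one₀ (pow_le_one₀ (norm_nonneg _) h2) (by positivity)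
      (pow_le_one₀ (norm_nonneg _) h1)
  | succ k ih =>
    -- The truncated exponents a - 1 and b - 1 are harmless at zero, since the coefficient then
    -- vanishes.
    have hd : derivative (X ^ a * (1 - X) ^ b : ℂ[X]) =
        C (a : ℂ) * (X ^ (a - 1) * (1 - X) ^ b) - C (b : ℂ) * (X ^ a * (1 - X) ^ (b - 1)) := by
      simp only [derivative_mul, derivative_pow, derivative_sub, derivative_one,
        derivative_X]
      ring
    rw [Function.iterate_succ_apply, hd, iterate_derivative_sub, iterate_derivative_C_mul,
      iterate_derivative_C_mul, eval_sub, eval_mul, eval_mul, eval_C, eval_C]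
    refine (norm_sub_le _ _).trans ?_
    rw [norm_mul, norm_mul, Complex.norm_natCast, Complex.norm_natCast, pow_succ', Nat.cast_add,
      add_mul]
    refine add_le_add (mul_le_mul_of_nonneg_left ((ih _ _).trans ?_) (by positivity))
      (mul_le_mul_of_nonneg_left ((ih _ _).trans ?_) (by positivity))
    all_goals
      rw [← Nat.cast_add]
      gcongr
      omega

/-- The functions `4⁻ⁿ tᵃ (1 - t)ᵇ` with `a + b ≤ 4n`. -/
noncomputable def scaledMonomials : Subsemigroup SmoothFn where
  carrier := {f | ∃ n a b : ℕ, a + b ≤ 4 * n ∧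
    f = ((1 / 4 : ℂ) ^ n) • (coord ^ a * (1 - coord) ^ b)}
  mul_mem' := by
    rintro _ _ ⟨n, a, b, h, rfl⟩ ⟨n', a', b', h', rfl⟩
    refine ⟨n + n', a + a', b + b', by omega, ?_⟩
    rw [smul_mul_smul_comm, ← pow_add]
    congr 1
    ring

/-- For each fixed order k, the polynomial growth (4n)^k of the k-th derivative loses against the
factor 4⁻ⁿ, uniformly in n. -/
theorem isBounded_scaledMonomials : IsBounded (scaledMonomials : Set SmoothFn) := by
  refine SmoothFn.isBounded_iff.2 fun k => ?_
  have hlim : Tendsto (fun n : ℕ => (4 : ℝ) ^ k * ((n : ℝ) ^ k * (1 / 4 : ℝ) ^ n)) atTop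
      (𝓝 (4 ^ k * 0)) :=
    (tendsto_pow_const_mul_const_pow_of_abs_lt_one k (by norm_num)).const_mul _
  obtain ⟨C, hC⟩ := hlim.bddAbove_range
  refine ⟨C, ?_⟩
  rintro _ ⟨n, a, b, h, rfl⟩ t ht
  have h1 : ((1 / 4 : ℂ) ^ n) • (coord ^ a * (1 - coord) ^ b) =
      aeval coord (Polynomial.C ((1 / 4 : ℂ) ^ n) * (X ^ a * (1 - X) ^ b)) := by
    simp [Algebra.smul_def]
  rw [h1, iteratedDerivWithin_aeval _ _ ht, iterate_derivative_C_mul, eval_mul, eval_C, norm_mul]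
  refine le_trans ?_ (hC ⟨n, rfl⟩)
  have h2 : ‖(1 / 4 : ℂ) ^ n‖ = (1 / 4 : ℝ) ^ n := by simp
  have h3 : ((a + b : ℕ) : ℝ) ≤ 4 * n := by exact_mod_cast h
  rw [h2]
  calc _ ≤ (1 / 4 : ℝ) ^ n * (4 * n) ^ k := by
        refine mul_le_mul_of_nonneg_left ?_ (by positivity)
        exact (norm_eval_iterate_derivative_le k a b ht).trans (by gcongr)
    _ = _ := by ring

theorem smul_mem_scaledMonomials {a b : ℕ} (h : a + b ≤ 4) :
    (1 / 4 : ℂ) • (coord ^ a * (1 - coord) ^ b) ∈ scaledMonomials :=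
  ⟨1, a, b, by omega, by simp⟩

/-- The family is invariant under t ↦ 1 - t, so a path and its time reversal are treated together.
-/
theorem smul_pow_mem_scaledMonomials {u : SmoothFn} (hu : u = coord ∨ u = 1 - coord) {a b : ℕ}
    (h : a + b ≤ 4) : (1 / 4 : ℂ) • (u ^ a * (1 - u) ^ b) ∈ scaledMonomials := by
  rcases hu with rfl | rfl
  · exact smul_mem_scaledMonomials h
  · rw [sub_sub_cancel, mul_comm]
    exact smul_mem_scaledMonomials (by omega)

theorem nilSet_scaledMonomials : NilSet (scaledMonomials : Set SmoothFn) :=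
  NilSet.of_subsemigroup _ isBounded_scaledMonomials subset_rfl

end SmoothFn

/-! ### The universal property of the even forms with the Fedosov product. -/

section UniversalProperty

set_option linter.unusedSectionVars false

variable {A B : Type*} [NonUnitalRing A] [Module ℂ A] [Bornology A] [BornologicalAlgebra A]
  [NonUnitalRing B] [Module ℂ B] [IsScalarTower ℂ B B] [SMulCommClass ℂ B B]

namespace Omega

variable (A) in
/-- The inclusion of `A` as the space of forms of degree zero. -/
noncomputable def zeroForm : A →ₗ[ℂ] Omega A := (mk A).flip 1 ∘ₗ Unitization.inrHom ℂ ℂ A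

theorem zeroForm_apply (a : A) : zeroForm A a = mk A (Unitization.inr a) 1 := rfl

theorem fedosov_zeroForm (a : A) (x : Omega A) : fedosov A (zeroForm A a) x =
    L A (Unitization.inr a) x - D A (Unitization.inr a) (d A x) := by
  simp [fedosov_apply, zeroForm_apply, mulForms_mk, d_mk, L_one]

theorem fedosov_zeroForm_mk (a : A) (c : Unitization ℂ A) (w : TensorAlgebra ℂ A) :
    fedosov A (zeroForm A a) (mk A c w) = mk A (Unitization.inr a * c) w -
      mk A 1 (TensorAlgebra.ι ℂ a * (TensorAlgebra.ι ℂ c.snd * w)) := by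
  rw [fedosov_zeroForm, d_mk, D_mk]
  simp

theorem fedosov_one (x : Omega A) : fedosov A (mk A 1 1) x = x := by
  simp [fedosov_apply, mulForms_mk, d_mk, L_one]

/-- The correction term da dw of the Fedosov product vanishes because dw = 0 for w = da₁ ⋯ daₙ. -/
theorem fedosov_zeroForm_closed (a : A) (w : TensorAlgebra ℂ A) :
    fedosov A (zeroForm A a) (mk A 1 w) = mk A (Unitization.inr a) w := by
  simp [fedosov_zeroForm_mk]

/-- This is da db = ab - a ⊙ b, multiplied on the right by a closed form. It expresses a pair of
differentials through Fedosov products with elements of A. -/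
theorem mk_ι_ι_mul (a b : A) (w : TensorAlgebra ℂ A) :
    mk A 1 (TensorAlgebra.ι ℂ a * (TensorAlgebra.ι ℂ b * w)) =
      fedosov A (zeroForm A (a * b)) (mk A 1 w) -
        fedosov A (zeroForm A a) (fedosov A (zeroForm A b) (mk A 1 w)) := by
  simp [fedosov_zeroForm_mk]

/-- The even forms are generated by the forms of degree zero. -/
theorem even_form_mem (P : Submodule ℂ (Omega A)) (h1 : mk A 1 1 ∈ P)
    (hmul : ∀ a, ∀ x ∈ P, fedosov A (zeroForm A a) x ∈ P) (c : Unitization ℂ A) :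
    ∀ l : List A, Even l.length → form c l ∈ P := by
  have key : ∀ l : List A, Even l.length → form 1 l ∈ P := by
    intro l
    induction l using List.twoStepInduction with
    | nil => exact fun _ => by simpa [form] using h1
    | singleton a => simp
    | cons_cons a b l ih _ =>
      intro hl
      have hl' : form 1 l ∈ P := ih (by simpa [Nat.even_add_one] using hl)
      rw [form, List.map_cons, List.map_cons, List.prod_cons, List.prod_cons, mk_ι_ι_mul]
      exact sub_mem (hmul _ _ hl') (hmul _ _ (hmul _ _ hl'))
  intro l hl
  -- Splitting c along A⁺ = ℂ ⊕ A reduces to c = 1, since the closed form may be multiplied by an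
  -- element of A without a correction term.
  have hc : form c l = c.fst • form 1 l + fedosov A (zeroForm A c.snd) (form 1 l) := by
    conv_lhs => rw [← Unitization.inl_fst_add_inr_snd_eq c]
    rw [← Unitization.algebraMap_eq_inl, Algebra.algebraMap_eq_smul_one]
    simp only [form, fedosov_zeroForm_closed, map_add, map_smul, LinearMap.add_apply,
      LinearMap.smul_apply]
  rw [hc]
  exact add_mem (P.smul_mem _ (key l hl)) (hmul _ _ (key l hl))

/-- An induction principle: identities for even forms need only be checked at 1 and under left
multiplication by A. The averaging operator (id + grad)/2 kills the odd monomials and fixes the even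
forms. -/
theorem even_mem (P : Submodule ℂ (Omega A)) (h1 : mk A 1 1 ∈ P)
    (hmul : ∀ a, ∀ x ∈ P, fedosov A (zeroForm A a) x ∈ P) {x : Omega A} (hx : grad A x = x) :
    x ∈ P := by
  have key : Submodule.span ℂ (forms (A := A) Set.univ Set.univ) ≤
      P.comap ((1 / 2 : ℂ) • (LinearMap.id + grad A)) := by
    refine Submodule.span_le.2 ?_
    rintro _ ⟨c, l, -, -, rfl⟩
    rw [SetLike.mem_coe, Submodule.mem_comap, LinearMap.smul_apply, LinearMap.add_apply,
      LinearMap.id_apply]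
    rw [grad_form]
    rcases Nat.even_or_odd l.length with he | ho
    · have := even_form_mem P h1 hmul c l he
      rw [he.neg_one_pow, one_smul]
      exact P.smul_mem _ (add_mem this this)
    · rw [ho.neg_one_pow]
      simp
  have := key (mem_span_forms x)
  rw [Submodule.mem_comap, LinearMap.smul_apply, LinearMap.add_apply, LinearMap.id_apply, hx,
    ← two_smul ℂ x, smul_smul] at this
  simpa using this

/-- The curvature as a bilinear map. -/
noncomputable def curvatureBilin (l : A →ₗ[ℂ] B) : A →ₗ[ℂ] A →ₗ[ℂ] B :=
  (LinearMap.mul ℂ A).compr₂ l - (LinearMap.mul ℂ B).compl₁₂ l l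

/-- The operators `(x, g) ↦ (g a, b ↦ ω(b, a) x)`; applied successively to `(1, 0)` they multiply
the values of the curvature at consecutive pairs. -/
noncomputable def pairing (l : A →ₗ[ℂ] B) :
    A →ₗ[ℂ] Module.End ℂ (Unitization ℂ B × (A →ₗ[ℂ] Unitization ℂ B)) where
  toFun a := LinearMap.prod (LinearMap.applyₗ a ∘ₗ LinearMap.snd ℂ _ _)
    (((LinearMap.mul ℂ (Unitization ℂ B)) ∘ₗ Unitization.inrHom ℂ ℂ B ∘ₗ
      (curvatureBilin l).flip a).flip ∘ₗ LinearMap.fst ℂ _ _)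
  map_add' a b := by
    refine LinearMap.ext fun x => Prod.ext ?_ (LinearMap.ext fun c => ?_)
    · simp
    · simp
  map_smul' r a := by
    refine LinearMap.ext fun x => Prod.ext ?_ (LinearMap.ext fun c => ?_)
    · simp
    · simp

theorem pairing_apply_fst (l : A →ₗ[ℂ] B) (a : A)
    (x : Unitization ℂ B × (A →ₗ[ℂ] Unitization ℂ B)) : (pairing l a x).1 = x.2 a := rfl

theorem pairing_apply_snd (l : A →ₗ[ℂ] B) (a b : A)
    (x : Unitization ℂ B × (A →ₗ[ℂ] Unitization ℂ B)) :
    (pairing l a x).2 b = Unitization.inr (curvature l b a) * x.1 := rfl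

/-- The map `a₁ ⊗ ⋯ ⊗ a₂ₙ ↦ ω(a₁, a₂) ⋯ ω(a₂ₙ₋₁, a₂ₙ)`. -/
noncomputable def curvatureProd (l : A →ₗ[ℂ] B) : TensorAlgebra ℂ A →ₗ[ℂ] Unitization ℂ B :=
  LinearMap.fst ℂ _ _ ∘ₗ LinearMap.applyₗ
    ((1, 0) : Unitization ℂ B × (A →ₗ[ℂ] Unitization ℂ B)) ∘ₗ
    (TensorAlgebra.lift ℂ (pairing l)).toLinearMap

theorem curvatureProd_one (l : A →ₗ[ℂ] B) : curvatureProd l 1 = 1 := by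
  simp [curvatureProd]

theorem curvatureProd_ι_ι_mul (l : A →ₗ[ℂ] B) (a b : A) (w : TensorAlgebra ℂ A) :
    curvatureProd l (TensorAlgebra.ι ℂ a * (TensorAlgebra.ι ℂ b * w)) =
      Unitization.inr (curvature l a b) * curvatureProd l w := by
  simp [curvatureProd, pairing_apply_fst, pairing_apply_snd]

/-- The map `c da₁ ⋯ da₂ₙ ↦ l⁺(c) ω(a₁, a₂) ⋯ ω(a₂ₙ₋₁, a₂ₙ)`. -/
noncomputable def liftUnit (l : A →ₗ[ℂ] B) : Omega A →ₗ[ℂ] Unitization ℂ B :=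
  lift ((LinearMap.mul ℂ (Unitization ℂ B)).compl₁₂
    ((Algebra.linearMap ℂ (Unitization ℂ B)) ∘ₗ (Unitization.fstHom ℂ A).toLinearMap +
      Unitization.inrHom ℂ ℂ B ∘ₗ l ∘ₗ Unitization.sndHom ℂ ℂ A) (curvatureProd l))

theorem liftUnit_mk (l : A →ₗ[ℂ] B) (c : Unitization ℂ A) (w : TensorAlgebra ℂ A) :
    liftUnit l (mk A c w) =
      (algebraMap ℂ (Unitization ℂ B) c.fst + Unitization.inr (l c.snd)) * curvatureProd l w := by
  simp [liftUnit, add_mul]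

/-- Since a ⊙ (c w) = (ac) w - da dc w, the claim for monomials reduces to l⁺(ac) - ω(a, c) = l(a)
l⁺(c), where c stands for its component in A inside ω. This is the definition of the curvature. -/
theorem liftUnit_zeroForm_mul (l : A →ₗ[ℂ] B) (a : A) (x : Omega A) :
    liftUnit l (fedosov A (zeroForm A a) x) = Unitization.inr (l a) * liftUnit l x := by
  have : liftUnit l ∘ₗ fedosov A (zeroForm A a) =
      LinearMap.mulLeft ℂ (Unitization.inr (l a)) ∘ₗ liftUnit l := hom_ext fun c w => by
    rw [LinearMap.comp_apply, fedosov_zeroForm_mk, map_sub, liftUnit_mk, liftUnit_mk,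
      curvatureProd_ι_ι_mul, LinearMap.comp_apply, LinearMap.mulLeft_apply, liftUnit_mk,
      Unitization.fst_one, Unitization.snd_one, map_one, map_zero, Unitization.inr_zero, add_zero,
      one_mul, ← mul_assoc, ← sub_mul]
    congr 1
    ext
    · simp [curvature, Unitization.algebraMap_eq_inl, sub_eq_add_neg]
    · simp [curvature, Unitization.algebraMap_eq_inl, sub_eq_add_neg]
      abel
  exact LinearMap.congr_fun this x

/-- Ensures that even forms over A land in the ideal B of B⁺. The second component is then
multiplicative on them. -/
theorem liftUnit_fst (l : A →ₗ[ℂ] B) {x : Omega A} (hx : grad A x = x) :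
    (liftUnit l x).fst = aug A x := by
  have := even_mem (LinearMap.ker ((Unitization.fstHom ℂ B).toLinearMap ∘ₗ liftUnit l - aug A))
    (by simp [liftUnit_mk, curvatureProd_one, aug_mk])
    (fun a x hx => by
      rw [LinearMap.mem_ker, LinearMap.sub_apply, LinearMap.comp_apply, liftUnit_zeroForm_mul,
        aug_fedosov, zeroForm_apply, aug_mk]
      simp) hx
  simpa [sub_eq_zero] using this

/-- For fixed y, the x that satisfy the identity contain 1 and, by associativity, are stable under
left multiplication by A. Hence `even_mem` applies. -/
theorem liftUnit_fedosov (l : A →ₗ[ℂ] B) {x : Omega A} (hx : grad A x = x) (y : Omega A) :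
    liftUnit l (fedosov A x y) = liftUnit l x * liftUnit l y := by
  have := even_mem (LinearMap.ker (liftUnit l ∘ₗ (fedosov A).flip y -
      LinearMap.mulRight ℂ (liftUnit l y) ∘ₗ liftUnit l))
    (by simp [fedosov_one, liftUnit_mk, curvatureProd_one])
    (fun a x hx => by
      have hx : liftUnit l (fedosov A x y) = liftUnit l x * liftUnit l y := by
        simpa [sub_eq_zero] using hx
      simp [fedosov_assoc, liftUnit_zeroForm_mul, hx, mul_assoc]) hx
  simpa [sub_eq_zero] using this

end Omega

namespace EvenForms

variable (A) in
/-- The canonical linear map `A → EvenForms A`. -/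
noncomputable def incl : A →ₗ[ℂ] EvenForms A :=
  LinearMap.codRestrict (evenForms A) (Omega.zeroForm A) fun a =>
    ⟨by simp [Omega.zeroForm_apply], by simp [Omega.zeroForm_apply, Omega.aug_mk]⟩

theorem val_incl (a : A) : (incl A a).val = Omega.zeroForm A a := rfl

theorem val_curvature_incl (a b : A) :
    (curvature (incl A) a b).val = Omega.form 1 [a, b] := by
  simp [curvature, val_mul, val_incl, Omega.zeroForm_apply, Omega.form]
  rw [← Omega.zeroForm_apply, Omega.fedosov_zeroForm_mk]
  simp

/-- The homomorphism `a₀ da₁ ⋯ da₂ₙ ↦ l(a₀) ω(a₁, a₂) ⋯ ω(a₂ₙ₋₁, a₂ₙ)` that extends a linear map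
`l` with curvature `ω`. -/
noncomputable def lift (l : A →ₗ[ℂ] B) : EvenForms A →ₙₐ[ℂ] B where
  toFun x := (Omega.liftUnit l x.val).snd
  map_smul' c x := by simp
  map_zero' := by simp
  map_add' x y := by simp
  map_mul' x y := by
    rw [val_mul, Omega.liftUnit_fedosov l x.grad_val, Unitization.snd_mul,
      Omega.liftUnit_fst l x.grad_val, Omega.liftUnit_fst l y.grad_val, x.aug_val, y.aug_val]
    simp

theorem lift_apply (l : A →ₗ[ℂ] B) (x : EvenForms A) :
    lift l x = (Omega.liftUnit l x.val).snd := rfl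

@[simp] theorem lift_incl (l : A →ₗ[ℂ] B) (a : A) : lift l (incl A a) = l a := by
  simp [lift_apply, val_incl, Omega.zeroForm_apply, Omega.liftUnit_mk, Omega.curvatureProd_one]

/-- Homomorphisms on `EvenForms A` are determined by their restriction to `A`. -/
theorem hom_ext {f g : EvenForms A →ₙₐ[ℂ] B} (h : ∀ a, f (incl A a) = g (incl A a)) : f = g := by
  -- The induction principle starts at the form 1, which is not a form over A. The equalizer of f
  -- and g is therefore enlarged by ℂ · 1.
  let P : Submodule ℂ (Omega A) :=
    LinearMap.range (LinearMap.toSpanSingleton ℂ (Omega A) (Omega.mk A 1 1)) ⊔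
      (LinearMap.ker ((f : EvenForms A →ₗ[ℂ] B) - (g : EvenForms A →ₗ[ℂ] B))).map val
  have hP : ∀ x ∈ P, ∃ (c : ℂ) (y : EvenForms A), f y = g y ∧ x = c • Omega.mk A 1 1 + y.val := by
    intro x hx
    obtain ⟨_, ⟨c, rfl⟩, _, ⟨y, hy, rfl⟩, rfl⟩ := Submodule.mem_sup.1 hx
    exact ⟨c, y, by simpa [sub_eq_zero] using hy, rfl⟩
  have hP' : ∀ y : EvenForms A, f y = g y → y.val ∈ P := fun y hy =>
    Submodule.mem_sup_right ⟨y, by simpa [sub_eq_zero] using hy, rfl⟩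
  refine NonUnitalAlgHom.ext fun x => ?_
  have hx := Omega.even_mem P (Submodule.mem_sup_left ⟨1, by simp⟩) (fun a y hy => by
    obtain ⟨c, y, hy', rfl⟩ := hP y hy
    have h1 : Omega.fedosov A (Omega.zeroForm A a) (c • Omega.mk A 1 1 + y.val) =
        (c • incl A a + incl A a * y).val := by
      rw [map_add, map_smul, Omega.fedosov_zeroForm_closed, map_add, map_smul, val_mul, val_incl,
        Omega.zeroForm_apply]
    rw [h1]
    exact hP' _ (by simp [h, hy'])) x.grad_val
  obtain ⟨c, y, hy, hxy⟩ := hP _ hx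
  -- The augmentation detects the scalar part and vanishes on forms over A, so the auxiliary
  -- multiple of 1 disappears again.
  have hc : c = 0 := by
    have := congrArg (Omega.aug A) hxy
    simpa [x.aug_val, y.aug_val, Omega.aug_mk] using this.symm
  rw [hc, zero_smul, zero_add] at hxy
  rw [ext hxy, hy]

end EvenForms

end UniversalProperty

/-! ### Elementary operations with bounded linear maps. -/

section BoundedMaps

set_option linter.unusedSectionVars false

variable {V W : Type*} [AddCommGroup V] [Module ℂ V] [Bornology V]
  [AddCommGroup W] [Module ℂ W] [Bornology W] [ConvexBornology W]

theorem BoundedMap.add {f g : V →ₗ[ℂ] W} (hf : BoundedMap f) (hg : BoundedMap g) :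
    BoundedMap (f + g) := fun S hS => by
  refine (ConvexBornology.isBounded_add _ _ (hf S hS) (hg S hS)).subset ?_
  rintro _ ⟨x, hx, rfl⟩
  exact ⟨_, ⟨x, hx, rfl⟩, _, ⟨x, hx, rfl⟩, rfl⟩

theorem BoundedMap.sub {f g : V →ₗ[ℂ] W} (hf : BoundedMap f) (hg : BoundedMap g) :
    BoundedMap (f - g) := fun S hS => by
  refine (ConvexBornology.isBounded_add _ _ (hf S hS) (isBounded_smul (hg S hS) (-1))).subset ?_
  rintro _ ⟨x, hx, rfl⟩
  exact ⟨_, ⟨x, hx, rfl⟩, _, ⟨_, ⟨x, hx, rfl⟩, rfl⟩, by simp [sub_eq_add_neg]⟩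

theorem boundedMap_id {V : Type*} [Bornology V] : BoundedMap (fun x : V => x) :=
  fun S hS => by simpa using hS

theorem boundedMap_tmul [ConvexBornology V] (v : V) :
    BoundedMap (TensorProduct.mk ℂ V W v) := fun S hS =>
  isBounded_tensor_iff.2 ⟨⟨⟨{v}, isBounded_singleton⟩, ⟨S, hS⟩⟩, by
    rintro _ ⟨w, hw, rfl⟩
    exact subset_diskHull _ ⟨v, rfl, w, hw, rfl⟩⟩

theorem isBounded_of_smul [ConvexBornology V] {c : ℂ} (hc : c ≠ 0) {S : Set V}
    (h : IsBounded (c • S)) : IsBounded S := by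
  simpa [smul_smul, inv_mul_cancel₀ hc] using isBounded_smul h c⁻¹

end BoundedMaps

/-! ### Curvature estimates and the extension of lanilcurs. -/

section CurvatureBounds

set_option linter.unusedSectionVars false

variable {A B : Type*} [NonUnitalRing A] [Module ℂ A] [Bornology A] [BornologicalAlgebra A]
  [NonUnitalRing B] [Module ℂ B] [Bornology B] [BornologicalAlgebra B]

theorem isBounded_curvature {l : A →ₗ[ℂ] B} (hl : BoundedMap l) {S : Set A} (hS : IsBounded S) :
    IsBounded (Set.image2 (curvature l) S S) := by
  refine (ConvexBornology.isBounded_add _ _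
    (hl _ (BornologicalAlgebra.isBounded_mul S S hS hS)) (isBounded_smul
      (BornologicalAlgebra.isBounded_mul _ _ (hl S hS) (hl S hS)) (-1))).subset ?_
  rintro _ ⟨a, ha, b, hb, rfl⟩
  exact ⟨_, ⟨_, ⟨a, ha, b, hb, rfl⟩, rfl⟩, _, ⟨_, ⟨_, ⟨a, ha, rfl⟩, _, ⟨b, hb, rfl⟩, rfl⟩, rfl⟩,
    by simp [curvature, sub_eq_add_neg]⟩

theorem curvature_smul_left (l : A →ₗ[ℂ] B) (c : ℂ) (a b : A) :
    curvature l (c • a) b = c • curvature l a b := by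
  simp [curvature, smul_sub, smul_mul_assoc]

theorem IsLanilcur.comp {C : Type*} [NonUnitalRing C] [Module ℂ C] [Bornology C]
    {l : A →ₗ[ℂ] B} (hl : IsLanilcur l) (f : B →ₙₐ[ℂ] C) (hf : BoundedMap f) :
    IsLanilcur ((f : B →ₗ[ℂ] C) ∘ₗ l) where
  bounded := hf.comp hl.bounded
  curvature_bounded S hS := by
    refine NilSet.mono (NilSet.image (hl.curvature_bounded S hS) f hf) ?_
    rintro _ ⟨a, ha, b, hb, rfl⟩
    exact ⟨_, ⟨a, ha, b, hb, rfl⟩, by simp [curvature]⟩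

theorem isLanilcur_of_mul {f : A →ₗ[ℂ] B} (hf : BoundedMap f) (h : ∀ a b, curvature f a b = 0) :
    IsLanilcur f where
  bounded := hf
  curvature_bounded S _ := nilSet_zero.mono (by
    rintro _ ⟨a, -, b, -, rfl⟩
    exact h a b)

/-- Consuming the list two entries at a time contributes one curvature per pair. Only the empty list
gives no factor, whence the separate alternative 1. -/
theorem Omega.curvatureProd_list (l : A →ₗ[ℂ] B) {S : Set A} :
    ∀ w : List A, (∀ a ∈ w, a ∈ S) → Even w.length →
      curvatureProd l (w.map (TensorAlgebra.ι ℂ)).prod = 1 ∨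
      ∃ z ∈ (Subsemigroup.closure (Set.image2 (curvature l) S S) : Set B),
        curvatureProd l (w.map (TensorAlgebra.ι ℂ)).prod = Unitization.inr z := by
  intro w
  induction w using List.twoStepInduction with
  | nil => exact fun _ _ => Or.inl (by simp [curvatureProd_one])
  | singleton a => simp
  | cons_cons a b w ih _ =>
    intro hw he
    have hab : curvature l a b ∈ Subsemigroup.closure (Set.image2 (curvature l) S S) :=
      Subsemigroup.subset_closure ⟨a, hw a (by simp), b, hw b (by simp), rfl⟩
    rw [List.map_cons, List.map_cons, List.prod_cons, List.prod_cons, curvatureProd_ι_ι_mul]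
    rcases ih (fun c hc => hw c (by simp [hc])) (by simpa [Nat.even_add_one] using he) with
      h | ⟨z, hz, h⟩
    · exact Or.inr ⟨_, hab, by rw [h, mul_one]⟩
    · exact Or.inr ⟨_, mul_mem hab hz, by rw [h, Unitization.inr_mul]⟩

namespace EvenForms

/-- Lanilcurs extend to bounded homomorphisms. -/
theorem boundedMap_lift {l : A →ₗ[ℂ] B} (hl : IsLanilcur l) : BoundedMap (lift l) := fun X hX => by
  obtain ⟨⟨S, hS⟩, hX⟩ := isBounded_iff.1 hX
  have hK := hl.curvature_bounded S hS
  -- A generator is sent to l(a₀), to a product z of curvatures, or to l(a₀) z. The point 0 takes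
  -- care of the formal case of the form 1, whose component in B vanishes.
  have hY := (((hl.bounded S hS).union hK).union
    (BornologicalAlgebra.isBounded_mul _ _ (hl.bounded S hS) hK)).union
      (isBounded_singleton (x := (0 : B)))
  refine (ConvexBornology.isBounded_diskHull _ hY).subset ((Set.image_mono hX).trans
    ((map_diskHull_subset (lift l : EvenForms A →ₗ[ℂ] B) _).trans (diskHull_mono ?_)))
  rintro _ ⟨x, ⟨c, w, hc, hw, he, hx⟩, rfl⟩
  change (Omega.liftUnit l x.val).snd ∈ _
  rw [hx, Omega.form, Omega.liftUnit_mk]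
  rcases hc with rfl | ⟨a, ha, rfl⟩ <;>
    rcases Omega.curvatureProd_list l w hw he with h | ⟨z, hz, h⟩ <;> rw [h]
  · exact Or.inr (by simp)
  · exact Or.inl (Or.inl (Or.inr (by simpa using hz)))
  · exact Or.inl (Or.inl (Or.inl ⟨a, ha, by simp⟩))
  · exact Or.inl (Or.inr ⟨l a, ⟨a, ha, rfl⟩, z, hz, by simp⟩)

theorem map_incl (f : A →ₙₐ[ℂ] B) (a : A) : EvenForms.map f (incl A a) = incl B (f a) :=
  ext (by
    rw [val_map, val_incl, val_incl, Omega.zeroForm_apply, Omega.map_mk, unitMap_inr, map_one]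
    rfl)

variable (A) in
theorem boundedMap_incl : BoundedMap (incl A) := fun S hS => by
  refine isBounded_iff.2 ⟨⟨S, hS⟩, ?_⟩
  rintro _ ⟨a, ha, rfl⟩
  exact subset_diskHull _ ⟨_, [], Or.inr ⟨a, ha, rfl⟩, by simp, by simp, by
    simp [val_incl, Omega.zeroForm_apply, Omega.form]⟩

end EvenForms

namespace Omega

/-- As da db is closed, its Fedosov product is the ordinary one, and the Leibniz rule moves both
differentials past c. The old coefficient c survives only inside a differential, and the new
coefficients are just 1 and a. -/
theorem fedosov_form_pair (a b : A) (c : Unitization ℂ A) (l : List A) :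
    fedosov A (form 1 [a, b]) (form c l) =
      form 1 (a :: (Unitization.inr b * c).snd :: l) - form 1 ((a * b) :: c.snd :: l) +
        form (Unitization.inr a) (b :: c.snd :: l) := by
  have h : fedosov A (form 1 [a, b]) (form c l) =
      D A (Unitization.inr a) (D A (Unitization.inr b) (form c l)) := by
    rw [fedosov_apply, grad_form, map_smul, d_form]
    simp [form, mulForms_mk, L_one]
  rw [h, form, D_mk, map_sub, D_mk, D_mk]
  simp [form]
  abel

theorem fedosov_zeroForm_form (a : A) (c : Unitization ℂ A) (l : List A) :
    fedosov A (zeroForm A a) (form c l) =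
      form (Unitization.inr a * c) l - form 1 (a :: c.snd :: l) := by
  rw [form, fedosov_zeroForm_mk]
  simp [form]

theorem form_smul_cons (r : ℂ) (c : Unitization ℂ A) (a : A) (l : List A) :
    form c ((r • a) :: l) = r • form c (a :: l) := by
  simp [form]

theorem form_smul (r : ℂ) (c : Unitization ℂ A) (l : List A) :
    form (r • c) l = r • form c l := by
  simp [form]

end Omega

/-- Gives a summand its share r of a disk. In the applications r⁻¹ is absorbed into one entry of a
form or into one tensor factor. -/
theorem mem_smul_diskHull {V : Type*} [AddCommGroup V] [Module ℂ V] {S : Set V} {x : V} {r : ℝ}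
    (hr : r ≠ 0) (h : ((r⁻¹ : ℝ) : ℂ) • x ∈ S) : x ∈ (r : ℂ) • diskHull S :=
  ⟨_, subset_diskHull _ h, by
    have : (r : ℂ) ≠ 0 := by exact_mod_cast hr
    simp [smul_smul, this]⟩

theorem IsDisk.neg_mem_smul {V : Type*} [AddCommGroup V] [Module ℂ V] {S : Set V} (hS : IsDisk S)
    {x : V} {r : ℂ} (h : x ∈ r • S) : -x ∈ r • S := by
  obtain ⟨s, hs, rfl⟩ := h
  exact ⟨-s, hS.neg_mem hs, by simp⟩

/-- The kernel of `EvenForms A → A` is analytically nilpotent relative to `A`: products of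
elements of a set `R ⊆ A` that generates a bounded semigroup and of forms `da db` are bounded. -/
theorem EvenForms.nilSet_incl {R S : Set A} (hR : NilSet ((2 : ℂ) • R)) (hS : IsBounded S) :
    NilSet (incl A '' R ∪ Set.image2 (curvature (incl A)) S S) := by
  set Q : Subsemigroup A := Subsemigroup.closure ((2 : ℂ) • R) with hQdef
  have hQ : IsBounded (Q : Set A) := hR
  have hRQ : ∀ r ∈ R, (2 : ℂ) • r ∈ Q := fun r hr => Subsemigroup.subset_closure ⟨r, hr, rfl⟩
  have hRb : IsBounded R := isBounded_of_smul (c := 2) (by norm_num)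
    (hQ.subset Subsemigroup.subset_closure)
  -- M collects the coefficients a₀ that can occur in products. Together with 1 it is mapped into M
  -- by left multiplication by Q. Invariance under S is not needed, because multiplication by da db
  -- discards the old coefficient.
  set M : Set A := (Q : Set A) ∪ (Q : Set A) * S ∪ S with hM
  have hMb : IsBounded M := (hQ.union (BornologicalAlgebra.isBounded_mul _ _ hQ hS)).union hS
  set T₀ : Set A := M ∪ S * M ∪ S * S ∪ R ∪ {0} with hT₀
  have hT₀b : IsBounded T₀ := (((hMb.union (BornologicalAlgebra.isBounded_mul _ _ hS hMb)).union
    (BornologicalAlgebra.isBounded_mul _ _ hS hS)).union hRb).union isBounded_singleton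
  -- T collects the differentiated entries. The factor 3 leaves room for the three summands of da db
  -- ⊙ x, and also for the two of r ⊙ x.
  set T : Set A := ((3 : ℝ) : ℂ) • BornAlg.diskHull T₀ with hT
  have hTb : IsBounded T := isBounded_smul (ConvexBornology.isBounded_diskHull _ hT₀b) _
  have hTmem : ∀ x ∈ T₀, ∀ r : ℂ, ‖r‖ ≤ 3 → r • x ∈ T := fun x hx r hr =>
    (isDisk_diskHull T₀).smul_subset hr ⟨x, subset_diskHull _ hx, rfl⟩
  have hTmem1 : ∀ x ∈ T₀, x ∈ T := fun x hx => by simpa using hTmem x hx 1 (by norm_num)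
  have hMT : ∀ x ∈ M, x ∈ T₀ := fun x hx => Or.inl (Or.inl (Or.inl (Or.inl hx)))
  have hST : ∀ x ∈ S, x ∈ T₀ := fun x hx => hMT x (Or.inr hx)
  have hcT : ∀ c : Unitization ℂ A, (c = 1 ∨ ∃ a ∈ M, c = Unitization.inr a) → c.snd ∈ T₀ := by
    rintro _ (rfl | ⟨a, ha, rfl⟩)
    · exact Or.inr (by simp)
    · exact hMT _ (by simpa using ha)
  set D := BornAlg.diskHull (Omega.forms M T) with hD
  have hDd : IsDisk D := isDisk_diskHull _
  have hcons : ∀ (l : List A), (∀ a ∈ l, a ∈ T) → ∀ a ∈ T, ∀ b ∈ T,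
      ∀ e ∈ a :: b :: l, e ∈ T := by
    intro l hl a ha b hb e he
    rcases List.mem_cons.1 he with rfl | he
    · exact ha
    rcases List.mem_cons.1 he with rfl | he
    · exact hb
    · exact hl e he
  have h1 : ∀ r ∈ R, ∀ x ∈ D, Omega.fedosov A (Omega.zeroForm A r) x ∈ D := by
    intro r hr
    have : D ⊆ (Omega.fedosov A (Omega.zeroForm A r)) ⁻¹' D := by
      refine diskHull_min (hDd.preimage _) ?_
      rintro _ ⟨c, l, hc, hl, rfl⟩
      rw [Set.mem_preimage, Omega.fedosov_zeroForm_form, sub_eq_add_neg]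
      -- The assumption on 2R enters here: 2r lies in Q, so (2r)c is again in M, and the product
      -- takes only half of D. The other half is left for dr dc.
      have ha : Omega.form (Unitization.inr r * c) l ∈ ((1 / 2 : ℝ) : ℂ) • D := by
        refine mem_smul_diskHull (by norm_num) ⟨Unitization.inr ((2 : ℂ) • r) * c, l, Or.inr ?_,
          hl, ?_⟩
        · rcases hc with rfl | ⟨m, hm, rfl⟩
          · exact ⟨_, Or.inl (Or.inl (hRQ r hr)), mul_one _⟩
          · refine ⟨(2 : ℂ) • r * m, ?_, by simp⟩
            rcases hm with (hm | ⟨q, hq, s, hs, rfl⟩) | hm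
            · exact Or.inl (Or.inl (mul_mem (hRQ r hr) hm))
            · exact Or.inl (Or.inr ⟨_, mul_mem (hRQ r hr) hq, s, hs, mul_assoc _ _ _⟩)
            · exact Or.inl (Or.inr ⟨_, hRQ r hr, m, hm, rfl⟩)
        · rw [Unitization.inr_smul, smul_mul_assoc, Omega.form_smul]
          norm_num
      have hb : Omega.form 1 (r :: c.snd :: l) ∈ ((1 / 2 : ℝ) : ℂ) • D := by
        refine mem_smul_diskHull (by norm_num) ⟨1, ((2 : ℂ) • r) :: c.snd :: l, Or.inl rfl,
          hcons l hl _ (hTmem r (Or.inl (Or.inr hr)) _ (by norm_num)) _ (hTmem1 _ (hcT c hc)), ?_⟩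
        rw [Omega.form_smul_cons]
        norm_num
      have := hDd.add_smul_mem (by norm_num) (by norm_num) ha (hDd.neg_mem_smul hb)
      norm_num at this
      exact this
    exact fun x hx => this hx
  have h2 : ∀ a ∈ S, ∀ b ∈ S, ∀ x ∈ D, Omega.fedosov A (Omega.form 1 [a, b]) x ∈ D := by
    intro a ha b hb
    have : D ⊆ (Omega.fedosov A (Omega.form 1 [a, b])) ⁻¹' D := by
      refine diskHull_min (hDd.preimage _) ?_
      rintro _ ⟨c, l, hc, hl, rfl⟩
      rw [Set.mem_preimage, Omega.fedosov_form_pair, sub_eq_add_neg]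
      -- The factor 3 goes into the first of the two new differentials, so each of the three
      -- summands takes a third of D.
      have hterm : ∀ (e : Unitization ℂ A), (e = 1 ∨ ∃ a ∈ M, e = Unitization.inr a) →
          ∀ f ∈ T₀, ∀ g ∈ T₀, Omega.form e (f :: g :: l) ∈ ((1 / 3 : ℝ) : ℂ) • D := by
        intro e he f hf g hg
        refine mem_smul_diskHull (by norm_num) ⟨e, ((3 : ℂ) • f) :: g :: l, he,
          hcons l hl _ (hTmem f hf _ (by norm_num)) _ (hTmem1 _ hg), ?_⟩
        rw [Omega.form_smul_cons]
        norm_num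
      have hbc : (Unitization.inr b * c).snd ∈ T₀ := by
        rcases hc with rfl | ⟨m, hm, rfl⟩
        · exact hST _ (by simpa using hb)
        · exact Or.inl (Or.inl (Or.inl (Or.inr ⟨b, hb, m, hm, by simp⟩)))
      have := hDd.add_smul_mem (by norm_num) (by norm_num) (hDd.add_smul_mem (by norm_num)
        (by norm_num) (hterm 1 (Or.inl rfl) a (hST a ha) _ hbc)
        (hDd.neg_mem_smul (hterm 1 (Or.inl rfl) (a * b)
          (Or.inl (Or.inl (Or.inr ⟨a, ha, b, hb, rfl⟩))) _ (hcT c hc))))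
        (hterm (Unitization.inr a) (Or.inr ⟨a, Or.inr ha, rfl⟩) b (hST b hb) _ (hcT c hc))
      rwa [show (1 / 3 + 1 / 3 + 1 / 3 : ℝ) = 1 by norm_num, Complex.ofReal_one, one_smul] at this
    exact fun x hx => this hx
  have hone : Omega.form 1 [] ∈ D := subset_diskHull _ ⟨1, [], Or.inl rfl, by simp, rfl⟩
  have hMT' : IsBounded (M ∪ T ∪ {0}) := (hMb.union hTb).union isBounded_singleton
  -- Closure of D under products is not needed: the elements of D that multiply D into itself from
  -- the left form a semigroup, bounded together with D.
  refine NilSet.of_subsemigroup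
    { carrier := {x : EvenForms A | x.val ∈ D ∧ ∀ y ∈ D, Omega.fedosov A x.val y ∈ D}
      mul_mem' := fun {x y} hx hy => by
        refine ⟨hx.2 _ hy.1, fun z hz => ?_⟩
        rw [EvenForms.val_mul, Omega.fedosov_assoc]
        exact hx.2 _ (hy.2 z hz) } ?_ ?_
  -- The disk D lives among all forms, including odd ones and 1. The projection to even forms over
  -- A, which fixes x, transfers the bound.
  · refine (isBounded_iff.2 ⟨⟨_, hMT'⟩, subset_rfl⟩).subset fun x hx => ?_
    have := proj_diskHull (S := M ∪ T)
      (diskHull_mono (Omega.forms_mono Set.subset_union_left Set.subset_union_right) hx.1)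
    rwa [proj_val] at this
  · rintro _ (⟨r, hr, rfl⟩ | ⟨a, ha, b, hb, rfl⟩)
    · refine ⟨?_, h1 r hr⟩
      have := h1 r hr _ hone
      rwa [Omega.form, Omega.fedosov_zeroForm_closed] at this
    · change (curvature (incl A) a b).val ∈ D ∧
        ∀ y ∈ D, Omega.fedosov A (curvature (incl A) a b).val y ∈ D
      rw [val_curvature_incl]
      refine ⟨subset_diskHull _ ⟨1, [a, b], Or.inl rfl, ?_, rfl⟩, h2 a ha b hb⟩
      exact hcons [] (by simp) _ (hTmem1 _ (hST a ha)) _ (hTmem1 _ (hST b hb))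

end CurvatureBounds

/-! ### Linear paths with analytically nilpotent curvature. -/

section Homotopies

set_option linter.unusedSectionVars false

variable {E T : Type*} [NonUnitalRing E] [Module ℂ E] [Bornology E] [BornologicalAlgebra E]
  [NonUnitalRing T] [Module ℂ T] [Bornology T] [BornologicalAlgebra T]

/-- The canonical homomorphism into the completion. -/
def Completion.naturalHom : T →ₙₐ[ℂ] Completion T :=
  { Completion.natural T with
    map_zero' := map_zero (Completion.natural T)
    map_mul' := fun _ _ => rfl }

theorem Completion.naturalHom_apply (x : T) :
    Completion.naturalHom x = Completion.natural T x := rfl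

theorem Completion.boundedMap_naturalHom :
    BoundedMap (Completion.naturalHom : T → Completion T) := Completion.boundedMap_natural

theorem Completion.mapHom_natural (f : E →ₙₐ[ℂ] T) (hf : BoundedMap f) (x : E) :
    Completion.mapHom f hf (Completion.natural E x) = Completion.natural T (f x) := rfl

/-- The products `ω_q(x, y)` and `(x - q x) (y - q y)` that measure how far a linear map `q` is
from being a homomorphism and from being the identity map. -/
def defectSet (q : E →ₗ[ℂ] E) (S : Set E) : Set E :=
  Set.image2 (curvature q) S S ∪ Set.image2 (fun x y => (x - q x) * (y - q y)) S S

/-- The path of linear maps `j ∘ q + u j ∘ (id - q)`. -/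
noncomputable def homotopyMap (u : SmoothFn) (j : E →ₗ[ℂ] T) (q : E →ₗ[ℂ] E) :
    E →ₗ[ℂ] SmoothFn ⊗[ℂ] T :=
  TensorProduct.mk ℂ SmoothFn T 1 ∘ₗ j ∘ₗ q +
    TensorProduct.mk ℂ SmoothFn T u ∘ₗ j ∘ₗ (LinearMap.id - q)

theorem homotopyMap_apply (u : SmoothFn) (j : E →ₗ[ℂ] T) (q : E →ₗ[ℂ] E) (x : E) :
    homotopyMap u j q x = 1 ⊗ₜ j (q x) + u ⊗ₜ j (x - q x) := rfl

/-- With k = id - q, the mixed products qx · ky and kx · qy occur with the same factor u in the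
image of xy and in the product of the images, so they cancel up to the curvature of j. The quadratic
part leaves u - u² = u(1 - u). -/
theorem curvature_homotopyMap (u : SmoothFn) (j : E →ₗ[ℂ] T) (q : E →ₗ[ℂ] E) (x y : E) :
    curvature (homotopyMap u j q) x y =
      (1 - u) ⊗ₜ j (curvature q x y) + (u * (1 - u)) ⊗ₜ j ((x - q x) * (y - q y)) +
      1 ⊗ₜ curvature j (q x) (q y) + u ⊗ₜ curvature j (q x) (y - q y) +
      u ⊗ₜ curvature j (x - q x) (q y) + (u * u) ⊗ₜ curvature j (x - q x) (y - q y) := by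
  simp only [curvature, homotopyMap_apply, add_mul, mul_add, sub_mul, mul_sub, map_sub,
    TensorProduct.sub_tmul, TensorProduct.tmul_sub,
    Algebra.TensorProduct.tmul_mul_tmul, one_mul, mul_one]
  abel

theorem boundedMap_homotopyMap (u : SmoothFn) {j : E →ₗ[ℂ] T} {q : E →ₗ[ℂ] E}
    (hj : BoundedMap j) (hq : BoundedMap q) : BoundedMap (homotopyMap u j q) :=
  BoundedMap.add (f := TensorProduct.mk ℂ SmoothFn T 1 ∘ₗ j ∘ₗ q)
    (g := TensorProduct.mk ℂ SmoothFn T u ∘ₗ j ∘ₗ (LinearMap.id - q))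
    ((boundedMap_tmul 1).comp (hj.comp hq))
    ((boundedMap_tmul u).comp (hj.comp (BoundedMap.sub (f := LinearMap.id) boundedMap_id hq)))

/-- All scalar factors in the curvature are monomials in u and 1 - u, so after rescaling it lies in
the hull of tensors of scaled monomials with a nilpotent set. The arbitrary scalar c in the
hypothesis pays for the rescaling. -/
theorem isLanilcur_homotopyMap {u : SmoothFn} (hu : u = SmoothFn.coord ∨ u = 1 - SmoothFn.coord)
    {j : E →ₗ[ℂ] T} {q : E →ₗ[ℂ] E} (hj : BoundedMap j) (hq : BoundedMap q)
    (hnil : ∀ S : Set E, IsBounded S → ∀ c : ℂ,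
      NilSet (c • (j '' defectSet q S ∪ Set.image2 (curvature j) S S))) :
    IsLanilcur (homotopyMap u j q) where
  bounded := boundedMap_homotopyMap u hj hq
  curvature_bounded S hS := by
    have hk : BoundedMap (LinearMap.id - q : E →ₗ[ℂ] E) :=
      BoundedMap.sub (f := LinearMap.id) boundedMap_id hq
    -- The curvature of j is evaluated at qx and x - qx as well, so S is enlarged accordingly.
    set S' : Set E := (S ∪ q '' S) ∪ (LinearMap.id - q : E →ₗ[ℂ] E) '' S with hS'
    have hSb : IsBounded S' := (hS.union (hq S hS)).union (hk S hS)
    set X : Set T := j '' defectSet q S' ∪ Set.image2 (curvature j) S' S' with hX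
    -- The constant is 24 = 4 · 6: the factor 4 undoes the scaling of the monomial, and 6 is the
    -- number of summands in `curvature_homotopyMap`.
    set D := diskHull (Set.image2 (fun f x => f ⊗ₜ[ℂ] x) (SmoothFn.scaledMonomials : Set SmoothFn)
      ((24 : ℂ) • X)) with hD
    have hDd : IsDisk D := isDisk_diskHull _
    refine NilSet.mono (SmoothFn.nilSet_scaledMonomials.tmul (hnil S' hSb 24)).diskHull ?_
    have hterm : ∀ (f : SmoothFn), (1 / 4 : ℂ) • f ∈ SmoothFn.scaledMonomials → ∀ x ∈ X,
        f ⊗ₜ[ℂ] x ∈ ((1 / 6 : ℝ) : ℂ) • D := by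
      intro f hf x hx
      refine mem_smul_diskHull (by norm_num) ⟨_, hf, _, ⟨x, hx, rfl⟩, ?_⟩
      simp only [TensorProduct.smul_tmul_smul]
      norm_num
    have hmon : ∀ (f : SmoothFn) (a b : ℕ), a + b ≤ 4 → f = u ^ a * (1 - u) ^ b →
        (1 / 4 : ℂ) • f ∈ SmoothFn.scaledMonomials := by
      rintro _ a b h rfl
      exact SmoothFn.smul_pow_mem_scaledMonomials hu h
    rintro _ ⟨x, hx, y, hy, rfl⟩
    have hxS : x ∈ S' := Or.inl (Or.inl hx)
    have hyS : y ∈ S' := Or.inl (Or.inl hy)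
    have hqS : ∀ z ∈ S, q z ∈ S' := fun z hz => Or.inl (Or.inr ⟨z, hz, rfl⟩)
    have hkS : ∀ z ∈ S, z - q z ∈ S' := fun z hz => Or.inr ⟨z, hz, rfl⟩
    have h1 := hterm _ (hmon (1 - u) 0 1 (by norm_num) (by ring)) (j (curvature q x y))
      (Or.inl ⟨_, Or.inl ⟨x, hxS, y, hyS, rfl⟩, rfl⟩)
    have h2 := hterm _ (hmon (u * (1 - u)) 1 1 (by norm_num) (by ring))
      (j ((x - q x) * (y - q y))) (Or.inl ⟨_, Or.inr ⟨x, hxS, y, hyS, rfl⟩, rfl⟩)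
    have h3 := hterm _ (hmon 1 0 0 (by norm_num) (by ring)) (curvature j (q x) (q y))
      (Or.inr ⟨_, hqS x hx, _, hqS y hy, rfl⟩)
    have hu1 := hmon u 1 0 (by norm_num) (by ring)
    have h4 := hterm _ hu1 (curvature j (q x) (y - q y))
      (Or.inr ⟨_, hqS x hx, _, hkS y hy, rfl⟩)
    have h5 := hterm _ hu1 (curvature j (x - q x) (q y))
      (Or.inr ⟨_, hkS x hx, _, hqS y hy, rfl⟩)
    have h6 := hterm _ (hmon (u * u) 2 0 (by norm_num) (by ring))
      (curvature j (x - q x) (y - q y)) (Or.inr ⟨_, hkS x hx, _, hkS y hy, rfl⟩)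
    have h12 := hDd.add_smul_mem (by norm_num) (by norm_num) h1 h2
    have h13 := hDd.add_smul_mem (by norm_num) (by norm_num) h12 h3
    have h14 := hDd.add_smul_mem (by norm_num) (by norm_num) h13 h4
    have h15 := hDd.add_smul_mem (by norm_num) (by norm_num) h14 h5
    have h16 := hDd.add_smul_mem (by norm_num) (by norm_num) h15 h6
    rwa [← curvature_homotopyMap, show (1 / 6 + 1 / 6 + 1 / 6 + 1 / 6 + 1 / 6 + 1 / 6 : ℝ) = 1 by
      norm_num, Complex.ofReal_one, one_smul] at h16

/-- The identity map has zero curvature. This value 0 is itself a defect, namely ω_q(0, 0), once 0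
has been added to S. -/
theorem isLanilcur_homotopyMap_id {u : SmoothFn}
    (hu : u = SmoothFn.coord ∨ u = 1 - SmoothFn.coord) {q : E →ₗ[ℂ] E} (hq : BoundedMap q)
    (hnil : ∀ S : Set E, IsBounded S → ∀ c : ℂ, NilSet (c • defectSet q S)) :
    IsLanilcur (homotopyMap u LinearMap.id q) := by
  refine isLanilcur_homotopyMap hu boundedMap_id hq fun S hS c =>
    (hnil (S ∪ {0}) (hS.union isBounded_singleton) c).mono (Set.smul_set_mono ?_)
  rintro _ (⟨x, hx, rfl⟩ | ⟨x, hx, y, hy, rfl⟩)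
  · rcases hx with ⟨x, hx, y, hy, rfl⟩ | ⟨x, hx, y, hy, rfl⟩
    · exact Or.inl ⟨x, Or.inl hx, y, Or.inl hy, rfl⟩
    · exact Or.inr ⟨x, Or.inl hx, y, Or.inl hy, rfl⟩
  · exact Or.inl ⟨0, Or.inr rfl, 0, Or.inr rfl, by simp [curvature]⟩

end Homotopies

/-! ### Evaluation of paths at a point. -/

section Evaluation

set_option linter.unusedSectionVars false

variable {T : Type*} [NonUnitalRing T] [Module ℂ T] [Bornology T] [CompleteBornologicalAlgebra T]

variable (T) in
/-- Evaluation as a homomorphism on the algebraic tensor product. -/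
noncomputable def evalTensor (t : Set.Icc (0 : ℝ) 1) : SmoothFn ⊗[ℂ] T →ₙₐ[ℂ] T :=
  { TensorProduct.lift (evalBilin T t) with
    map_zero' := map_zero (TensorProduct.lift (evalBilin T t))
    map_mul' := fun x y => by
      change TensorProduct.lift (evalBilin T t) (x * y) =
        TensorProduct.lift (evalBilin T t) x * TensorProduct.lift (evalBilin T t) y
      induction x using TensorProduct.induction_on with
      | zero => simp
      | add x x' hx hx' => rw [add_mul, map_add, map_add, hx, hx', add_mul]
      | tmul f a =>
        induction y using TensorProduct.induction_on with
        | zero => simp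
        | add y y' hy hy' => rw [mul_add, map_add, map_add, hy, hy', mul_add]
        | tmul g b => simp [evalBilin, smul_mul_smul_comm] }

theorem evalTensor_tmul (t : Set.Icc (0 : ℝ) 1) (f : SmoothFn) (b : T) :
    evalTensor T t (f ⊗ₜ b) = SmoothFn.eval t f • b := rfl

theorem evalAt_natural (t : Set.Icc (0 : ℝ) 1) (x : SmoothFn ⊗[ℂ] T) :
    evalAt T t (Completion.natural _ x) = evalTensor T t x :=
  Completion.lift_natural _ (boundedMap_evalBilin t) x

theorem evalTensor_homotopyMap {E : Type*} [NonUnitalRing E] [Module ℂ E]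
    [Bornology E] [BornologicalAlgebra E] (t : Set.Icc (0 : ℝ) 1)
    (u : SmoothFn) (j : E →ₗ[ℂ] T) (q : E →ₗ[ℂ] E) (x : E) :
    evalTensor T t (homotopyMap u j q x) = j (q x) + SmoothFn.eval t u • j (x - q x) := by
  rw [homotopyMap_apply, map_add, evalTensor_tmul, evalTensor_tmul, map_one, one_smul]

end Evaluation

/-! ### Homotopies on the analytic tensor algebra. -/

section AnalyticTensorAlgebra

set_option linter.unusedSectionVars false

variable {A E : Type*} [NonUnitalRing A] [Module ℂ A] [Bornology A] [BornologicalAlgebra A]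
  [NonUnitalRing E] [Module ℂ E] [Bornology E] [BornologicalAlgebra E]

namespace AnTensor

variable (A) in
/-- The canonical bounded linear map `A → 𝒯 A`. -/
noncomputable def incl : A →ₗ[ℂ] AnTensor A := Completion.natural _ ∘ₗ EvenForms.incl A

variable (A) in
theorem boundedMap_incl : BoundedMap (incl A) :=
  Completion.boundedMap_natural.comp (EvenForms.boundedMap_incl A)

/-- Bounded linear maps on a completion are determined by the uncompleted space, and homomorphisms
on the even forms by A. Multiplicativity is needed only before completion, which is why f' and g'
appear separately. -/
theorem ext {Y : Type*} [NonUnitalRing Y] [Module ℂ Y] [Bornology Y]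
    [CompleteBornologicalAlgebra Y] {f g : AnTensor A →ₗ[ℂ] Y} (hf : BoundedMap f)
    (hg : BoundedMap g) (f' g' : EvenForms A →ₙₐ[ℂ] Y)
    (hf' : ∀ v, f (Completion.natural _ v) = f' v) (hg' : ∀ v, g (Completion.natural _ v) = g' v)
    (h : ∀ a, f' (EvenForms.incl A a) = g' (EvenForms.incl A a)) (x : AnTensor A) :
    f x = g x := by
  have hfg : ∀ v, f (Completion.natural _ v) = g (Completion.natural _ v) := fun v => by
    rw [hf', hg', EvenForms.hom_ext h]
  have hb : BoundedMap (g ∘ₗ Completion.natural (EvenForms A)) :=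
    hg.comp Completion.boundedMap_natural
  have h1 := Completion.lift_unique _ hb f hf hfg
  have h2 := Completion.lift_unique _ hb g hg fun _ => rfl
  rw [h1, ← h2]

/-- Bilinearity absorbs the scalar: c ω(x, y) = ω(cx, y), so S is enlarged by c • S, while the
factor 2 required by `EvenForms.nilSet_incl` is covered by the hypothesis at 2c. -/
theorem nilSet_incl {q : E →ₗ[ℂ] E}
    (hnil : ∀ S : Set E, IsBounded S → ∀ c : ℂ, NilSet (c • defectSet q S)) {S : Set E}
    (hS : IsBounded S) (c : ℂ) :
    NilSet (c • (incl E '' defectSet q S ∪ Set.image2 (curvature (incl E)) S S)) := by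
  have h := EvenForms.nilSet_incl (R := c • defectSet q S) (S := S ∪ c • S)
    (by simpa [smul_smul] using hnil S hS (2 * c)) (hS.union (isBounded_smul hS c))
  refine (h.image Completion.naturalHom Completion.boundedMap_naturalHom).mono ?_
  rintro _ ⟨_, ⟨x, hx, rfl⟩ | ⟨x, hx, y, hy, rfl⟩, rfl⟩
  · exact ⟨_, Or.inl ⟨_, ⟨x, hx, rfl⟩, rfl⟩, by simp [incl, Completion.naturalHom_apply]⟩
  · refine ⟨_, Or.inr ⟨c • x, Or.inr ⟨x, hx, rfl⟩, y, Or.inl hy, rfl⟩, ?_⟩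
    rw [curvature_smul_left, map_smul, curvature, map_sub, map_mul Completion.naturalHom]
    rfl

/-- The homotopy on `𝒯 E` induced by a path of linear maps from `j ∘ q` to `j`. -/
theorem exists_homotopy {T : Type*} [NonUnitalRing T] [Module ℂ T] [Bornology T]
    [CompleteBornologicalAlgebra T] {j : E →ₗ[ℂ] T} {q : E →ₗ[ℂ] E} (hj : BoundedMap j)
    (hq : BoundedMap q) (hnil : ∀ S : Set E, IsBounded S → ∀ c : ℂ,
      NilSet (c • (j '' defectSet q S ∪ Set.image2 (curvature j) S S))) {u : SmoothFn}
    (hu : u = SmoothFn.coord ∨ u = 1 - SmoothFn.coord) :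
    ∃ H : AnTensor E →ₙₐ[ℂ] SmoothPaths T, BoundedMap H ∧
      ∀ t, ∃ g : EvenForms E →ₙₐ[ℂ] T,
        (∀ v, evalAt T t (H (Completion.natural _ v)) = g v) ∧
        ∀ x, g (EvenForms.incl E x) = j (q x) + SmoothFn.eval t u • j (x - q x) := by
  have hl := isLanilcur_homotopyMap hu hj hq hnil
  -- The path is already a lanilcur into the algebraic tensor product. Its extension to even forms
  -- can therefore be completed on both sides at once.
  refine ⟨Completion.mapHom _ (EvenForms.boundedMap_lift hl), Completion.boundedMap_map _ _,
    fun t => ⟨(evalTensor T t).comp (EvenForms.lift (homotopyMap u j q)),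
      fun v => ?_, fun x => ?_⟩⟩
  · rw [Completion.mapHom_natural]
    exact evalAt_natural t _
  · rw [NonUnitalAlgHom.comp_apply, EvenForms.lift_incl, evalTensor_homotopyMap]

/-- Specializes `AnTensor.ext` to evaluated homotopies. Taking φ to be the identity handles the end
points, and taking φ to be a section handles constancy along it. -/
theorem evalAt_eq {T : Type*} [NonUnitalRing T] [Module ℂ T] [Bornology T]
    [CompleteBornologicalAlgebra T] {H : AnTensor E →ₙₐ[ℂ] SmoothPaths T} (hH : BoundedMap H)
    {t : Set.Icc (0 : ℝ) 1} {g : EvenForms E →ₙₐ[ℂ] T}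
    (hg : ∀ v, evalAt T t (H (Completion.natural _ v)) = g v)
    {φ : AnTensor A →ₙₐ[ℂ] AnTensor E} (hφ : BoundedMap φ) {φ' : EvenForms A →ₙₐ[ℂ] EvenForms E}
    (hφ' : ∀ v, φ (Completion.natural _ v) = Completion.natural _ (φ' v))
    {ψ : AnTensor A →ₙₐ[ℂ] T} (hψ : BoundedMap ψ) {ψ' : EvenForms A →ₙₐ[ℂ] T}
    (hψ' : ∀ v, ψ (Completion.natural _ v) = ψ' v)
    (h : ∀ a, g (φ' (EvenForms.incl A a)) = ψ' (EvenForms.incl A a)) (x : AnTensor A) :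
    evalAt T t (H (φ x)) = ψ x :=
  AnTensor.ext (f := evalAt T t ∘ₗ (H : AnTensor E →ₗ[ℂ] SmoothPaths T) ∘ₗ
      (φ : AnTensor A →ₗ[ℂ] AnTensor E)) (g := (ψ : AnTensor A →ₗ[ℂ] T))
    ((Completion.boundedMap_lift _ (boundedMap_evalBilin t)).comp (hH.comp hφ)) hψ (g.comp φ') ψ'
    (fun v => by
      change evalAt T t (H (φ _)) = g (φ' v)
      rw [hφ', hg]) hψ' h x

end AnTensor

end AnalyticTensorAlgebra

/-! ### Nilpotence estimates in an analytically nilpotent extension. -/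

section Extensions

set_option linter.unusedSectionVars false

variable {N E A : Type*} [NonUnitalRing N] [Module ℂ N] [Bornology N] [BornologicalAlgebra N]
  [NonUnitalRing E] [Module ℂ E] [Bornology E] [BornologicalAlgebra E]
  [NonUnitalRing A] [Module ℂ A] [Bornology A] [BornologicalAlgebra A]

/-- The set comes from N by exactness, is bounded there because N carries the subspace bornology,
and there generates a bounded semigroup. -/
theorem IsANilpotentExtension.nilSet {i : N →ₙₐ[ℂ] E} {p : E →ₙₐ[ℂ] A}
    (h : IsANilpotentExtension i p) {S : Set E} (hS : IsBounded S) (hp : ∀ x ∈ S, p x = 0) :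
    NilSet S := by
  have hi : i '' (i ⁻¹' S) = S :=
    Set.image_preimage_eq_of_subset fun x hx => (h.exact x).1 (hp x hx)
  have hb : IsBounded (i ⁻¹' S) := h.bounded_of_image _ (by rwa [hi])
  have := NilSet.image (h.nilpotent _ hb) i h.bounded_i
  rwa [hi] at this

theorem isBounded_defectSet {q : E →ₗ[ℂ] E} (hq : BoundedMap q) {S : Set E} (hS : IsBounded S) :
    IsBounded (defectSet q S) := by
  have hk : BoundedMap (LinearMap.id - q : E →ₗ[ℂ] E) := BoundedMap.sub (f := LinearMap.id) boundedMap_id hq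
  refine (isBounded_curvature hq hS).union
    ((BornologicalAlgebra.isBounded_mul _ _ (hk S hS) (hk S hS)).subset ?_)
  rintro _ ⟨x, hx, y, hy, rfl⟩
  exact ⟨_, ⟨x, hx, rfl⟩, _, ⟨y, hy, rfl⟩, rfl⟩

/-- Because p ∘ s ∘ p = p and p is multiplicative, both kinds of defects of s ∘ p lie in ker p. -/
theorem IsANilpotentExtension.nilSet_defectSet {i : N →ₙₐ[ℂ] E} {p : E →ₙₐ[ℂ] A}
    (h : IsANilpotentExtension i p) {s : A →ₗ[ℂ] E} (hs : BoundedMap s)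
    (hps : ∀ a, p (s a) = a) {S : Set E} (hS : IsBounded S) (c : ℂ) :
    NilSet (c • defectSet (s ∘ₗ (p : E →ₗ[ℂ] A)) S) := by
  refine h.nilSet (isBounded_smul (isBounded_defectSet (hs.comp h.bounded_p) hS) c) ?_
  rintro _ ⟨_, ⟨x, -, y, -, rfl⟩ | ⟨x, -, y, -, rfl⟩, rfl⟩ <;> simp [curvature, hps]

theorem IsANilpotentExtension.isLanilcur_section {i : N →ₙₐ[ℂ] E} {p : E →ₙₐ[ℂ] A}
    (h : IsANilpotentExtension i p) {s : A →ₗ[ℂ] E} (hs : BoundedMap s)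
    (hps : ∀ a, p (s a) = a) : IsLanilcur s where
  bounded := hs
  curvature_bounded S hS := h.nilSet (isBounded_curvature hs hS) (by
    rintro _ ⟨a, -, b, -, rfl⟩
    simp [curvature, hps])

/-- The composite of a section with the canonical map into the algebra of even forms. -/
theorem IsANilpotentExtension.isLanilcur_incl_section {i : N →ₙₐ[ℂ] E} {p : E →ₙₐ[ℂ] A}
    (h : IsANilpotentExtension i p) {s : A →ₗ[ℂ] E} (hs : BoundedMap s)
    (hps : ∀ a, p (s a) = a) : IsLanilcur (EvenForms.incl E ∘ₗ s) where
  bounded := (EvenForms.boundedMap_incl E).comp hs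
  curvature_bounded S hS := by
    -- The curvature of the composite is the image of ω_s(a, b) plus ω(sa, sb), with ω the curvature
    -- of the inclusion. Writing each summand as half of its double places the sum in a disked hull,
    -- whence the factors 2.
    refine NilSet.diskHull (EvenForms.nilSet_incl
      (R := (2 : ℂ) • Set.image2 (curvature s) S S) (S := s '' S ∪ (2 : ℂ) • s '' S)
      (h.nilSet (isBounded_smul (isBounded_smul (isBounded_curvature hs hS) 2) 2) ?_)
      ((hs S hS).union (isBounded_smul (hs S hS) 2))) |>.mono ?_
    · rintro _ ⟨_, ⟨_, ⟨a, -, b, -, rfl⟩, rfl⟩, rfl⟩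
      simp [curvature, hps]
    · rintro _ ⟨a, ha, b, hb, rfl⟩
      have := isDisk_diskHull _ _
        (subset_diskHull (EvenForms.incl E '' ((2 : ℂ) • Set.image2 (curvature s) S S) ∪
          Set.image2 (curvature (EvenForms.incl E)) (s '' S ∪ (2 : ℂ) • s '' S)
            (s '' S ∪ (2 : ℂ) • s '' S))
          (Or.inl ⟨_, ⟨_, ⟨a, ha, b, hb, rfl⟩, rfl⟩, rfl⟩)) _
        (subset_diskHull _ (Or.inr ⟨(2 : ℂ) • s a, Or.inr ⟨_, ⟨a, ha, rfl⟩, rfl⟩, s b,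
          Or.inl ⟨b, hb, rfl⟩, rfl⟩)) (1 / 2) (1 / 2) (by norm_num)
      convert this using 1
      simp [curvature_smul_left, smul_smul]
      simp [curvature]

end Extensions

/-! ### Contractions and deformations in both categories. -/

section Contraction

set_option linter.unusedSectionVars false

variable {N E A : Type*} [NonUnitalRing N] [Module ℂ N] [Bornology N]
  [CompleteBornologicalAlgebra N] [NonUnitalRing E] [Module ℂ E] [Bornology E]
  [CompleteBornologicalAlgebra E] [NonUnitalRing A] [Module ℂ A] [Bornology A]
  [CompleteBornologicalAlgebra A]

theorem SmoothFn.eval_zero_one_sub_coord : SmoothFn.eval 0 (1 - SmoothFn.coord) = 1 := by simp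

theorem SmoothFn.eval_one_one_sub_coord : SmoothFn.eval 1 (1 - SmoothFn.coord) = 0 := by simp

theorem SmoothFn.eval_zero_coord : SmoothFn.eval 0 SmoothFn.coord = 0 := by simp

theorem SmoothFn.eval_one_coord : SmoothFn.eval 1 SmoothFn.coord = 1 := by simp

/-- The lanilcur homotopy between the identity map and a nilpotent perturbation of it, which is
constant on the fixed points of the latter. -/
theorem exists_lanilcurHomotopy {q : E →ₗ[ℂ] E} (hq : BoundedMap q)
    (hnil : ∀ S : Set E, IsBounded S → ∀ c : ℂ, NilSet (c • defectSet q S)) :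
    ∃ H : E →ₗ[ℂ] SmoothPaths E, IsLanilcurHomotopy H LinearMap.id q ∧
      ∀ t x, q x = x → evalAt E t (H x) = x := by
  have hev : ∀ t x, evalAt E t (Completion.natural _
      (homotopyMap (1 - SmoothFn.coord) LinearMap.id q x)) =
        q x + SmoothFn.eval t (1 - SmoothFn.coord) • (x - q x) := fun t x =>
    (evalAt_natural t _).trans (evalTensor_homotopyMap _ _ _ _ _)
  refine ⟨Completion.natural _ ∘ₗ homotopyMap (1 - SmoothFn.coord) LinearMap.id q,
    ⟨(isLanilcur_homotopyMap_id (Or.inr rfl) hq hnil).comp Completion.naturalHom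
      Completion.boundedMap_naturalHom, fun x => (hev 0 x).trans ?_,
      fun x => (hev 1 x).trans ?_⟩, fun t x hx => (hev t x).trans ?_⟩
  · rw [SmoothFn.eval_zero_one_sub_coord, one_smul, add_sub_cancel, LinearMap.id_apply]
  · rw [SmoothFn.eval_one_one_sub_coord, zero_smul, add_zero]
  · rw [hx, sub_self, smul_zero, add_zero]

/-- This treats contraction as the case q = 0: the defects are 0 and the products xy, which form a
bounded subset of N. -/
theorem IsANilpotent.nilSet_defectSet_zero (hN : IsANilpotent N) {S : Set N} (hS : IsBounded S)
    (c : ℂ) : NilSet (c • defectSet (0 : N →ₗ[ℂ] N) S) :=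
  hN _ (isBounded_smul (isBounded_defectSet (fun S _ =>
    (isBounded_singleton (x := (0 : N))).subset (by rintro _ ⟨x, -, rfl⟩; rfl)) hS) c)

/-- The case q = id has no defects. It serves to produce constant homotopies. -/
theorem nilSet_defectSet_id (S : Set E) (c : ℂ) :
    NilSet (c • defectSet (LinearMap.id : E →ₗ[ℂ] E) S) :=
  nilSet_zero.mono (by
    rintro _ ⟨_, ⟨x, -, y, -, rfl⟩ | ⟨x, -, y, -, rfl⟩, rfl⟩ <;> simp [curvature])

/-- Bounded homomorphisms on `𝒯 E` that restrict to linear maps `j` and `j ∘ q` are smoothly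
homotopic if `q` is a perturbation of the identity map that is nilpotent with respect to `j`. -/
theorem AnTensor.exists_smoothHomotopy {T : Type*} [NonUnitalRing T] [Module ℂ T] [Bornology T]
    [CompleteBornologicalAlgebra T] {j : E →ₗ[ℂ] T} {q : E →ₗ[ℂ] E} (hj : BoundedMap j)
    (hq : BoundedMap q) (hnil : ∀ S : Set E, IsBounded S → ∀ c : ℂ,
      NilSet (c • (j '' defectSet q S ∪ Set.image2 (curvature j) S S)))
    {ψ₀ ψ₁ : AnTensor E →ₙₐ[ℂ] T} (hψ₀ : BoundedMap ψ₀) (hψ₁ : BoundedMap ψ₁)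
    {χ₀ χ₁ : EvenForms E →ₙₐ[ℂ] T} (hχ₀ : ∀ v, ψ₀ (Completion.natural _ v) = χ₀ v)
    (hχ₁ : ∀ v, ψ₁ (Completion.natural _ v) = χ₁ v) (h₀ : ∀ x, χ₀ (EvenForms.incl E x) = j x)
    (h₁ : ∀ x, χ₁ (EvenForms.incl E x) = j (q x)) :
    (∃ H : AnTensor E →ₙₐ[ℂ] SmoothPaths T, IsSmoothHomotopy H ψ₀ ψ₁ ∧
      ∀ (σ : AnTensor A →ₙₐ[ℂ] AnTensor E) (σ' : EvenForms A →ₙₐ[ℂ] EvenForms E)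
        (s : A →ₗ[ℂ] E), BoundedMap σ →
        (∀ v, σ (Completion.natural _ v) = Completion.natural _ (σ' v)) →
        (∀ a, σ' (EvenForms.incl A a) = EvenForms.incl E (s a)) → (∀ a, q (s a) = s a) →
        ∀ t a, evalAt T t (H (σ a)) = ψ₀ (σ a)) ∧
    SmoothlyHomotopic ψ₁ ψ₀ := by
  have hid : BoundedMap (NonUnitalAlgHom.id ℂ (AnTensor E)) := boundedMap_id
  constructor
  · obtain ⟨H, hH, hg⟩ := AnTensor.exists_homotopy hj hq hnil (u := 1 - SmoothFn.coord) (Or.inr rfl)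
    refine ⟨H, ⟨hH, fun x => ?_, fun x => ?_⟩, ?_⟩
    · obtain ⟨g, hg, hgx⟩ := hg 0
      refine AnTensor.evalAt_eq hH hg hid (φ' := NonUnitalAlgHom.id ℂ _) (fun _ => rfl) hψ₀ hχ₀
        (fun a => (hgx a).trans ?_) x
      rw [SmoothFn.eval_zero_one_sub_coord, one_smul, ← map_add, add_sub_cancel, h₀]
    · obtain ⟨g, hg, hgx⟩ := hg 1
      refine AnTensor.evalAt_eq hH hg hid (φ' := NonUnitalAlgHom.id ℂ _) (fun _ => rfl) hψ₁ hχ₁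
        (fun a => (hgx a).trans ?_) x
      rw [SmoothFn.eval_one_one_sub_coord, zero_smul, add_zero, h₁]
    · intro σ σ' s hσ hσ' hs hqs t a
      obtain ⟨g, hg, hgx⟩ := hg t
      refine AnTensor.evalAt_eq hH hg hσ hσ' (ψ := ψ₀.comp σ) (hψ₀.comp hσ) (ψ' := χ₀.comp σ')
        (fun v => ?_) (fun a => ?_) a
      · rw [NonUnitalAlgHom.comp_apply, NonUnitalAlgHom.comp_apply, hσ', hχ₀]
      -- On s(A) the map q is the identity, so the t-dependent term j(x - qx) vanishes.
      · rw [NonUnitalAlgHom.comp_apply, hs, hgx, hqs, sub_self, map_zero, smul_zero, add_zero, h₀]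
  -- Time is reversed by using u = t instead of 1 - t, so no reparametrization of paths is needed.
  · obtain ⟨H, hH, hg⟩ := AnTensor.exists_homotopy hj hq hnil (u := SmoothFn.coord) (Or.inl rfl)
    refine ⟨H, ⟨hH, fun x => ?_, fun x => ?_⟩⟩
    · obtain ⟨g, hg, hgx⟩ := hg 0
      refine AnTensor.evalAt_eq hH hg hid (φ' := NonUnitalAlgHom.id ℂ _) (fun _ => rfl) hψ₁ hχ₁
        (fun a => (hgx a).trans ?_) x
      rw [SmoothFn.eval_zero_coord, zero_smul, add_zero, h₁]
    · obtain ⟨g, hg, hgx⟩ := hg 1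
      refine AnTensor.evalAt_eq hH hg hid (φ' := NonUnitalAlgHom.id ℂ _) (fun _ => rfl) hψ₀ hχ₀
        (fun a => (hgx a).trans ?_) x
      rw [SmoothFn.eval_one_coord, one_smul, ← map_add, add_sub_cancel, h₀]

end Contraction

end BornAlg

/-! ### The Goodwillie-type theorem. -/

theorem mainTheorem7 {N E A : Type*}
    [NonUnitalRing N] [Module ℂ N] [Bornology N] [BornAlg.CompleteBornologicalAlgebra N]
    [NonUnitalRing E] [Module ℂ E] [Bornology E] [BornAlg.CompleteBornologicalAlgebra E]
    [NonUnitalRing A] [Module ℂ A] [Bornology A] [BornAlg.CompleteBornologicalAlgebra A]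
    (i : N →ₙₐ[ℂ] E) (p : E →ₙₐ[ℂ] A) (h : BornAlg.IsANilpotentExtension i p) :
    BornAlg.LanilcurContractible N ∧
    BornAlg.IsLanilcurDeformationRetraction (p : E →ₗ[ℂ] A) ∧
    BornAlg.SmoothlyContractible (BornAlg.AnTensor N) ∧
    BornAlg.IsSmoothDeformationRetraction (BornAlg.AnTensor.map p h.bounded_p) ∧
    BornAlg.IsSmoothHomotopyEquiv (BornAlg.AnTensor.map p h.bounded_p) := by
  open BornAlg in
  obtain ⟨s, hs, hps⟩ := h.allowable
  have hp := h.bounded_p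
  set q : E →ₗ[ℂ] E := s ∘ₗ (p : E →ₗ[ℂ] A) with hqdef
  have hq : BoundedMap q := hs.comp hp
  have hqs : ∀ a, q (s a) = s a := fun a => congrArg s (hps a)
  have hnil : ∀ S : Set E, IsBounded S → ∀ c : ℂ, NilSet (c • defectSet q S) :=
    fun S hS c => h.nilSet_defectSet hs hps hS c
  have hN0 : BoundedMap (0 : N →ₗ[ℂ] N) := fun S _ =>
    (isBounded_singleton (x := (0 : N))).subset (by rintro _ ⟨x, -, rfl⟩; rfl)
  have hNnil : ∀ S : Set N, IsBounded S → ∀ c : ℂ, NilSet (c • defectSet (0 : N →ₗ[ℂ] N) S) :=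
    fun S hS c => h.nilpotent.nilSet_defectSet_zero hS c
  have hls := h.isLanilcur_incl_section hs hps
  set σ' : EvenForms A →ₙₐ[ℂ] EvenForms E := EvenForms.lift (EvenForms.incl E ∘ₗ s) with hσ'
  have hσ'b : BoundedMap σ' := EvenForms.boundedMap_lift hls
  have hσ's : ∀ a, σ' (EvenForms.incl A a) = EvenForms.incl E (s a) := fun a =>
    EvenForms.lift_incl _ a
  -- The section of 𝒯p extends the lanilcur a ↦ s(a) ∈ 𝒯E. In general it is not 𝒯s, since s need not
  -- be multiplicative.
  set σ : AnTensor A →ₙₐ[ℂ] AnTensor E := Completion.mapHom σ' hσ'b with hσ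
  have hσb : BoundedMap σ := Completion.boundedMap_map _ hσ'b
  have hTp : BoundedMap (AnTensor.map p hp) := Completion.boundedMap_map _ _
  have hpσ : ∀ a, AnTensor.map p hp (σ a) = a := AnTensor.ext
    (f := (AnTensor.map p hp : AnTensor E →ₗ[ℂ] AnTensor A) ∘ₗ (σ : AnTensor A →ₗ[ℂ] AnTensor E))
    (g := LinearMap.id) (hTp.comp hσb) boundedMap_id
    (Completion.naturalHom.comp ((EvenForms.map p).comp σ')) Completion.naturalHom
    (fun _ => rfl) (fun _ => rfl) fun a => by
      rw [NonUnitalAlgHom.comp_apply, NonUnitalAlgHom.comp_apply, hσ's, EvenForms.map_incl, hps]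
  -- On E, the composite σ ∘ 𝒯p restricts to x ↦ s(p x) = q x inside 𝒯E. It is therefore the end
  -- point that belongs to j ∘ q.
  obtain ⟨⟨H, hH, hHs⟩, hsym⟩ := AnTensor.exists_smoothHomotopy (A := A) (AnTensor.boundedMap_incl E)
    hq (fun S hS c => AnTensor.nilSet_incl hnil hS c) (ψ₀ := NonUnitalAlgHom.id ℂ (AnTensor E))
    (ψ₁ := σ.comp (AnTensor.map p hp)) boundedMap_id (hσb.comp hTp)
    (χ₀ := Completion.naturalHom)
    (χ₁ := Completion.naturalHom.comp (σ'.comp (EvenForms.map p))) (fun _ => rfl) (fun _ => rfl)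
    (fun _ => rfl) (fun x => by
      rw [NonUnitalAlgHom.comp_apply, NonUnitalAlgHom.comp_apply, EvenForms.map_incl, hσ's]
      rfl)
  refine ⟨?_, ⟨isLanilcur_of_mul hp fun a b => by simp [curvature],
    s, h.isLanilcur_section hs hps, hps, ?_⟩, ?_, ⟨hTp, σ, hσb, hpσ, H, hH, fun t a =>
      hHs σ σ' s hσb (fun _ => rfl) hσ's hqs t a⟩, hTp, σ, hσb, hsym, ?_⟩
  · obtain ⟨H, hH, -⟩ := exists_lanilcurHomotopy hN0 hNnil
    exact ⟨H, hH⟩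
  · obtain ⟨H, hH, hc⟩ := exists_lanilcurHomotopy hq hnil
    exact ⟨H, hH, fun t a => hc t (s a) (hqs a)⟩
  -- With q = 0 on N, the end point j ∘ q = 0 extends to the zero homomorphism on 𝒯N.
  · obtain ⟨⟨H, hH, -⟩, -⟩ := AnTensor.exists_smoothHomotopy (A := N) (AnTensor.boundedMap_incl N)
      hN0 (fun S hS c => AnTensor.nilSet_incl hNnil hS c)
      (ψ₀ := NonUnitalAlgHom.id ℂ (AnTensor N)) (ψ₁ := 0) boundedMap_id
      (fun S _ => (isBounded_singleton (x := (0 : AnTensor N))).subset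
        (by rintro _ ⟨x, -, rfl⟩; rfl))
      (χ₀ := Completion.naturalHom) (χ₁ := 0) (fun _ => rfl) (fun _ => rfl)
      (fun _ => rfl) (fun x => by simp)
    exact ⟨H, hH⟩
  · have hid : (AnTensor.map p hp).comp σ = NonUnitalAlgHom.id ℂ (AnTensor A) :=
      NonUnitalAlgHom.ext hpσ
    rw [hid]
    -- As 𝒯p ∘ σ is equal to the identity, only the constant homotopy is required, and q = id
    -- supplies it.
    exact (AnTensor.exists_smoothHomotopy (A := A) (AnTensor.boundedMap_incl A)
      (q := LinearMap.id) boundedMap_id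
      (fun S hS c => AnTensor.nilSet_incl (fun S _ c => nilSet_defectSet_id S c) hS c)
      (ψ₀ := NonUnitalAlgHom.id ℂ (AnTensor A)) (ψ₁ := NonUnitalAlgHom.id ℂ (AnTensor A))
      boundedMap_id boundedMap_id (χ₀ := Completion.naturalHom) (χ₁ := Completion.naturalHom)
      (fun _ => rfl) (fun _ => rfl) (fun _ => rfl) (fun _ => rfl)).2
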